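/- Let $R(x)=(1+|x|^2)^{1/2}$ for $x\in\mathbb R^3$ and, for $g:\mathbb R^3\to\mathbb R$ and $q>0$, put $\|g\|_\infty=\sup_x|g(x)|$ and $\|g\|_q=\sup_x|g(x)|R(x)^q\in[0,\infty]$. Let $p\in(3,4)$, $T>0$, and let $F:\mathbb R^3\to[0,\infty)$, $f_0:\mathbb R^3\times\mathbb R^3\to[0,\infty)$, $A:[0,\infty)\times\mathbb R^3\to\mathbb R^3$ satisfy, for some constant $c>0$: (I) $F(v)=F_R(|v|)$ is $C^2$ with $F_R''(0)<0$, and there is $W\in(0,\infty)$ with $F_R'(u)<0$ for $u\in(0,W)$ and $F_R(u)=0$ for $u\ge W$; (II) $f_0$ is $C^1$; (III) $A$ is $C^1$ and, for all $t\ge0$, $x\in\mathbb R^3$, $i\in\{1,2,3\}$, $|A(t,x)|\le c\,R(x)^{-2}$, $|\partial_{x_i}A(t,x)|\le c\,R(x)^{-3}$ and $\nabla_x\cdot A(t,x)=0$; moreover there is a continuous $a:[0,T]\to\mathbb R$ with $|A(t,x)-a(t)x/|x|^3|\le c\,R(x)^{1-p}$ for $t\in[0,T]$, $|x|\ge1$;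 (IV) $F(v)-f_0(x,v)$ vanishes for all $x$ when $|v|$ is large enough, and there is $N>0$ with $|F(v)-f_0(x,v)|\le c\,R(x)^{-6}$ for all $v$ and all $|x|>N$. Let $q>0$ and $b\in[0,\tfrac5{18})$ with $b\le\tfrac2q$, and let $M\ge0$. Then there is a constant $C$, depending only on $F,f_0,A,T,p,q,b$ and $M$, with the following property. Let $f:[0,T]\times\mathbb R^3\times\mathbb R^3\to[0,\infty)$ be a $C^1$ solution of the Vlasov–Poisson system $$\partial_tf+v\cdot\nabla_xf-(E+A)\cdot\nabla_vf=0,\qquad \rho(t,x)=\int(F(v)-f(t,x,v))\,dv,$$ $$E(t,x)=\int\rho(t,y)\frac{x-y}{|x-y|^3}\,dy,\qquad f(0,x,v)=f_0(x,v),$$ with both integrals absolutely convergent and with $\|\rho(t)\|_p$ bounded on $[0,T]$. Then for every $t\in[0,T]$ with $\|\rho(t)\|_\infty\le M$ and every $x$ with $|x|\ge1$, $$|E(t,x)|\le C\left(\|\rho(t)\|_q\,R(x)^{-q}\right)^b ,$$ where the right-hand side is read in $[0,\infty]$ with $s^0=1$ for every $s\in[0,\infty]$. -/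

import Mathlib

open MeasureTheory Set
open scoped NNReal ENNReal

noncomputable section

/-- Euclidean three-space. -/
abbrev R3 : Type := EuclideanSpace ℝ (Fin 3)

/-- The weight `R(x) = (1 + |x|²)^{1/2}`. -/
def weightR (x : R3) : ℝ := (1 + ‖x‖ ^ 2) ^ (1 / 2 : ℝ)

/-- `‖g‖_∞ = sup_x |g(x)|`, with values in `[0, ∞]`. -/
def supNorm (g : R3 → ℝ) : ℝ≥0∞ := ⨆ x, ENNReal.ofReal |g x|

/-- `‖g‖_q = sup_x |g(x) R(x)^q|`, with values in `[0, ∞]`. -/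
def weightedNorm (q : ℝ) (g : R3 → ℝ) : ℝ≥0∞ :=
  ⨆ x, ENNReal.ofReal |g x * weightR x ^ q|

/-- The charge density `ρ(t,x) = ∫ (F(v) - f(t,x,v)) dv`. -/
def chargeDensity (F : R3 → ℝ) (f : ℝ → R3 → R3 → ℝ) (t : ℝ) (x : R3) : ℝ :=
  ∫ v, (F v - f t x v)

/-- The integrand `ρ(t,y) (x - y) / |x - y|³` of the field. -/
def fieldIntegrand (F : R3 → ℝ) (f : ℝ → R3 → R3 → ℝ) (t : ℝ) (x y : R3) : R3 :=
  (chargeDensity F f t y / ‖x - y‖ ^ 3) • (x - y)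

/-- The electrostatic field `E(t,x) = ∫ ρ(t,y) (x - y) / |x - y|³ dy`. -/
def electricField (F : R3 → ℝ) (f : ℝ → R3 → R3 → ℝ) (t : ℝ) (x : R3) : R3 :=
  ∫ y, fieldIntegrand F f t x y

/-- Condition (I): the background density is nonnegative, `C²`, radial, with radial profile `FR`
on `[0, ∞)` satisfying `FR''(0) < 0`, `FR' < 0` on `(0, W)` and `FR = 0` on `[W, ∞)`. -/
structure BackgroundCondition (F : R3 → ℝ) : Prop where
  nonneg : ∀ v, 0 ≤ F v
  contDiff : ContDiff ℝ 2 F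
  radial : ∃ FR : ℝ → ℝ, (∀ v, F v = FR ‖v‖) ∧
    iteratedDerivWithin 2 FR (Ici 0) 0 < 0 ∧
    ∃ W : ℝ, 0 < W ∧ (∀ u ∈ Ioo 0 W, deriv FR u < 0) ∧ ∀ u, W ≤ u → FR u = 0

/-- Condition (III): the applied field is `C¹` on `[0, ∞) × ℝ³`, decays together with its first
spatial derivatives, is divergence free, and is asymptotically a Coulomb field on `[0, T]`. -/
structure AppliedFieldCondition (p T : ℝ) (A : ℝ → R3 → R3) : Prop where
  contDiff : ContDiffOn ℝ 1 (fun z : ℝ × R3 => A z.1 z.2) (Ici 0 ×ˢ univ)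
  decay : ∃ C : ℝ, ∀ t, 0 ≤ t → ∀ x, ‖A t x‖ ≤ C * weightR x ^ (-2 : ℝ)
  deriv_decay : ∃ C : ℝ, ∀ t, 0 ≤ t → ∀ x, ∀ i : Fin 3,
    ‖fderiv ℝ (A t) x (EuclideanSpace.single i 1)‖ ≤ C * weightR x ^ (-3 : ℝ)
  div_free : ∀ t, 0 ≤ t → ∀ x,
    ∑ i : Fin 3, (fderiv ℝ (A t) x (EuclideanSpace.single i 1)) i = 0
  asymptotics : ∃ a : ℝ → ℝ, ContinuousOn a (Icc 0 T) ∧ ∃ C : ℝ, ∀ t ∈ Icc 0 T, ∀ x : R3,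
    1 ≤ ‖x‖ → ‖A t x - (a t / ‖x‖ ^ 3) • x‖ ≤ C * weightR x ^ (1 - p)

/-- Conditions (II) and (IV): the initial density is nonnegative and `C¹`, it equals the background
for large `|v|`, and it tends to the background like `R(x)^{-6}` for large `|x|`. -/
structure InitialCondition (F : R3 → ℝ) (f₀ : R3 → R3 → ℝ) : Prop where
  nonneg : ∀ x v, 0 ≤ f₀ x v
  contDiff : ContDiff ℝ 1 (fun z : R3 × R3 => f₀ z.1 z.2)
  compact_support : ∃ B : ℝ, ∀ x v, B < ‖v‖ → F v - f₀ x v = 0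
  decay : ∃ N : ℝ, 0 < N ∧ ∃ C : ℝ, ∀ x v, N < ‖x‖ →
    |F v - f₀ x v| ≤ C * weightR x ^ (-6 : ℝ)

/-- `f` is a `C¹` solution of the Vlasov-Poisson system on `[0, T] × ℝ³ × ℝ³` whose charge density
has `‖ρ(t)‖_p` bounded on `[0, T]`. The two integrability fields say that the integrals defining
`ρ` and `E` converge. -/
structure IsVlasovPoissonSolution (p T : ℝ) (F : R3 → ℝ) (f₀ : R3 → R3 → ℝ)
    (A : ℝ → R3 → R3) (f : ℝ → R3 → R3 → ℝ) : Prop where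
  nonneg : ∀ t ∈ Icc 0 T, ∀ x v, 0 ≤ f t x v
  contDiff : ContDiffOn ℝ 1 (fun z : ℝ × R3 × R3 => f z.1 z.2.1 z.2.2) (Icc 0 T ×ˢ univ)
  integrable_velocity : ∀ t ∈ Icc 0 T, ∀ x, Integrable (fun v => F v - f t x v)
  integrable_field : ∀ t ∈ Icc 0 T, ∀ x, Integrable (fieldIntegrand F f t x)
  vlasov : ∀ t ∈ Icc 0 T, ∀ x v,
    derivWithin (fun s => f s x v) (Icc 0 T) t
      + inner ℝ v (gradient (fun y => f t y v) x)
      - inner ℝ (electricField F f t x + A t x) (gradient (fun w => f t x w) v) = 0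
  initial : ∀ x v, f 0 x v = f₀ x v
  density_bounded : ∃ K : ℝ≥0, ∀ t ∈ Icc 0 T, weightedNorm p (chargeDensity F f t) ≤ K

end

/-! ### The weight and integrals of powers -/

theorem weightR_eq_sqrt (x : R3) : weightR x = √(1 + ‖x‖ ^ 2) := by
  rw [weightR, Real.sqrt_eq_rpow]

theorem weightR_sq (x : R3) : weightR x ^ 2 = 1 + ‖x‖ ^ 2 := by
  rw [weightR_eq_sqrt, Real.sq_sqrt (by positivity)]

theorem one_le_weightR (x : R3) : 1 ≤ weightR x := by
  rw [weightR_eq_sqrt]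
  exact Real.one_le_sqrt.2 (by nlinarith [norm_nonneg x])

theorem weightR_pos (x : R3) : 0 < weightR x := lt_of_lt_of_le one_pos (one_le_weightR x)

theorem norm_le_weightR (x : R3) : ‖x‖ ≤ weightR x := by
  rw [weightR_eq_sqrt]
  exact Real.le_sqrt_of_sq_le (by linarith)

theorem weightR_le_one_add_norm (x : R3) : weightR x ≤ 1 + ‖x‖ := by
  rw [weightR_eq_sqrt, Real.sqrt_le_left (by positivity)]
  nlinarith [norm_nonneg x]

theorem weightR_le_add (x y : R3) : weightR x ≤ weightR y + ‖x - y‖ := by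
  have h1 := weightR_pos y
  have h2 := weightR_sq y
  have h3 := norm_le_weightR y
  have h4 : ‖x‖ ≤ ‖y‖ + ‖x - y‖ := by
    have := norm_add_le y (x - y)
    simpa using this
  rw [weightR_eq_sqrt x, Real.sqrt_le_left (by positivity)]
  nlinarith [norm_nonneg (x - y), norm_nonneg x, norm_nonneg y]

theorem contDiff_weightR {n : WithTop ℕ∞} : ContDiff ℝ n weightR := by
  have : weightR = fun x : R3 => √(1 + ‖x‖ ^ 2) := funext weightR_eq_sqrt
  rw [this]
  exact ContDiff.sqrt (contDiff_const.add (contDiff_norm_sq ℝ)) fun x => by positivity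

theorem continuous_weightR : Continuous weightR := (contDiff_weightR (n := 0)).continuous

theorem lipschitzWith_weightR : LipschitzWith 1 weightR :=
  LipschitzWith.of_dist_le_mul fun x y => by
    rw [Real.dist_eq, dist_eq_norm, NNReal.coe_one, one_mul, abs_le]
    have h1 := weightR_le_add x y
    have h2 := weightR_le_add y x
    rw [norm_sub_rev y x] at h2
    constructor <;> linarith

theorem norm_fderiv_weightR_le (x : R3) : ‖fderiv ℝ weightR x‖ ≤ 1 := by
  simpa using norm_fderiv_le_of_lipschitz ℝ lipschitzWith_weightR (x₀ := x)

theorem weightR_rpow_pos (x : R3) (a : ℝ) : 0 < weightR x ^ a := Real.rpow_pos_of_pos (weightR_pos x) a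

theorem weightR_rpow_le_rpow (x : R3) {a b : ℝ} (h : a ≤ b) : weightR x ^ a ≤ weightR x ^ b :=
  Real.rpow_le_rpow_of_exponent_le (one_le_weightR x) h

theorem weightR_rpow_le_one (x : R3) {a : ℝ} (h : a ≤ 0) : weightR x ^ a ≤ 1 := by
  simpa using weightR_rpow_le_rpow x h

theorem continuous_weightR_rpow (a : ℝ) : Continuous fun x => weightR x ^ a :=
  continuous_weightR.rpow_const fun x => Or.inl (weightR_pos x).ne'

theorem integrable_weightR_rpow {a : ℝ} (ha : 3 < a) : Integrable fun x : R3 => weightR x ^ (-a) := by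
  have h := integrable_rpow_neg_one_add_norm_sq (E := R3) (μ := volume) (r := a) (by simpa using ha)
  refine h.congr (Filter.Eventually.of_forall fun x => ?_)
  simp only [weightR]
  rw [← Real.rpow_mul (by positivity)]
  congr 1
  ring

/-- The radial function equal to `|z|^{-s}` in the unit ball and to `|z|^{-a}` outside. -/
noncomputable def twoPower (s a : ℝ) (z : R3) : ℝ := if ‖z‖ < 1 then ‖z‖ ^ (-s) else ‖z‖ ^ (-a)

theorem twoPower_nonneg (s a : ℝ) (z : R3) : 0 ≤ twoPower s a z := by
  unfold twoPower; split_ifs <;> positivity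

theorem integrable_twoPower {s a : ℝ} (hs : s < 3) (ha : 3 < a) : Integrable (twoPower s a) := by
  have key := integrable_fun_norm_addHaar (E := R3) volume
    (f := fun r : ℝ => if r < 1 then r ^ (-s) else r ^ (-a))
  refine key.2 ?_
  have hu : Ioi (0 : ℝ) = Ioo 0 1 ∪ Ici 1 := by
    ext r; simp only [mem_Ioi, mem_union, mem_Ioo, mem_Ici]
    constructor
    · intro h; rcases lt_or_ge r 1 with h' | h'
      · exact Or.inl ⟨h, h'⟩
      · exact Or.inr h'
    · rintro (h | h)
      · exact h.1
      · linarith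
  rw [hu]
  refine IntegrableOn.union ?_ ?_
  · refine ((intervalIntegral.integrableOn_Ioo_rpow_iff (s := 2 - s) one_pos).2 (by linarith)).congr_fun
      (fun r hr => ?_) measurableSet_Ioo
    simp only [hr.2, if_true, smul_eq_mul, finrank_euclideanSpace, Fintype.card_fin]
    rw [sub_eq_add_neg, Real.rpow_add hr.1]
    norm_num
  · rw [integrableOn_Ici_iff_integrableOn_Ioi]
    refine ((integrableOn_Ioi_rpow_iff (s := 2 - a) one_pos).2 (by linarith)).congr_fun
      (fun r hr => ?_) measurableSet_Ioi
    have hr' : (1 : ℝ) < r := hr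
    simp only [not_lt.2 hr'.le, if_false, smul_eq_mul, finrank_euclideanSpace, Fintype.card_fin]
    rw [sub_eq_add_neg, Real.rpow_add (by linarith)]
    norm_num

theorem rpow_mul_rpow_le_add {a b s t : ℝ} (ha : 0 ≤ a) (hb : 0 ≤ b) (hs : 0 ≤ s) (ht : 0 ≤ t) :
    a ^ s * b ^ t ≤ a ^ (s + t) + b ^ (s + t) := by
  rcases le_total a b with h | h
  · calc a ^ s * b ^ t ≤ b ^ s * b ^ t := by gcongr
      _ = b ^ (s + t) := (Real.rpow_add_of_nonneg hb hs ht).symm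
      _ ≤ _ := by have := Real.rpow_nonneg ha (s + t); linarith
  · calc a ^ s * b ^ t ≤ a ^ s * a ^ t := by gcongr
      _ = a ^ (s + t) := (Real.rpow_add_of_nonneg ha hs ht).symm
      _ ≤ _ := by have := Real.rpow_nonneg hb (s + t); linarith

theorem add_rpow_le_two_rpow {a b s : ℝ} (ha : 0 ≤ a) (hb : 0 ≤ b) (hs : 0 ≤ s) :
    (a + b) ^ s ≤ 2 ^ s * (a ^ s + b ^ s) := by
  rcases le_total a b with h | h
  · calc (a + b) ^ s ≤ (2 * b) ^ s := by gcongr; linarith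
      _ = 2 ^ s * b ^ s := Real.mul_rpow (by norm_num) hb
      _ ≤ _ := by gcongr; have := Real.rpow_nonneg ha s; linarith
  · calc (a + b) ^ s ≤ (2 * a) ^ s := by gcongr; linarith
      _ = 2 ^ s * a ^ s := Real.mul_rpow (by norm_num) ha
      _ ≤ _ := by gcongr; have := Real.rpow_nonneg hb s; linarith

theorem weightR_rpow_le_two_rpow (x y : R3) {s : ℝ} (hs : 0 ≤ s) :
    weightR x ^ s ≤ 2 ^ s * (weightR y ^ s + ‖x - y‖ ^ s) :=
  (Real.rpow_le_rpow (weightR_pos x).le (weightR_le_add x y) hs).trans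
    (add_rpow_le_two_rpow (weightR_pos y).le (norm_nonneg _) hs)

theorem weightR_mul_norm_rpow_le {a s : ℝ} (hs : 0 ≤ s) (hsa : s ≤ a) (y z : R3) :
    weightR y ^ (s - a) * ‖z‖ ^ (-s) ≤ weightR y ^ (-a) + twoPower s a z := by
  have hy := weightR_pos y
  unfold twoPower
  split_ifs with h
  · have h1 : weightR y ^ (s - a) ≤ 1 := weightR_rpow_le_one y (by linarith)
    have h2 : 0 ≤ ‖z‖ ^ (-s) := by positivity
    have h3 := weightR_rpow_pos y (-a)
    nlinarith
  · have hz : 0 < ‖z‖ := by linarith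
    have := rpow_mul_rpow_le_add (a := (weightR y)⁻¹) (b := ‖z‖⁻¹) (s := a - s) (t := s)
      (by positivity) (by positivity) (by linarith) hs
    rw [Real.inv_rpow hy.le, Real.inv_rpow hz.le, Real.inv_rpow hy.le, Real.inv_rpow hz.le,
      ← Real.rpow_neg hy.le, ← Real.rpow_neg hz.le, ← Real.rpow_neg hy.le, ← Real.rpow_neg hz.le] at this
    simpa using this

theorem weightR_mul_norm_sub_rpow_le {a s : ℝ} (hs : 0 ≤ s) (hsa : s ≤ a) (x y : R3) :
    weightR y ^ (-a) * ‖x - y‖ ^ (-s) ≤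
      2 ^ s * weightR x ^ (-s) * (2 * weightR y ^ (-a) + twoPower s a (x - y)) := by
  have hx := weightR_pos x
  have hy := weightR_pos y
  have h1 := weightR_rpow_le_two_rpow x y hs
  have h2 := weightR_mul_norm_rpow_le hs hsa y (x - y)
  have h3 : ‖x - y‖ ^ s * ‖x - y‖ ^ (-s) ≤ 1 := by
    rcases (norm_nonneg (x - y)).eq_or_lt with h | h
    · rw [← h]
      rcases hs.eq_or_lt with rfl | hs
      · simp
      · rw [Real.zero_rpow hs.ne', zero_mul]; exact zero_le_one
    · rw [← Real.rpow_add h]; simp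
  have h4 : weightR x ^ (-s) * weightR x ^ s = 1 := by rw [← Real.rpow_add hx]; simp
  have h5 : weightR y ^ s * weightR y ^ (-a) = weightR y ^ (s - a) := by
    rw [← Real.rpow_add hy]; congr 1
  have p1 := weightR_rpow_pos x (-s)
  have p2 := weightR_rpow_pos y (-a)
  have p3 : 0 ≤ ‖x - y‖ ^ (-s) := by positivity
  calc weightR y ^ (-a) * ‖x - y‖ ^ (-s)
      = weightR x ^ (-s) * (weightR x ^ s * (weightR y ^ (-a) * ‖x - y‖ ^ (-s))) := by
        rw [← mul_assoc, h4, one_mul]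
    _ ≤ weightR x ^ (-s) * ((2 ^ s * (weightR y ^ s + ‖x - y‖ ^ s)) *
        (weightR y ^ (-a) * ‖x - y‖ ^ (-s))) := by gcongr
    _ = 2 ^ s * weightR x ^ (-s) * ((weightR y ^ s * weightR y ^ (-a)) * ‖x - y‖ ^ (-s) +
        weightR y ^ (-a) * (‖x - y‖ ^ s * ‖x - y‖ ^ (-s))) := by ring
    _ ≤ 2 ^ s * weightR x ^ (-s) * ((weightR y ^ (-a) + twoPower s a (x - y)) +
        weightR y ^ (-a) * 1) := by rw [h5]; gcongr
    _ = _ := by ring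

theorem integrable_weightR_mul_norm_sub {a s : ℝ} (hs : 0 ≤ s) (hs3 : s < 3) (ha : 3 < a) (x : R3) :
    Integrable fun y : R3 => weightR y ^ (-a) * ‖x - y‖ ^ (-s) := by
  have h1 : Integrable fun y : R3 =>
      2 ^ s * weightR x ^ (-s) * (2 * weightR y ^ (-a) + twoPower s a (x - y)) :=
    (((integrable_weightR_rpow ha).const_mul 2).add
      ((integrable_twoPower hs3 ha).comp_sub_left x)).const_mul _
  refine h1.mono' ?_ (Filter.Eventually.of_forall fun y => ?_)
  · refine ((continuous_weightR_rpow _).measurable.mul ?_).aestronglyMeasurable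
    exact (measurable_const.sub measurable_id).norm.pow_const _
  · rw [Real.norm_of_nonneg (by have := weightR_rpow_pos y (-a); positivity)]
    exact weightR_mul_norm_sub_rpow_le hs (by linarith) x y

/-- Convolving an integrable power of the weight with `|z|^{-s}` yields decay of order `s`. -/
theorem exists_integral_weightR_mul_norm_sub_le {a s : ℝ} (hs : 0 ≤ s) (hs3 : s < 3) (ha : 3 < a) :
    ∃ C : ℝ, 0 < C ∧ ∀ x : R3,
      ∫ y, weightR y ^ (-a) * ‖x - y‖ ^ (-s) ≤ C * weightR x ^ (-s) := by
  set I : ℝ := ∫ y : R3, weightR y ^ (-a) with hI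
  set J : ℝ := ∫ z : R3, twoPower s a z with hJ
  have hI0 : 0 ≤ I := integral_nonneg fun y => (weightR_rpow_pos y _).le
  have hJ0 : 0 ≤ J := integral_nonneg fun y => twoPower_nonneg _ _ _
  refine ⟨2 ^ s * (2 * I + J) + 1, by positivity, fun x => ?_⟩
  have i1 := integrable_weightR_rpow ha
  have i2 := (integrable_twoPower hs3 ha).comp_sub_left x
  calc ∫ y, weightR y ^ (-a) * ‖x - y‖ ^ (-s)
      ≤ ∫ y, 2 ^ s * weightR x ^ (-s) * (2 * weightR y ^ (-a) + twoPower s a (x - y)) :=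
        integral_mono (integrable_weightR_mul_norm_sub hs hs3 ha x)
          (((i1.const_mul 2).add i2).const_mul _)
          fun y => weightR_mul_norm_sub_rpow_le hs (by linarith) x y
    _ = 2 ^ s * weightR x ^ (-s) * (2 * I + J) := by
        rw [integral_const_mul, integral_add (i1.const_mul 2) i2, integral_const_mul,
          integral_sub_left_eq_self (twoPower s a) volume x]
    _ ≤ _ := by
        have := weightR_rpow_pos x (-s)
        nlinarith

/-! ### Pointwise bound on the field of a square integrable bounded density -/

theorem norm_div_norm_cube_smul (c : ℝ) (z : R3) :
    ‖(c / ‖z‖ ^ 3) • z‖ = |c| * ‖z‖ ^ (-2 : ℝ) := by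
  rcases eq_or_ne z 0 with rfl | hz
  · simp
  · have : 0 < ‖z‖ := norm_pos_iff.2 hz
    rw [norm_smul, Real.norm_eq_abs, abs_div, abs_of_pos (pow_pos this 3), Real.rpow_neg this.le]
    norm_num
    field_simp

theorem mul_rpow_one_sub_le {u r b : ℝ} (hu : 0 ≤ u) (hr : 0 ≤ r) (hb : 0 ≤ b) (hb1 : b ≤ 1) :
    u * r ^ (1 - b) ≤ u ^ (2 / (1 + b)) + r ^ 2 := by
  have h := rpow_mul_rpow_le_add (a := u ^ (1 / (1 + b))) (b := r) (s := 1 + b) (t := 1 - b)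
    (by positivity) hr (by linarith) (by linarith)
  rw [← Real.rpow_mul hu, ← Real.rpow_mul hu] at h
  have e1 : 1 / (1 + b) * (1 + b) = 1 := by field_simp
  have e2 : 1 / (1 + b) * (1 + b + (1 - b)) = 2 / (1 + b) := by ring
  have e3 : 1 + b + (1 - b) = ((2 : ℕ) : ℝ) := by norm_num
  rw [e1, e2, e3, Real.rpow_natCast, Real.rpow_one] at h
  exact h

theorem weightR_rpow_mul_density_le {b s M Q r : ℝ} (hb : 0 ≤ b) (hb1 : b < 1 / 3) (hs : 0 ≤ s)
    (hs2 : s ≤ 2) (hQ : 0 ≤ Q) (hr : 0 ≤ r) (hrM : r ≤ M) (x y : R3)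
    (hrQ : r ^ b ≤ Q * weightR y ^ (-s)) :
    weightR x ^ s * (r * ‖x - y‖ ^ (-2 : ℝ)) ≤ Q * (12 * (1 + M)) *
      (r ^ 2 + weightR y ^ (-(4 / (1 + b))) + twoPower 2 (4 / (1 + b)) (x - y)) := by
  set a := 4 / (1 + b) with ha
  set w := r ^ (1 - b) with hw
  have hw0 : 0 ≤ w := by positivity
  have hM : 0 ≤ M := hr.trans hrM
  have hwM : w ≤ 1 + M := by
    calc w ≤ (1 + M) ^ (1 - b) := Real.rpow_le_rpow hr (by linarith) (by linarith)
      _ ≤ (1 + M) ^ (1 : ℝ) := Real.rpow_le_rpow_of_exponent_le (by linarith) (by linarith)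
      _ = 1 + M := Real.rpow_one _
  have hrw : r ≤ Q * weightR y ^ (-s) * w := by
    calc r = r ^ b * w := by
          rw [hw, ← Real.rpow_add_of_nonneg hr hb (by linarith)]; simp
      _ ≤ _ := by gcongr
  have hx := weightR_rpow_pos x s
  have hy := weightR_pos y
  have hys := weightR_rpow_pos y (-s)
  have hya := weightR_rpow_pos y (-a)
  have h2s : (2 : ℝ) ^ s ≤ 4 := by
    calc (2 : ℝ) ^ s ≤ 2 ^ (2 : ℝ) := Real.rpow_le_rpow_of_exponent_le (by norm_num) hs2
      _ = 4 := by norm_num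
  have h1 : weightR x ^ s * weightR y ^ (-s) ≤ 4 * (1 + weightR y ^ (-s) * ‖x - y‖ ^ s) := by
    have := weightR_rpow_le_two_rpow x y hs
    have e : weightR y ^ s * weightR y ^ (-s) = 1 := by rw [← Real.rpow_add hy]; simp
    have hz : 0 ≤ ‖x - y‖ ^ s := by positivity
    calc weightR x ^ s * weightR y ^ (-s)
        ≤ 2 ^ s * (weightR y ^ s + ‖x - y‖ ^ s) * weightR y ^ (-s) := by gcongr
      _ = 2 ^ s * (weightR y ^ s * weightR y ^ (-s) + weightR y ^ (-s) * ‖x - y‖ ^ s) := by ring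
      _ ≤ 4 * (1 + weightR y ^ (-s) * ‖x - y‖ ^ s) := by rw [e]; gcongr
  suffices H : (1 + weightR y ^ (-s) * ‖x - y‖ ^ s) * ‖x - y‖ ^ (-2 : ℝ) * w ≤
      3 * (1 + M) * (r ^ 2 + weightR y ^ (-a) + twoPower 2 a (x - y)) by
    calc weightR x ^ s * (r * ‖x - y‖ ^ (-2 : ℝ))
        ≤ weightR x ^ s * ((Q * weightR y ^ (-s) * w) * ‖x - y‖ ^ (-2 : ℝ)) := by gcongr
      _ = Q * ((weightR x ^ s * weightR y ^ (-s)) * ‖x - y‖ ^ (-2 : ℝ) * w) := by ring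
      _ ≤ Q * ((4 * (1 + weightR y ^ (-s) * ‖x - y‖ ^ s)) * ‖x - y‖ ^ (-2 : ℝ) * w) := by gcongr
      _ = Q * (4 * ((1 + weightR y ^ (-s) * ‖x - y‖ ^ s) * ‖x - y‖ ^ (-2 : ℝ) * w)) := by ring
      _ ≤ Q * (4 * (3 * (1 + M) * (r ^ 2 + weightR y ^ (-a) + twoPower 2 a (x - y)))) := by gcongr
      _ = _ := by ring
  have hT := twoPower_nonneg 2 a (x - y)
  have hys1 : weightR y ^ (-s) ≤ 1 := weightR_rpow_le_one y (by linarith)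
  by_cases hz : ‖x - y‖ < 1
  · have e : twoPower 2 a (x - y) = ‖x - y‖ ^ (-2 : ℝ) := by simp [twoPower, hz]
    rw [e] at hT ⊢
    have hzs : ‖x - y‖ ^ s ≤ 1 := Real.rpow_le_one (norm_nonneg _) hz.le hs
    have hz0 : 0 ≤ ‖x - y‖ ^ s := by positivity
    have : 1 + weightR y ^ (-s) * ‖x - y‖ ^ s ≤ 2 := by nlinarith
    calc (1 + weightR y ^ (-s) * ‖x - y‖ ^ s) * ‖x - y‖ ^ (-2 : ℝ) * w
        ≤ 2 * ‖x - y‖ ^ (-2 : ℝ) * (1 + M) := by gcongr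
      _ ≤ 3 * (1 + M) * ‖x - y‖ ^ (-2 : ℝ) := by nlinarith [mul_nonneg hT (by linarith : 0 ≤ 1 + M)]
      _ ≤ _ := by gcongr; nlinarith [sq_nonneg r]
  · have e : twoPower 2 a (x - y) = ‖x - y‖ ^ (-a) := by simp [twoPower, hz]
    rw [e] at hT ⊢
    have hz1 : 1 ≤ ‖x - y‖ := not_lt.1 hz
    have hz0 : 0 < ‖x - y‖ := by linarith
    have h3 : weightR y ^ (-s) * ‖x - y‖ ^ s * ‖x - y‖ ^ (-2 : ℝ) ≤
        weightR y ^ (-2 : ℝ) + ‖x - y‖ ^ (-2 : ℝ) := by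
      have := rpow_mul_rpow_le_add (a := (weightR y)⁻¹) (b := ‖x - y‖⁻¹) (s := s) (t := 2 - s)
        (by positivity) (by positivity) hs (by linarith)
      rw [Real.inv_rpow hy.le, Real.inv_rpow hz0.le, Real.inv_rpow hy.le, Real.inv_rpow hz0.le,
        ← Real.rpow_neg hy.le, ← Real.rpow_neg hz0.le, ← Real.rpow_neg hy.le,
        ← Real.rpow_neg hz0.le] at this
      rw [mul_assoc, ← Real.rpow_add hz0]
      convert this using 2 <;> ring_nf
    have young : ∀ c : ℝ, 0 < c → c ^ (-2 : ℝ) * w ≤ c ^ (-a) + r ^ 2 := by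
      intro c hc
      have := mul_rpow_one_sub_le (u := c ^ (-2 : ℝ)) (r := r) (b := b) (by positivity) hr hb
        (by linarith)
      rw [← Real.rpow_mul hc.le] at this
      convert this using 3
      rw [ha]; ring
    have y1 := young _ hy
    have y2 := young _ hz0
    calc (1 + weightR y ^ (-s) * ‖x - y‖ ^ s) * ‖x - y‖ ^ (-2 : ℝ) * w
        = ‖x - y‖ ^ (-2 : ℝ) * w + (weightR y ^ (-s) * ‖x - y‖ ^ s * ‖x - y‖ ^ (-2 : ℝ)) * w := by
          ring
      _ ≤ ‖x - y‖ ^ (-2 : ℝ) * w + (weightR y ^ (-2 : ℝ) + ‖x - y‖ ^ (-2 : ℝ)) * w := by gcongr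
      _ ≤ 3 * (r ^ 2 + weightR y ^ (-a) + ‖x - y‖ ^ (-a)) := by linarith
      _ ≤ _ := by
          have : 0 ≤ r ^ 2 + weightR y ^ (-a) + ‖x - y‖ ^ (-a) := by positivity
          nlinarith

/-- A bounded square integrable density with `|ρ|^b ≤ Q R^{-s}`, `s ≤ 2`, generates a field bounded
by a multiple of `Q R^{-s}`, uniformly in the density. -/
theorem exists_norm_field_le {b s M I : ℝ} (hb : 0 ≤ b) (hb1 : b < 1 / 3) (hs : 0 ≤ s)
    (hs2 : s ≤ 2) :
    ∃ C : ℝ, 0 < C ∧ ∀ ρ : R3 → ℝ, (∀ y, |ρ y| ≤ M) → Integrable (fun y => ρ y ^ 2) →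
      ∫ y, ρ y ^ 2 ≤ I → ∀ Q : ℝ, 0 ≤ Q → (∀ y, |ρ y| ^ b ≤ Q * weightR y ^ (-s)) →
        ∀ x : R3, ‖∫ y, (ρ y / ‖x - y‖ ^ 3) • (x - y)‖ ≤ C * (Q * weightR x ^ (-s)) := by
  set a := 4 / (1 + b) with ha
  have ha3 : 3 < a := by rw [ha, lt_div_iff₀ (by linarith)]; linarith
  set I₁ : ℝ := ∫ y : R3, weightR y ^ (-a) with hI1
  set I₂ : ℝ := ∫ z : R3, twoPower 2 a z with hI2
  have hI10 : 0 ≤ I₁ := integral_nonneg fun y => (weightR_rpow_pos y _).le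
  have hI20 : 0 ≤ I₂ := integral_nonneg fun y => twoPower_nonneg _ _ _
  refine ⟨12 * (1 + |M|) * (|I| + I₁ + I₂) + 1, by positivity, fun ρ hM hρ hI Q hQ hρQ x => ?_⟩
  have hx := weightR_pos x
  have hx1 := weightR_rpow_pos x (-s)
  have hM' : M ≤ |M| := le_abs_self M
  have i1 := integrable_weightR_rpow ha3
  have i2 := (integrable_twoPower (s := 2) (by norm_num) ha3).comp_sub_left x
  have hbound : ∀ y, ‖(ρ y / ‖x - y‖ ^ 3) • (x - y)‖ ≤ weightR x ^ (-s) * (Q * (12 * (1 + |M|))) *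
      (ρ y ^ 2 + weightR y ^ (-a) + twoPower 2 a (x - y)) := by
    intro y
    have h := weightR_rpow_mul_density_le (M := |M|) hb hb1 hs hs2 hQ (abs_nonneg (ρ y))
      ((hM y).trans hM') x y (hρQ y)
    rw [norm_div_norm_cube_smul]
    have e : weightR x ^ (-s) * weightR x ^ s = 1 := by rw [← Real.rpow_add hx]; simp
    calc |ρ y| * ‖x - y‖ ^ (-2 : ℝ)
        = weightR x ^ (-s) * (weightR x ^ s * (|ρ y| * ‖x - y‖ ^ (-2 : ℝ))) := by
          rw [← mul_assoc, e, one_mul]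
      _ ≤ weightR x ^ (-s) * (Q * (12 * (1 + |M|)) *
          (|ρ y| ^ 2 + weightR y ^ (-a) + twoPower 2 a (x - y))) := by gcongr
      _ = _ := by rw [sq_abs]; ring
  have hi : Integrable fun y => weightR x ^ (-s) * (Q * (12 * (1 + |M|))) *
      (ρ y ^ 2 + weightR y ^ (-a) + twoPower 2 a (x - y)) := ((hρ.add i1).add i2).const_mul _
  refine (norm_integral_le_of_norm_le hi (Filter.Eventually.of_forall hbound)).trans ?_
  have e : ∫ y, (ρ y ^ 2 + weightR y ^ (-a) + twoPower 2 a (x - y)) = (∫ y, ρ y ^ 2) + I₁ + I₂ := by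
    have i3 : Integrable fun y => ρ y ^ 2 + weightR y ^ (-a) := hρ.add i1
    rw [integral_add i3 i2, integral_add hρ i1,
      integral_sub_left_eq_self (twoPower 2 a) volume x]
  rw [integral_const_mul, e]
  have hI' := hI.trans (le_abs_self I)
  calc weightR x ^ (-s) * (Q * (12 * (1 + |M|))) * ((∫ y, ρ y ^ 2) + I₁ + I₂)
      ≤ weightR x ^ (-s) * (Q * (12 * (1 + |M|))) * (|I| + I₁ + I₂) := by gcongr
    _ = (12 * (1 + |M|) * (|I| + I₁ + I₂)) * (Q * weightR x ^ (-s)) := by ring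
    _ ≤ _ := by
      gcongr
      linarith

/-! ### The relative energy density -/

/-- `τ` inverts the background as a function of the kinetic energy `|v|²/2`, extended to the whole
line in such a way that the inverse of `τ` is Lipschitz. -/
structure IsEnergyInverse (F : R3 → ℝ) (W L : ℝ) (τ : ℝ → ℝ) : Prop where
  W_pos : 0 < W
  L_pos : 0 < L
  continuous : Continuous τ
  sub_le : ∀ h₁ h₂, h₁ ≤ h₂ → h₂ - h₁ ≤ L * (τ h₁ - τ h₂)
  apply_background : ∀ v, ‖v‖ ≤ W → τ (F v) = ‖v‖ ^ 2 / 2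
  background_eq_zero : ∀ v, W ≤ ‖v‖ → F v = 0

theorem exists_homeo_of_strictAntiOn {φ : ℝ → ℝ} {W C : ℝ} (hW : 0 < W) (hC : 0 ≤ C)
    (hφ : Continuous φ) (hanti : StrictAntiOn φ (Icc 0 W))
    (hlip : ∀ a b, 0 ≤ a → a ≤ b → b ≤ W → φ a - φ b ≤ C * (b ^ 2 / 2 - a ^ 2 / 2)) :
    ∃ τ : ℝ → ℝ, Continuous τ ∧ (∀ h₁ h₂, h₁ ≤ h₂ → h₂ - h₁ ≤ (C + 1) * (τ h₁ - τ h₂)) ∧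
      ∀ u ∈ Icc 0 W, τ (φ u) = u ^ 2 / 2 := by
  set c : ℝ → ℝ := fun w => max 0 (min (W ^ 2 / 2) w) with hc
  have hW2 : 0 < W ^ 2 / 2 := by positivity
  have hc0 : ∀ w, 0 ≤ c w := fun w => le_max_left _ _
  have hc1 : ∀ w, c w ≤ W ^ 2 / 2 := fun w => max_le hW2.le (min_le_left _ _)
  have hcmono : ∀ w₁ w₂, w₁ ≤ w₂ → c w₁ ≤ c w₂ := fun w₁ w₂ h =>
    max_le_max le_rfl (min_le_min le_rfl h)
  have hcsub : ∀ w₁ w₂, w₁ ≤ w₂ → c w₂ - c w₁ ≤ w₂ - w₁ := by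
    intro w₁ w₂ h
    simp only [hc]
    rcases max_cases 0 (min (W ^ 2 / 2) w₂) with ⟨h1, h2⟩ | ⟨h1, h2⟩ <;>
    rcases max_cases 0 (min (W ^ 2 / 2) w₁) with ⟨h3, h4⟩ | ⟨h3, h4⟩ <;>
    rcases min_cases (W ^ 2 / 2) w₁ with ⟨h5, h6⟩ | ⟨h5, h6⟩ <;>
    rcases min_cases (W ^ 2 / 2) w₂ with ⟨h7, h8⟩ | ⟨h7, h8⟩ <;> linarith
  have hccont : Continuous c := continuous_const.max (continuous_const.min continuous_id)
  set r : ℝ → ℝ := fun w => √(2 * c w) with hr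
  have hr0 : ∀ w, 0 ≤ r w := fun w => Real.sqrt_nonneg _
  have hr2 : ∀ w, r w ^ 2 / 2 = c w := fun w => by
    simp only [hr]; rw [Real.sq_sqrt (by linarith [hc0 w])]; ring
  have hrW : ∀ w, r w ≤ W := fun w => by
    simp only [hr]
    rw [Real.sqrt_le_left hW.le]; linarith [hc1 w]
  have hrmono : ∀ w₁ w₂, w₁ ≤ w₂ → r w₁ ≤ r w₂ := fun w₁ w₂ h =>
    Real.sqrt_le_sqrt (by linarith [hcmono _ _ h])
  have hrcont : Continuous r := (continuous_const.mul hccont).sqrt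
  set G : ℝ → ℝ := fun w => (w - c w) - φ (r w) with hG
  have hGcont : Continuous G := (continuous_id.sub hccont).sub (hφ.comp hrcont)
  have hGmono : StrictMono G := by
    intro w₁ w₂ h
    have h1 := hcsub _ _ h.le
    have h2 : φ (r w₂) ≤ φ (r w₁) :=
      hanti.antitoneOn ⟨hr0 _, hrW _⟩ ⟨hr0 _, hrW _⟩ (hrmono _ _ h.le)
    rcases h1.lt_or_eq with h3 | h3
    · simp only [hG]; linarith
    · have h4 : r w₁ < r w₂ := by
        refine lt_of_le_of_ne (hrmono _ _ h.le) fun he => ?_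
        have := hr2 w₁; rw [he, hr2 w₂] at this; linarith
      have h5 : φ (r w₂) < φ (r w₁) := hanti ⟨hr0 _, hrW _⟩ ⟨hr0 _, hrW _⟩ h4
      simp only [hG]; linarith
  have hGlip : ∀ w₁ w₂, w₁ ≤ w₂ → G w₂ - G w₁ ≤ (C + 1) * (w₂ - w₁) := by
    intro w₁ w₂ h
    have h1 := hlip _ _ (hr0 w₁) (hrmono _ _ h) (hrW w₂)
    rw [hr2, hr2] at h1
    have h2 := hcsub _ _ h
    have h3 := hcmono _ _ h
    simp only [hG]
    nlinarith
  have htop : Filter.Tendsto G Filter.atTop Filter.atTop := by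
    refine Filter.tendsto_atTop_mono (f := fun w => w + (-(W ^ 2 / 2) - φ 0)) (fun w => ?_)
      (Filter.tendsto_atTop_add_const_right _ _ Filter.tendsto_id)
    have h2 : φ (r w) ≤ φ 0 := hanti.antitoneOn ⟨le_rfl, hW.le⟩ ⟨hr0 _, hrW _⟩ (hr0 _)
    simp only [hG]; linarith [hc1 w]
  have hbot : Filter.Tendsto G Filter.atBot Filter.atBot := by
    refine Filter.tendsto_atBot_mono (f := fun w => w + (- φ W)) (fun w => ?_)
      (Filter.tendsto_atBot_add_const_right _ _ Filter.tendsto_id)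
    have h2 : φ W ≤ φ (r w) := hanti.antitoneOn ⟨hr0 _, hrW _⟩ ⟨hW.le, le_rfl⟩ (hrW _)
    simp only [hG]; linarith [hc0 w]
  have hsurj : Function.Surjective G := hGcont.surjective htop hbot
  set e := hGmono.orderIsoOfSurjective G hsurj with he
  have heG : ∀ w, e w = G w := fun w => rfl
  refine ⟨fun h => e.symm (-h), e.symm.continuous.comp continuous_neg, fun h₁ h₂ h => ?_,
    fun u hu => ?_⟩
  · have h1 : e.symm (-h₂) ≤ e.symm (-h₁) := e.symm.monotone (by linarith)
    have h2 := hGlip _ _ h1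
    rw [← heG, ← heG, e.apply_symm_apply, e.apply_symm_apply] at h2
    linarith
  · rw [OrderIso.symm_apply_eq, heG]
    have h1 : c (u ^ 2 / 2) = u ^ 2 / 2 := by
      simp only [hc]
      rw [min_eq_right (by nlinarith [hu.1, hu.2]), max_eq_right (by positivity)]
    have h2 : r (u ^ 2 / 2) = u := by
      simp only [hr]; rw [h1, mul_div_cancel₀ _ (by norm_num), Real.sqrt_sq hu.1]
    simp only [hG]; rw [h1, h2]; ring

theorem BackgroundCondition.exists_isEnergyInverse {F : R3 → ℝ} (hF : BackgroundCondition F) :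
    ∃ W L τ, IsEnergyInverse F W L τ := by
  obtain ⟨FR, hFR, -, W, hW, hneg, hzero⟩ := hF.radial
  set e₀ : R3 := EuclideanSpace.single 0 1 with he₀
  have hnorm : ∀ u : ℝ, ‖u • e₀‖ = |u| := fun u => by simp [he₀, norm_smul]
  set φ : ℝ → ℝ := fun u => F (u • e₀) with hφ
  have hφFR : ∀ u, φ u = FR |u| := fun u => by simp only [hφ]; rw [hFR, hnorm]
  have hφ2 : ContDiff ℝ 2 φ := hF.contDiff.comp (contDiff_id.smul contDiff_const)
  have hφd : Differentiable ℝ φ := hφ2.differentiable (by norm_num)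
  have hφ' : ContDiff ℝ 1 (deriv φ) := by
    have : ContDiff ℝ (1 + 1) φ := by simpa [one_add_one_eq_two] using hφ2
    exact (contDiff_succ_iff_deriv.1 this).2.2
  have hd0 : deriv φ 0 = 0 := by
    have h1 : (fun u => φ (-u)) = φ := by funext u; rw [hφFR, hφFR, abs_neg]
    have h2 := deriv_comp_neg φ 0
    rw [h1] at h2
    simp at h2
    linarith
  obtain ⟨C, hC⟩ := (isCompact_Icc (a := (0 : ℝ)) (b := W)).exists_bound_of_continuousOn
    (hφ'.continuous_deriv (by norm_num)).continuousOn
  have hC0 : 0 ≤ C := (norm_nonneg _).trans (hC 0 ⟨le_rfl, hW.le⟩)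
  have hlin : ∀ u ∈ Icc 0 W, |deriv φ u| ≤ C * u := by
    intro u hu
    have := (convex_Icc (0 : ℝ) W).norm_image_sub_le_of_norm_deriv_le (f := deriv φ) (C := C)
      (fun x _ => (hφ'.differentiable (by norm_num)) x) hC ⟨le_rfl, hW.le⟩ hu
    simpa [hd0, abs_of_nonneg hu.1] using this
  have hmono : MonotoneOn (fun u => φ u + C * (u ^ 2 / 2)) (Icc 0 W) := by
    have hder : ∀ u, HasDerivAt (fun u => φ u + C * (u ^ 2 / 2)) (deriv φ u + C * u) u := by
      intro u
      have h2 : HasDerivAt (fun u : ℝ => u ^ 2 / 2) u u := by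
        have := (hasDerivAt_pow 2 u).div_const 2
        simpa using this
      exact (hφd u).hasDerivAt.add (h2.const_mul C)
    refine monotoneOn_of_deriv_nonneg (convex_Icc 0 W)
      (fun u _ => (hder u).continuousAt.continuousWithinAt)
      (fun u _ => (hder u).differentiableAt.differentiableWithinAt) fun u hu => ?_
    rw [(hder u).deriv]
    have := (abs_le.1 (hlin u (interior_subset hu))).1
    linarith
  have hanti : StrictAntiOn φ (Icc 0 W) := by
    refine strictAntiOn_of_deriv_neg (convex_Icc 0 W) hφd.continuous.continuousOn fun u hu => ?_
    rw [interior_Icc] at hu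
    have : φ =ᶠ[nhds u] FR := by
      filter_upwards [lt_mem_nhds hu.1] with s hs
      rw [hφFR, abs_of_pos hs]
    rw [this.deriv_eq]
    exact hneg u hu
  obtain ⟨τ, hτ, hτL, hτφ⟩ := exists_homeo_of_strictAntiOn hW hC0 hφd.continuous hanti (by
    intro a b ha hab hb
    have := hmono ⟨ha, hab.trans hb⟩ ⟨ha.trans hab, hb⟩ hab
    simp only at this
    linarith)
  refine ⟨W, C + 1, τ, hW, by linarith, hτ, hτL, fun v hv => ?_, fun v hv => ?_⟩
  · rw [← hτφ ‖v‖ ⟨norm_nonneg v, hv⟩, hφFR, abs_norm, hFR]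
  · rw [hFR, hzero _ hv]

/-- Energy of `h` relative to the background at velocity `v`. -/
noncomputable def relEnergy (F : R3 → ℝ) (τ : ℝ → ℝ) (v : R3) (h : ℝ) : ℝ :=
  ‖v‖ ^ 2 / 2 * (h - F v) - ((∫ u in (0)..h, τ u) - ∫ u in (0)..(F v), τ u)

namespace IsEnergyInverse

variable {F : R3 → ℝ} {W L : ℝ} {τ : ℝ → ℝ}

theorem sq_le_integral (H : IsEnergyInverse F W L τ) (a h : ℝ) :
    (h - a) ^ 2 / (2 * L) ≤ τ a * (h - a) - ((∫ u in (0)..h, τ u) - ∫ u in (0)..a, τ u) := by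
  have hL := H.L_pos
  have hInt : ∀ p q : ℝ, IntervalIntegrable τ volume p q := fun p q =>
    H.continuous.intervalIntegrable p q
  rw [intervalIntegral.integral_interval_sub_left (hInt _ _) (hInt _ _)]
  have e1 : ∫ u in a..h, (u - a) / L = (h - a) ^ 2 / (2 * L) := by
    rw [intervalIntegral.integral_div, intervalIntegral.integral_sub (by simp) (by simp)]
    simp
    field_simp
    ring
  have e2 : ∫ u in a..h, (τ a - τ u) = τ a * (h - a) - ∫ u in a..h, τ u := by
    rw [intervalIntegral.integral_sub (by simp) (hInt _ _)]
    simp [mul_comm]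
  rw [← e1, ← e2]
  have ic : ∀ p q : ℝ, IntervalIntegrable (fun u => (u - a) / L) volume p q := fun p q =>
    (by fun_prop : Continuous fun u : ℝ => (u - a) / L).intervalIntegrable p q
  have id : ∀ p q : ℝ, IntervalIntegrable (fun u => τ a - τ u) volume p q := fun p q =>
    (continuous_const.sub H.continuous).intervalIntegrable p q
  rcases le_total a h with hah | hah
  · refine intervalIntegral.integral_mono_on hah (ic _ _) (id _ _) fun u hu => ?_
    rw [div_le_iff₀ hL]
    linarith [H.sub_le a u hu.1]
  · rw [intervalIntegral.integral_symm, intervalIntegral.integral_symm h a]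
    refine neg_le_neg (intervalIntegral.integral_mono_on hah (id _ _) (ic _ _) fun u hu => ?_)
    rw [le_div_iff₀ hL]
    linarith [H.sub_le u a hu.2]

theorem apply_zero (H : IsEnergyInverse F W L τ) : τ 0 = W ^ 2 / 2 := by
  set v : R3 := EuclideanSpace.single 0 W with hv
  have hn : ‖v‖ = W := by simp [hv, abs_of_pos H.W_pos]
  have h1 := H.apply_background v hn.le
  rwa [H.background_eq_zero v hn.ge, hn] at h1

theorem sq_le_relEnergy (H : IsEnergyInverse F W L τ) (v : R3) {h : ℝ} (hh : 0 ≤ h) :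
    (h - F v) ^ 2 / (2 * L) ≤ relEnergy F τ v h := by
  have h1 := H.sq_le_integral (F v) h
  unfold relEnergy
  rcases le_total ‖v‖ W with hv | hv
  · rwa [H.apply_background v hv] at h1
  · rw [H.background_eq_zero v hv, H.apply_zero] at h1
    rw [H.background_eq_zero v hv]
    have : W ^ 2 / 2 * (h - 0) ≤ ‖v‖ ^ 2 / 2 * (h - 0) := by
      have := H.W_pos
      rw [sub_zero]; gcongr
    linarith

theorem relEnergy_nonneg (H : IsEnergyInverse F W L τ) (v : R3) {h : ℝ} (hh : 0 ≤ h) :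
    0 ≤ relEnergy F τ v h := by
  have := H.L_pos
  exact le_trans (by positivity) (H.sq_le_relEnergy v hh)

theorem mul_le_relEnergy (H : IsEnergyInverse F W L τ) {v : R3} (hv : W ≤ ‖v‖) (h : ℝ) :
    (‖v‖ ^ 2 - W ^ 2) / 2 * h ≤ relEnergy F τ v h := by
  have h1 := H.sq_le_integral (F v) h
  have hL := H.L_pos
  have h2 : 0 ≤ (h - F v) ^ 2 / (2 * L) := by positivity
  unfold relEnergy
  rw [H.background_eq_zero v hv, H.apply_zero] at h1
  rw [H.background_eq_zero v hv] at h2 ⊢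
  linarith

theorem relEnergy_background (_H : IsEnergyInverse F W L τ) (v : R3) :
    relEnergy F τ v (F v) = 0 := by
  simp [relEnergy]

theorem hasDerivAt_primitive (H : IsEnergyInverse F W L τ) (h : ℝ) :
    HasDerivAt (fun h => ∫ u in (0)..h, τ u) (τ h) h :=
  intervalIntegral.integral_hasDerivAt_right (H.continuous.intervalIntegrable _ _)
    H.continuous.stronglyMeasurable.stronglyMeasurableAtFilter H.continuous.continuousAt

theorem contDiff_primitive (H : IsEnergyInverse F W L τ) :
    ContDiff ℝ 1 fun h => ∫ u in (0)..h, τ u := by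
  rw [contDiff_one_iff_deriv]
  refine ⟨fun h => (H.hasDerivAt_primitive h).differentiableAt, ?_⟩
  have : deriv (fun h => ∫ u in (0)..h, τ u) = τ := funext fun h => (H.hasDerivAt_primitive h).deriv
  rw [this]; exact H.continuous

theorem contDiff_relEnergy (H : IsEnergyInverse F W L τ) (hF : ContDiff ℝ 2 F) :
    ContDiff ℝ 1 fun z : R3 × ℝ => relEnergy F τ z.1 z.2 := by
  have hF1 : ContDiff ℝ 1 fun z : R3 × ℝ => F z.1 := (hF.of_le (by norm_num)).comp contDiff_fst
  unfold relEnergy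
  refine ((((contDiff_norm_sq ℝ).comp contDiff_fst).div_const 2).mul (contDiff_snd.sub hF1)).sub
    ((H.contDiff_primitive.comp contDiff_snd).sub (H.contDiff_primitive.comp hF1))

theorem sub_mul_fderiv_background (H : IsEnergyInverse F W L τ) (v w : R3) :
    (τ (F v) - ‖v‖ ^ 2 / 2) * fderiv ℝ F v w = 0 := by
  rcases le_or_gt ‖v‖ W with hv | hv
  · rw [H.apply_background v hv, sub_self, zero_mul]
  · have : F =ᶠ[nhds v] fun _ => 0 := by
      filter_upwards [(isOpen_lt continuous_const continuous_norm).mem_nhds hv] with u hu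
      exact H.background_eq_zero u (le_of_lt hu)
    rw [this.fderiv_eq]; simp

/-- Derivative of the relative energy along a curve in velocity space and in the density. -/
theorem hasDerivAt_relEnergy (H : IsEnergyInverse F W L τ) (hF : ContDiff ℝ 2 F) {v : ℝ → R3}
    {g : ℝ → ℝ} {v' : R3} {g' s : ℝ} (hv : HasDerivAt v v' s) (hg : HasDerivAt g g' s) :
    HasDerivAt (fun s => relEnergy F τ (v s) (g s))
      (inner ℝ (v s) v' * (g s - F (v s)) + (‖v s‖ ^ 2 / 2 - τ (g s)) * g') s := by
  have hFd : HasDerivAt (fun s => F (v s)) (fderiv ℝ F (v s) v') s :=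
    ((hF.differentiable (by norm_num)) (v s)).hasFDerivAt.comp_hasDerivAt s hv
  have h1 : HasDerivAt (fun s => ‖v s‖ ^ 2 / 2) (inner ℝ (v s) v') s := by
    have := (hv.norm_sq).div_const 2
    simpa using this
  have h2 := (H.hasDerivAt_primitive (g s)).comp s hg
  have h3 := (H.hasDerivAt_primitive (F (v s))).comp s hFd
  have h4 := (h1.mul (hg.sub hFd)).sub (h2.sub h3)
  refine h4.congr_deriv ?_
  have := H.sub_mul_fderiv_background (v s) v'
  simp only [Pi.sub_apply]
  linear_combination this

end IsEnergyInverse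

/-! ### First properties of solutions: decay of the field and support in velocity -/

theorem abs_le_of_weightedNorm_le {q : ℝ} {g : R3 → ℝ} {K : ℝ≥0} (h : weightedNorm q g ≤ K) (x : R3) :
    |g x| ≤ K * weightR x ^ (-q) := by
  have h1 : ENNReal.ofReal |g x * weightR x ^ q| ≤ K := (le_iSup _ x).trans h
  have hx := weightR_rpow_pos x q
  rw [← ENNReal.ofReal_coe_nnreal, ENNReal.ofReal_le_ofReal_iff K.coe_nonneg, abs_mul, abs_of_pos hx] at h1
  rw [Real.rpow_neg (weightR_pos x).le]
  field_simp
  exact h1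

theorem exists_norm_electricField_le {p : ℝ} (hp : 3 < p) (K : ℝ) :
    ∃ C : ℝ, 0 < C ∧ ∀ (F : R3 → ℝ) (f : ℝ → R3 → R3 → ℝ) (t : ℝ),
      (∀ y, |chargeDensity F f t y| ≤ K * weightR y ^ (-p)) →
        ∀ x, ‖electricField F f t x‖ ≤ C * weightR x ^ (-2 : ℝ) := by
  obtain ⟨C, hC, h⟩ := exists_integral_weightR_mul_norm_sub_le (a := p) (s := 2) (by norm_num)
    (by norm_num) hp
  refine ⟨(|K| + 1) * C, by positivity, fun F f t hρ x => ?_⟩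
  have hi := (integrable_weightR_mul_norm_sub (a := p) (s := 2) (by norm_num)
    (by norm_num) hp x).const_mul (|K| + 1)
  refine (norm_integral_le_of_norm_le hi (Filter.Eventually.of_forall fun y => ?_)).trans ?_
  · have hy := weightR_rpow_pos y (-p)
    rw [fieldIntegrand, norm_div_norm_cube_smul, ← mul_assoc]
    gcongr
    refine (hρ y).trans ?_
    gcongr
    linarith [le_abs_self K]
  · rw [integral_const_mul, mul_assoc]
    gcongr
    exact h x

namespace IsVlasovPoissonSolution

variable {p T : ℝ} {F : R3 → ℝ} {f₀ : R3 → R3 → ℝ} {A : ℝ → R3 → R3} {f : ℝ → R3 → R3 → ℝ}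

theorem contDiffAt (hf : IsVlasovPoissonSolution p T F f₀ A f) {t : ℝ} (ht : t ∈ Ioo 0 T)
    (z : R3 × R3) : ContDiffAt ℝ 1 (fun z : ℝ × R3 × R3 => f z.1 z.2.1 z.2.2) (t, z) :=
  hf.contDiff.contDiffAt (prod_mem_nhds (Icc_mem_nhds ht.1 ht.2) Filter.univ_mem)

theorem differentiableAt (hf : IsVlasovPoissonSolution p T F f₀ A f) {t : ℝ} (ht : t ∈ Ioo 0 T)
    (z : R3 × R3) : DifferentiableAt ℝ (fun z : ℝ × R3 × R3 => f z.1 z.2.1 z.2.2) (t, z) :=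
  (hf.contDiffAt ht z).differentiableAt (by norm_num)

theorem hasDerivAt_comp (hf : IsVlasovPoissonSolution p T F f₀ A f) {s : ℝ} {θ : ℝ → ℝ}
    {x v : ℝ → R3} {θ' : ℝ} {x' v' : R3} (hs : θ s ∈ Ioo 0 T) (hθ : HasDerivAt θ θ' s)
    (hx : HasDerivAt x x' s) (hv : HasDerivAt v v' s) :
    HasDerivAt (fun s => f (θ s) (x s) (v s))
      (fderiv ℝ (fun z : ℝ × R3 × R3 => f z.1 z.2.1 z.2.2) (θ s, x s, v s) (θ', x', v')) s := by
  have h1 : HasDerivAt (fun s => (θ s, x s, v s)) (θ', x', v') s := hθ.prodMk (hx.prodMk hv)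
  have h2 := (hf.differentiableAt hs (x s, v s)).hasFDerivAt
  exact HasFDerivAt.comp_hasDerivAt (f := fun s => (θ s, x s, v s)) s h2 h1

/-- The transport equation as the vanishing of a directional derivative. -/
theorem fderiv_eq_zero (hf : IsVlasovPoissonSolution p T F f₀ A f) {t : ℝ} (ht : t ∈ Ioo 0 T)
    (x v : R3) :
    fderiv ℝ (fun z : ℝ × R3 × R3 => f z.1 z.2.1 z.2.2) (t, x, v)
      (1, v, -(electricField F f t x + A t x)) = 0 := by
  set D := fderiv ℝ (fun z : ℝ × R3 × R3 => f z.1 z.2.1 z.2.2) (t, x, v) with hD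
  have hd : HasFDerivAt (fun z : ℝ × R3 × R3 => f z.1 z.2.1 z.2.2) D (t, x, v) :=
    (hf.differentiableAt ht (x, v)).hasFDerivAt
  set a := electricField F f t x + A t x with ha
  have h1 : derivWithin (fun s => f s x v) (Icc 0 T) t = D (1, 0, 0) := by
    rw [derivWithin_of_mem_nhds (Icc_mem_nhds ht.1 ht.2)]
    exact (hf.hasDerivAt_comp ht (hasDerivAt_id t) (hasDerivAt_const t x)
      (hasDerivAt_const t v)).deriv
  have h2 : inner ℝ v (gradient (fun y => f t y v) x) = D (0, v, 0) := by
    have h : HasFDerivAt (fun y => f t y v)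
        (D.comp ((0 : R3 →L[ℝ] ℝ).prod ((ContinuousLinearMap.id ℝ R3).prod 0))) x :=
      HasFDerivAt.comp (f := fun y => (t, y, v)) x hd
        ((hasFDerivAt_const t x).prodMk ((hasFDerivAt_id x).prodMk (hasFDerivAt_const v x)))
    rw [real_inner_comm, inner_gradient_left, h.fderiv]
    simp
  have h3 : inner ℝ a (gradient (fun w => f t x w) v) = D (0, 0, a) := by
    have h : HasFDerivAt (fun w => f t x w)
        (D.comp ((0 : R3 →L[ℝ] ℝ).prod ((0 : R3 →L[ℝ] R3).prod (ContinuousLinearMap.id ℝ R3)))) v :=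
      HasFDerivAt.comp (f := fun w => (t, x, w)) v hd
        ((hasFDerivAt_const t v).prodMk ((hasFDerivAt_const x v).prodMk (hasFDerivAt_id v)))
    rw [real_inner_comm, inner_gradient_left, h.fderiv]
    simp
  have h := hf.vlasov t ⟨ht.1.le, ht.2.le⟩ x v
  rw [h1, h2, h3, ← map_add, ← map_sub] at h
  simpa using h

theorem exists_norm_field_add_le (hp : 3 < p) (hA : AppliedFieldCondition p T A)
    (hf : IsVlasovPoissonSolution p T F f₀ A f) :
    ∃ C : ℝ, 0 < C ∧ ∀ t ∈ Icc 0 T, ∀ x,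
      ‖electricField F f t x + A t x‖ ≤ C * weightR x ^ (-2 : ℝ) := by
  obtain ⟨K, hK⟩ := hf.density_bounded
  obtain ⟨C, hC, h⟩ := exists_norm_electricField_le hp K
  obtain ⟨C', hC'⟩ := hA.decay
  refine ⟨C + |C'|, by positivity, fun t ht x => ?_⟩
  have hx := weightR_rpow_pos x (-2)
  calc _ ≤ ‖electricField F f t x‖ + ‖A t x‖ := norm_add_le _ _
    _ ≤ C * weightR x ^ (-2 : ℝ) + C' * weightR x ^ (-2 : ℝ) :=
      add_le_add (h F f t (fun y => abs_le_of_weightedNorm_le (hK t ht) y) x) (hC' t ht.1 x)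
    _ ≤ _ := by rw [← add_mul]; gcongr; exact le_abs_self C'

end IsVlasovPoissonSolution

theorem hasDerivAt_max_zero_sq (s : ℝ) :
    HasDerivAt (fun s : ℝ => max s 0 ^ 2) (2 * max s 0) s := by
  rcases lt_trichotomy s 0 with h | rfl | h
  · have : (fun s : ℝ => max s 0 ^ 2) =ᶠ[nhds s] fun _ => 0 := by
      filter_upwards [gt_mem_nhds h] with u hu
      rw [max_eq_right hu.le]; norm_num
    rw [max_eq_right h.le, mul_zero]
    exact (hasDerivAt_const s (0 : ℝ)).congr_of_eventuallyEq this
  · rw [hasDerivAt_iff_isLittleO_nhds_zero]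
    simp only [zero_add, max_self]
    norm_num
    have h1 : (fun h : ℝ => max h 0 ^ 2) =O[nhds 0] fun h => h ^ 2 :=
      Asymptotics.isBigO_of_le _ fun h => by
        rw [Real.norm_of_nonneg (by positivity), Real.norm_of_nonneg (by positivity)]
        rcases le_total h 0 with h0 | h0
        · rw [max_eq_right h0]; simpa using sq_nonneg h
        · rw [max_eq_left h0]
    have h2 : (fun h : ℝ => h ^ 2) =o[nhds 0] fun h => h := by
      simpa using Asymptotics.isLittleO_pow_id (𝕜 := ℝ) (n := 2) (by norm_num)
    exact h1.trans_isLittleO h2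
  · have : (fun s : ℝ => max s 0 ^ 2) =ᶠ[nhds s] fun s => s ^ 2 := by
      filter_upwards [lt_mem_nhds h] with u hu
      rw [max_eq_left hu.le]
    rw [max_eq_left h.le]
    have h2 : HasDerivAt (fun s : ℝ => s ^ 2) (2 * s) s := by simpa using hasDerivAt_pow 2 s
    exact h2.congr_of_eventuallyEq this

theorem contDiff_max_zero_sq : ContDiff ℝ 1 fun s : ℝ => max s 0 ^ 2 := by
  rw [contDiff_one_iff_deriv]
  refine ⟨fun s => (hasDerivAt_max_zero_sq s).differentiableAt, ?_⟩
  have : deriv (fun s : ℝ => max s 0 ^ 2) = fun s => 2 * max s 0 :=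
    funext fun s => (hasDerivAt_max_zero_sq s).deriv
  rw [this]; fun_prop

theorem exists_lt_of_hasDerivAt_neg {m : ℝ → ℝ} {m' t : ℝ} (ht : 0 < t) (hm : HasDerivAt m m' t)
    (hneg : m' < 0) : ∃ s ∈ Ioo 0 t, m t < m s := by
  have h1 := (hasDerivAt_iff_tendsto_slope.1 hm).eventually (gt_mem_nhds hneg)
  have h2 : ∀ᶠ s in nhdsWithin t (Iio t), slope m t s < 0 :=
    h1.filter_mono (nhdsWithin_mono t fun s hs => ne_of_lt hs)
  obtain ⟨s, hs1, hs2⟩ := (h2.and (Ioo_mem_nhdsLT ht)).exists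
  refine ⟨s, hs2, ?_⟩
  rw [slope_def_field, div_neg_iff] at hs1
  rcases hs1 with h | h
  · linarith
  · linarith [hs2.2]

/-- If a nonnegative cutoff decreases strictly along the flow wherever it is positive, then
`f` times the cutoff stays nonpositive. -/
theorem IsVlasovPoissonSolution.mul_nonpos_of_cutoff {p T : ℝ} {F : R3 → ℝ} {f₀ : R3 → R3 → ℝ}
    {A : ℝ → R3 → R3} {f : ℝ → R3 → R3 → ℝ} (hf : IsVlasovPoissonSolution p T F f₀ A f)
    {χ : ℝ → R3 → R3 → ℝ} (hχ : Continuous fun z : ℝ × R3 × R3 => χ z.1 z.2.1 z.2.2)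
    (hχ0 : ∀ t x v, 0 ≤ χ t x v) {r : ℝ}
    (hsupp : ∀ t x v, 0 ≤ t → χ t x v ≠ 0 → ‖x‖ ≤ r ∧ ‖v‖ ≤ r)
    (hstart : ∀ x v, f₀ x v * χ 0 x v = 0)
    (hdecr : ∀ t ∈ Ioo 0 T, ∀ x v, 0 < χ t x v → ∃ χ' < 0, HasDerivAt (fun s => χ s (x + (s - t) • v)
      (v - (s - t) • (electricField F f t x + A t x))) χ' t)
    {t : ℝ} (ht : t ∈ Ioo 0 T) (x v : R3) : f t x v * χ t x v ≤ 0 := by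
  by_contra! hcon
  set m : ℝ × R3 × R3 → ℝ := fun z => f z.1 z.2.1 z.2.2 * χ z.1 z.2.1 z.2.2 with hm
  set S : Set (ℝ × R3 × R3) := Icc 0 t ×ˢ (Metric.closedBall 0 r ×ˢ Metric.closedBall 0 r) with hS
  have hScomp : IsCompact S :=
    isCompact_Icc.prod ((isCompact_closedBall _ _).prod (isCompact_closedBall _ _))
  have hmem : ∀ s x v, s ∈ Icc 0 t → m (s, x, v) ≠ 0 → (s, x, v) ∈ S := by
    intro s x v hs h
    have := hsupp s x v hs.1 (right_ne_zero_of_mul h)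
    exact ⟨hs, by simpa using this.1, by simpa using this.2⟩
  have hmcont : ContinuousOn m S := by
    refine (hf.contDiff.continuousOn.mono ?_).mul hχ.continuousOn
    rintro ⟨s, z⟩ hs
    exact ⟨⟨hs.1.1, hs.1.2.trans ht.2.le⟩, mem_univ _⟩
  obtain ⟨⟨t₀, x₀, v₀⟩, hz₀, hmax⟩ := hScomp.exists_isMaxOn
    ⟨_, hmem t x v ⟨ht.1.le, le_rfl⟩ (ne_of_gt hcon)⟩ hmcont
  have hpos : 0 < m (t₀, x₀, v₀) :=
    lt_of_lt_of_le hcon (hmax (hmem t x v ⟨ht.1.le, le_rfl⟩ (ne_of_gt hcon)))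
  have ht₀ : 0 < t₀ := by
    rcases hz₀.1.1.eq_or_lt with h | h
    · exfalso
      simp only at h
      subst h
      simp only [hm, hf.initial, hstart, lt_self_iff_false] at hpos
    · exact h
  have ht₀T : t₀ ∈ Ioo 0 T := ⟨ht₀, lt_of_le_of_lt hz₀.1.2 ht.2⟩
  have hfpos : 0 < f t₀ x₀ v₀ := lt_of_le_of_ne (hf.nonneg t₀ ⟨ht₀.le, ht₀T.2.le⟩ x₀ v₀)
    (left_ne_zero_of_mul hpos.ne').symm
  have hχpos : 0 < χ t₀ x₀ v₀ := lt_of_le_of_ne (hχ0 _ _ _) (right_ne_zero_of_mul hpos.ne').symm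
  obtain ⟨χ', hχ', hder⟩ := hdecr t₀ ht₀T x₀ v₀ hχpos
  set a := electricField F f t₀ x₀ + A t₀ x₀ with ha
  have hx : HasDerivAt (fun s : ℝ => x₀ + (s - t₀) • v₀) v₀ t₀ := by
    have := (((hasDerivAt_id t₀).sub_const t₀).smul_const v₀).const_add x₀
    simpa using this
  have hv : HasDerivAt (fun s : ℝ => v₀ - (s - t₀) • a) (-a) t₀ := by
    have := (((hasDerivAt_id t₀).sub_const t₀).smul_const a).const_sub v₀
    simpa using this
  have hfd := hf.hasDerivAt_comp (θ := fun s => s) ht₀T (hasDerivAt_id t₀) hx hv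
  simp only [sub_self, zero_smul, add_zero, sub_zero] at hfd
  rw [hf.fderiv_eq_zero ht₀T] at hfd
  have hmd := hfd.mul hder
  simp only [sub_self, zero_smul, add_zero, sub_zero, zero_mul, zero_add] at hmd
  obtain ⟨s, hs, hlt⟩ := exists_lt_of_hasDerivAt_neg ht₀ hmd (mul_neg_of_pos_of_neg hfpos hχ')
  simp only [Pi.mul_apply, sub_self, zero_smul, add_zero, sub_zero] at hlt
  have hs' : s ∈ Icc 0 t := ⟨hs.1.le, hs.2.le.trans hz₀.1.2⟩
  have hlt' : m (t₀, x₀, v₀) < m (s, x₀ + (s - t₀) • v₀, v₀ - (s - t₀) • a) := hlt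
  exact absurd (hmax (hmem _ _ _ hs' (ne_of_gt (hpos.trans hlt')))) (not_le.2 hlt')

theorem exists_hasDerivAt_cutoff_neg {g₁ g₂ g₃ : ℝ → ℝ} {d₁ d₂ d₃ s : ℝ}
    (h₁ : HasDerivAt g₁ d₁ s) (h₂ : HasDerivAt g₂ d₂ s) (h₃ : HasDerivAt g₃ d₃ s)
    (hd₁ : d₁ ≤ 0) (hd₂ : d₂ ≤ 0) (hd₃ : d₃ ≤ 0) (hg₁ : 0 < g₁ s) (hg₂ : 0 < g₂ s)
    (hg₃ : 0 < g₃ s) :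
    ∃ χ' < 0, HasDerivAt (fun u => Real.exp (-u) *
      (max (g₁ u) 0 ^ 2 * (max (g₂ u) 0 ^ 2 * max (g₃ u) 0 ^ 2))) χ' s := by
  have d₁' := (hasDerivAt_max_zero_sq (g₁ s)).comp s h₁
  have d₂' := (hasDerivAt_max_zero_sq (g₂ s)).comp s h₂
  have d₃' := (hasDerivAt_max_zero_sq (g₃ s)).comp s h₃
  have d₀ : HasDerivAt (fun u : ℝ => Real.exp (-u)) (-Real.exp (-s)) s := by
    simpa using (hasDerivAt_neg s).exp
  refine ⟨_, ?_, d₀.mul (d₁'.mul (d₂'.mul d₃'))⟩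
  simp only [Function.comp, max_eq_left hg₁.le, max_eq_left hg₂.le,
    max_eq_left hg₃.le]
  generalize g₁ s = α at *
  generalize g₂ s = β at *
  generalize g₃ s = γ at *
  have k1 : 2 * α * d₁ ≤ 0 := mul_nonpos_of_nonneg_of_nonpos (by positivity) hd₁
  have k2 : 2 * β * d₂ ≤ 0 := mul_nonpos_of_nonneg_of_nonpos (by positivity) hd₂
  have k3 : 2 * γ * d₃ ≤ 0 := mul_nonpos_of_nonneg_of_nonpos (by positivity) hd₃
  have q : 0 < α ^ 2 * (β ^ 2 * γ ^ 2) := by positivity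
  have q1 : 2 * α * d₁ * (β ^ 2 * γ ^ 2) ≤ 0 := mul_nonpos_of_nonpos_of_nonneg k1 (by positivity)
  have q2 : α ^ 2 * (2 * β * d₂ * γ ^ 2) ≤ 0 :=
    mul_nonpos_of_nonneg_of_nonpos (by positivity) (mul_nonpos_of_nonpos_of_nonneg k2 (by positivity))
  have q3 : α ^ 2 * (β ^ 2 * (2 * γ * d₃)) ≤ 0 :=
    mul_nonpos_of_nonneg_of_nonpos (by positivity) (mul_nonpos_of_nonneg_of_nonpos (by positivity) k3)
  have key : -(α ^ 2 * (β ^ 2 * γ ^ 2)) + 2 * α * d₁ * (β ^ 2 * γ ^ 2) +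
      α ^ 2 * (2 * β * d₂ * γ ^ 2) + α ^ 2 * (β ^ 2 * (2 * γ * d₃)) < 0 := by linarith
  refine lt_of_eq_of_lt ?_ (mul_neg_of_pos_of_neg (Real.exp_pos (-s)) key)
  ring

/-- Solutions have bounded support in velocity. -/
theorem IsVlasovPoissonSolution.exists_velocity_bound {p T : ℝ} {F : R3 → ℝ} {f₀ : R3 → R3 → ℝ}
    {A : ℝ → R3 → R3} {f : ℝ → R3 → R3 → ℝ} (hp : 3 < p) (hT : 0 < T)
    (hF : BackgroundCondition F) (hf₀ : InitialCondition F f₀) (hA : AppliedFieldCondition p T A)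
    (hf : IsVlasovPoissonSolution p T F f₀ A f) :
    ∃ P : ℝ, 0 < P ∧ (∀ v, P ≤ ‖v‖ → F v = 0) ∧
      ∀ t ∈ Icc 0 T, ∀ x v, P ≤ ‖v‖ → f t x v = 0 := by
  obtain ⟨W, L, τ, hτ⟩ := hF.exists_isEnergyInverse
  obtain ⟨B, hB⟩ := hf₀.compact_support
  obtain ⟨K, hK, hfield⟩ := hf.exists_norm_field_add_le hp hA
  have hfield' : ∀ t ∈ Icc 0 T, ∀ x, ‖electricField F f t x + A t x‖ ≤ K := fun t ht x =>
    (hfield t ht x).trans (by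
      have := weightR_rpow_le_one x (a := -2) (by norm_num)
      nlinarith)
  set b := 1 + max B W with hb
  have hbW : W < b := by have := le_max_right B W; linarith
  have hbB : B + 1 ≤ b := by have := le_max_left B W; linarith
  have hW := hτ.W_pos
  have hP : ∀ v, b + K * T + 1 ≤ ‖v‖ → F v = 0 := fun v hv =>
    hτ.background_eq_zero v (by nlinarith [mul_pos hK hT])
  refine ⟨b + K * T + 1, by nlinarith [mul_pos hK hT], hP, ?_⟩
  suffices H : ∀ t ∈ Ioo 0 T, ∀ x v, b + K * T + 1 ≤ ‖v‖ → f t x v = 0 by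
    intro t ht x v hv
    have hc : ContinuousOn (fun t => f t x v) (Icc 0 T) :=
      hf.contDiff.continuousOn.comp (f := fun t : ℝ => ((t, x, v) : ℝ × R3 × R3))
        (by fun_prop) fun s hs => ⟨hs, mem_univ _⟩
    have he : EqOn (fun t => f t x v) (fun _ => 0) (Ioo 0 T) := fun s hs => H s hs x v hv
    exact he.of_subset_closure hc continuousOn_const Ioo_subset_Icc_self
      (by rw [closure_Ioo hT.ne]) ht
  intro t ht x v hv
  set V := weightR v + K * T + 1 with hV
  set r := weightR x + V * T + 1 with hr
  have hV0 : 0 < V := by nlinarith [mul_pos hK hT, weightR_pos v]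
  set χ : ℝ → R3 → R3 → ℝ := fun s y w => Real.exp (-s) *
    (max (weightR w - b - K * s) 0 ^ 2 * (max (V - weightR w - K * s) 0 ^ 2 *
      max (r - weightR y - V * s) 0 ^ 2)) with hχ
  have hχpos : 0 < χ t x v := by
    have h1 : 0 < weightR v - b - K * t := by
      have := norm_le_weightR v
      nlinarith [ht.2]
    have h2 : 0 < V - weightR v - K * t := by nlinarith [ht.2]
    have h3 : 0 < r - weightR x - V * t := by nlinarith [ht.2]
    simp only [hχ, max_eq_left h1.le, max_eq_left h2.le, max_eq_left h3.le]
    positivity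
  have hfac : ∀ s y w, χ s y w ≠ 0 → 0 < weightR w - b - K * s ∧ 0 < V - weightR w - K * s ∧
      0 < r - weightR y - V * s := by
    intro s y w h
    refine ⟨?_, ?_, ?_⟩ <;>
    · by_contra! hc
      simp [hχ, max_eq_right hc] at h
  have hle := hf.mul_nonpos_of_cutoff (χ := χ) (r := V + r) ?_ ?_ ?_ ?_ ?_ ht x v
  · exact le_antisymm (by nlinarith) (hf.nonneg t ⟨ht.1.le, ht.2.le⟩ x v)
  · have := continuous_weightR
    simp only [hχ]
    fun_prop
  · intro s y w; simp only [hχ]; positivity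
  · intro s y w hs h
    obtain ⟨-, h2, h3⟩ := hfac s y w h
    have i1 := norm_le_weightR w
    have i2 := norm_le_weightR y
    have i3 := mul_nonneg hK.le hs
    have i4 := mul_nonneg hV0.le hs
    have i5 : 0 < r := by nlinarith [mul_pos hV0 hT, weightR_pos x]
    constructor <;> linarith
  · intro y w
    by_cases h : χ 0 y w = 0
    · rw [h, mul_zero]
    · obtain ⟨h1, -, -⟩ := hfac 0 y w h
      have i1 := weightR_le_one_add_norm w
      have hw : W ≤ ‖w‖ := by
        have := le_max_right B W
        linarith
      have hw' : B < ‖w‖ := by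
        have := le_max_left B W
        linarith
      have := hB y w hw'
      rw [hτ.background_eq_zero w hw] at this
      rw [show f₀ y w = 0 by linarith, zero_mul]
  · intro s hs y w hpos
    set a := electricField F f s y + A s y with ha
    obtain ⟨h1, h2, h3⟩ := hfac s y w hpos.ne'
    have hw : HasDerivAt (fun u : ℝ => w - (u - s) • a) (-a) s := by
      have := (((hasDerivAt_id s).sub_const s).smul_const a).const_sub w
      simpa using this
    have hy : HasDerivAt (fun u : ℝ => y + (u - s) • w) w s := by
      have := (((hasDerivAt_id s).sub_const s).smul_const w).const_add y
      simpa using this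
    have hd : Differentiable ℝ weightR := (contDiff_weightR (n := 1)).differentiable (by norm_num)
    have hRw : HasDerivAt (fun u : ℝ => weightR (w - (u - s) • a)) (fderiv ℝ weightR w (-a)) s := by
      exact HasFDerivAt.comp_hasDerivAt_of_eq s (hd w).hasFDerivAt hw (by simp)
    have hRy : HasDerivAt (fun u : ℝ => weightR (y + (u - s) • w)) (fderiv ℝ weightR y w) s := by
      exact HasFDerivAt.comp_hasDerivAt_of_eq s (hd y).hasFDerivAt hy (by simp)
    set dw := fderiv ℝ weightR w (-a) with hdw
    set dy := fderiv ℝ weightR y w with hdy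
    have bdw : |dw| ≤ K := by
      calc |dw| ≤ ‖fderiv ℝ weightR w‖ * ‖-a‖ := (fderiv ℝ weightR w).le_opNorm _
        _ ≤ 1 * K := by
          gcongr
          · exact norm_fderiv_weightR_le w
          · rw [norm_neg]; exact hfield' s ⟨hs.1.le, hs.2.le⟩ y
        _ = K := one_mul K
    have bdy : |dy| ≤ V := by
      calc |dy| ≤ ‖fderiv ℝ weightR y‖ * ‖w‖ := (fderiv ℝ weightR y).le_opNorm _
        _ ≤ 1 * V := by
          gcongr
          · exact norm_fderiv_weightR_le y
          · have := norm_le_weightR w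
            have := mul_pos hK hs.1
            linarith
        _ = V := one_mul V
    have hlin : ∀ c : ℝ, HasDerivAt (fun u : ℝ => c * u) c s := fun c => by
      simpa using (hasDerivAt_id s).const_mul c
    refine exists_hasDerivAt_cutoff_neg ((hRw.sub_const b).sub (hlin K)) ((hRw.const_sub V).sub (hlin K))
      ((hRy.const_sub r).sub (hlin V)) ?_ ?_ ?_ ?_ ?_ ?_
    · linarith [(abs_le.1 bdw).2]
    · linarith [(abs_le.1 bdw).1]
    · linarith [(abs_le.1 bdy).1]
    · simpa using h1
    · simpa using h2
    · simpa using h3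

/-! ### Moments of phase space functions -/

theorem integrable_of_continuous_of_eq_zero {Z G : Type*} [TopologicalSpace Z] [T2Space Z]
    [MeasurableSpace Z] [OpensMeasurableSpace Z] [NormedAddCommGroup G] [SecondCountableTopology Z]
    {μ : Measure Z} [IsFiniteMeasureOnCompacts μ] {g : Z → G} (hg : Continuous g) {k : Set Z}
    (hk : IsCompact k) (h0 : ∀ z, z ∉ k → g z = 0) : Integrable g μ :=
  hg.integrable_of_hasCompactSupport (HasCompactSupport.intro hk h0)

/-- Differentiation under the integral sign for continuously differentiable integrands with uniform
compact support. -/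
theorem hasDerivAt_integral_of_compact {Z : Type*} [NormedAddCommGroup Z] [MeasurableSpace Z]
    [BorelSpace Z] [SecondCountableTopology Z] {μ : Measure Z} [IsFiniteMeasureOnCompacts μ]
    {Ψ Ψ' : ℝ → Z → ℝ} {k : Set Z} (hk : IsCompact k) {a b t : ℝ} (ht : t ∈ Ioo a b)
    (hΨ : ContinuousOn (fun z : ℝ × Z => Ψ z.1 z.2) (Ioo a b ×ˢ univ))
    (hΨ' : ContinuousOn (fun z : ℝ × Z => Ψ' z.1 z.2) (Ioo a b ×ˢ univ))
    (hd : ∀ s ∈ Ioo a b, ∀ z, HasDerivAt (fun s => Ψ s z) (Ψ' s z) s)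
    (h0 : ∀ s ∈ Ioo a b, ∀ z, z ∉ k → Ψ s z = 0) :
    HasDerivAt (fun s => ∫ z, Ψ s z ∂μ) (∫ z, Ψ' t z ∂μ) t := by
  obtain ⟨ε, hε, hball⟩ := Metric.nhds_basis_closedBall.mem_iff.1 (Ioo_mem_nhds ht.1 ht.2)
  have h0' : ∀ s ∈ Ioo a b, ∀ z, z ∉ k → Ψ' s z = 0 := by
    intro s hs z hz
    have : (fun s => Ψ s z) =ᶠ[nhds s] fun _ => 0 := by
      filter_upwards [Ioo_mem_nhds hs.1 hs.2] with u hu using h0 u hu z hz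
    exact (hd s hs z).unique ((hasDerivAt_const s (0 : ℝ)).congr_of_eventuallyEq this)
  have hcs : ∀ s ∈ Ioo a b, Continuous (Ψ s) := fun s hs =>
    continuousOn_univ.1 (hΨ.comp (f := fun z : Z => (s, z)) (by fun_prop) fun z _ => ⟨hs, mem_univ _⟩)
  have hcs' : ∀ s ∈ Ioo a b, Continuous (Ψ' s) := fun s hs =>
    continuousOn_univ.1 (hΨ'.comp (f := fun z : Z => (s, z)) (by fun_prop) fun z _ => ⟨hs, mem_univ _⟩)
  obtain ⟨C, hC⟩ := ((isCompact_closedBall t ε).prod hk).exists_bound_of_continuousOn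
    (hΨ'.mono fun z hz => ⟨hball hz.1, mem_univ _⟩)
  refine (hasDerivAt_integral_of_dominated_loc_of_deriv_le (μ := μ) (F := Ψ) (F' := Ψ')
    (bound := k.indicator fun _ => C) (Metric.closedBall_mem_nhds t hε) ?_ ?_ ?_ ?_ ?_ ?_).2
  · filter_upwards [Ioo_mem_nhds ht.1 ht.2] with s hs using (hcs s hs).aestronglyMeasurable
  · exact integrable_of_continuous_of_eq_zero (hcs t ht) hk (h0 t ht)
  · exact (hcs' t ht).aestronglyMeasurable
  · refine Filter.Eventually.of_forall fun z s hs => ?_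
    by_cases hz : z ∈ k
    · rw [indicator_of_mem hz]; exact hC (s, z) ⟨hs, hz⟩
    · rw [indicator_of_notMem hz, h0' s (hball hs) z hz, norm_zero]
  · exact (integrable_indicator_iff hk.measurableSet).2 (integrableOn_const hk.measure_ne_top)
  · exact Filter.Eventually.of_forall fun z s hs => hd s (hball hs) z

/-- A `C¹` function on `[0, T] × ℝ³ × ℝ³` vanishing for `|v| ≥ P`. -/
structure IsPhaseFunction (T P : ℝ) (g : ℝ → R3 → R3 → ℝ) : Prop where
  contDiff : ContDiffOn ℝ 1 (fun z : ℝ × R3 × R3 => g z.1 z.2.1 z.2.2) (Icc 0 T ×ˢ univ)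
  eq_zero : ∀ t ∈ Icc 0 T, ∀ x v, P ≤ ‖v‖ → g t x v = 0

/-- The total derivative of a function on `ℝ × ℝ³ × ℝ³`. -/
noncomputable def phaseDeriv (g : ℝ → R3 → R3 → ℝ) (t : ℝ) (x v : R3) : ℝ × R3 × R3 →L[ℝ] ℝ :=
  fderiv ℝ (fun z : ℝ × R3 × R3 => g z.1 z.2.1 z.2.2) (t, x, v)

namespace IsPhaseFunction

variable {T P : ℝ} {g : ℝ → R3 → R3 → ℝ}

theorem contDiffAt (hg : IsPhaseFunction T P g) {t : ℝ} (ht : t ∈ Ioo 0 T) (x v : R3) :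
    ContDiffAt ℝ 1 (fun z : ℝ × R3 × R3 => g z.1 z.2.1 z.2.2) (t, x, v) :=
  hg.contDiff.contDiffAt (prod_mem_nhds (Icc_mem_nhds ht.1 ht.2) Filter.univ_mem)

theorem hasFDerivAt (hg : IsPhaseFunction T P g) {t : ℝ} (ht : t ∈ Ioo 0 T) (x v : R3) :
    HasFDerivAt (fun z : ℝ × R3 × R3 => g z.1 z.2.1 z.2.2) (phaseDeriv g t x v) (t, x, v) :=
  ((hg.contDiffAt ht x v).differentiableAt (by norm_num)).hasFDerivAt

theorem continuousOn_phaseDeriv (hg : IsPhaseFunction T P g) :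
    ContinuousOn (fun z : ℝ × R3 × R3 => phaseDeriv g z.1 z.2.1 z.2.2) (Ioo 0 T ×ˢ univ) :=
  (hg.contDiff.mono (prod_mono Ioo_subset_Icc_self subset_rfl)).continuousOn_fderiv_of_isOpen
    (isOpen_Ioo.prod isOpen_univ) le_rfl

theorem continuous_slice (hg : IsPhaseFunction T P g) {t : ℝ} (ht : t ∈ Icc 0 T) :
    Continuous fun z : R3 × R3 => g t z.1 z.2 :=
  continuousOn_univ.1 (hg.contDiff.continuousOn.comp (f := fun z : R3 × R3 => (t, z)) (by fun_prop)
    fun z _ => ⟨ht, mem_univ _⟩)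

theorem hasDerivAt_time (hg : IsPhaseFunction T P g) {t : ℝ} (ht : t ∈ Ioo 0 T) (x v : R3) :
    HasDerivAt (fun s => g s x v) (phaseDeriv g t x v (1, 0, 0)) t :=
  HasFDerivAt.comp_hasDerivAt (f := fun s => (s, x, v)) t (hg.hasFDerivAt ht x v)
    ((hasDerivAt_id t).prodMk ((hasDerivAt_const t x).prodMk (hasDerivAt_const t v)))

theorem hasFDerivAt_space (hg : IsPhaseFunction T P g) {t : ℝ} (ht : t ∈ Ioo 0 T) (x v : R3) :
    HasFDerivAt (fun y => g t y v) ((phaseDeriv g t x v).comp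
      ((0 : R3 →L[ℝ] ℝ).prod ((ContinuousLinearMap.id ℝ R3).prod 0))) x :=
  HasFDerivAt.comp (f := fun y => (t, y, v)) x (hg.hasFDerivAt ht x v)
    ((hasFDerivAt_const t x).prodMk ((hasFDerivAt_id x).prodMk (hasFDerivAt_const v x)))

theorem hasFDerivAt_velocity (hg : IsPhaseFunction T P g) {t : ℝ} (ht : t ∈ Ioo 0 T) (x v : R3) :
    HasFDerivAt (fun w => g t x w) ((phaseDeriv g t x v).comp
      ((0 : R3 →L[ℝ] ℝ).prod ((0 : R3 →L[ℝ] R3).prod (ContinuousLinearMap.id ℝ R3)))) v :=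
  HasFDerivAt.comp (f := fun w => (t, x, w)) v (hg.hasFDerivAt ht x v)
    ((hasFDerivAt_const t v).prodMk ((hasFDerivAt_const x v).prodMk (hasFDerivAt_id v)))

theorem phaseDeriv_eq_zero (hg : IsPhaseFunction T P g) {t : ℝ} (ht : t ∈ Ioo 0 T) (x : R3) {v : R3}
    (hv : P < ‖v‖) : phaseDeriv g t x v = 0 := by
  have : (fun z : ℝ × R3 × R3 => g z.1 z.2.1 z.2.2) =ᶠ[nhds (t, x, v)] fun _ => 0 := by
    have h1 : Ioo 0 T ×ˢ ((univ : Set R3) ×ˢ {w : R3 | P < ‖w‖}) ∈ nhds (t, x, v) :=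
      prod_mem_nhds (Ioo_mem_nhds ht.1 ht.2) (prod_mem_nhds Filter.univ_mem
        ((isOpen_lt continuous_const continuous_norm).mem_nhds hv))
    filter_upwards [h1] with z hz
    exact hg.eq_zero z.1 (Ioo_subset_Icc_self hz.1) _ _ (le_of_lt hz.2.2)
  rw [phaseDeriv, this.fderiv_eq]
  simp

theorem eq_zero_of_notMem (hg : IsPhaseFunction T P g) {t : ℝ} (ht : t ∈ Icc 0 T) (x : R3) {v : R3}
    (hv : v ∉ Metric.closedBall (0 : R3) P) : g t x v = 0 :=
  hg.eq_zero t ht x v (by simpa using (not_le.1 (by simpa using hv)).le)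

theorem phaseDeriv_eq_zero_of_notMem (hg : IsPhaseFunction T P g) {t : ℝ} (ht : t ∈ Ioo 0 T) (x : R3)
    {v : R3} (hv : v ∉ Metric.closedBall (0 : R3) P) : phaseDeriv g t x v = 0 :=
  hg.phaseDeriv_eq_zero ht x (not_le.1 (by simpa using hv))

theorem continuousOn_moment (hg : IsPhaseFunction T P g) :
    ContinuousOn (fun z : ℝ × R3 => ∫ v, g z.1 z.2 v) (Icc 0 T ×ˢ univ) := by
  refine continuousOn_integral_of_compact_support (isCompact_closedBall (0 : R3) P) ?_ ?_
  · exact hg.contDiff.continuousOn.comp (f := fun z : (ℝ × R3) × R3 => (z.1.1, z.1.2, z.2))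
      (by fun_prop) fun z hz => ⟨hz.1.1, mem_univ _⟩
  · intro z v hz hv
    exact hg.eq_zero_of_notMem hz.1 _ hv

theorem continuousOn_integral_phaseDeriv (hg : IsPhaseFunction T P g) {w : R3 → ℝ × R3 × R3}
    (hw : Continuous w) :
    ContinuousOn (fun z : ℝ × R3 => ∫ v, phaseDeriv g z.1 z.2 v (w v)) (Ioo 0 T ×ˢ univ) := by
  refine continuousOn_integral_of_compact_support (isCompact_closedBall (0 : R3) P) ?_ ?_
  · refine ContinuousOn.clm_apply ?_ (by fun_prop)
    exact hg.continuousOn_phaseDeriv.comp (f := fun z : (ℝ × R3) × R3 => (z.1.1, z.1.2, z.2))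
      (by fun_prop) fun z hz => ⟨hz.1.1, mem_univ _⟩
  · intro z v hz hv
    rw [hg.phaseDeriv_eq_zero_of_notMem hz.1 _ hv]; rfl

theorem continuous_phaseDeriv_slice (hg : IsPhaseFunction T P g) {t : ℝ} (ht : t ∈ Ioo 0 T) :
    Continuous fun z : R3 × R3 => phaseDeriv g t z.1 z.2 :=
  continuousOn_univ.1 (hg.continuousOn_phaseDeriv.comp (f := fun z : R3 × R3 => (t, z))
    (by fun_prop) fun z _ => ⟨ht, mem_univ _⟩)

theorem integrable_phaseDeriv (hg : IsPhaseFunction T P g) {t : ℝ} (ht : t ∈ Ioo 0 T) (x : R3)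
    {w : R3 → ℝ × R3 × R3} (hw : Continuous w) :
    Integrable fun v => phaseDeriv g t x v (w v) := by
  refine integrable_of_continuous_of_eq_zero (k := Metric.closedBall (0 : R3) P) ?_
    (isCompact_closedBall _ _) fun v hv => ?_
  · exact ((hg.continuous_phaseDeriv_slice ht).comp (f := fun v : R3 => (x, v)) (by fun_prop)).clm_apply hw
  · rw [hg.phaseDeriv_eq_zero_of_notMem ht _ hv]; rfl

theorem hasDerivAt_moment (hg : IsPhaseFunction T P g) {t : ℝ} (ht : t ∈ Ioo 0 T) (x : R3) :
    HasDerivAt (fun s => ∫ v, g s x v) (∫ v, phaseDeriv g t x v (1, 0, 0)) t := by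
  refine hasDerivAt_integral_of_compact (Ψ := fun s v => g s x v)
    (Ψ' := fun s v => phaseDeriv g s x v (1, 0, 0)) (isCompact_closedBall (0 : R3) P) ht ?_ ?_
    (fun s hs v => hg.hasDerivAt_time hs x v)
    fun s hs v hv => hg.eq_zero_of_notMem (Ioo_subset_Icc_self hs) _ hv
  · exact hg.contDiff.continuousOn.comp (f := fun z : ℝ × R3 => (z.1, x, z.2))
      (by fun_prop) fun z hz => ⟨Ioo_subset_Icc_self hz.1, mem_univ _⟩
  · refine ContinuousOn.clm_apply ?_ continuousOn_const
    exact hg.continuousOn_phaseDeriv.comp (f := fun z : ℝ × R3 => (z.1, x, z.2))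
      (by fun_prop) fun z hz => ⟨hz.1, mem_univ _⟩

theorem integral_phaseDeriv_velocity (hg : IsPhaseFunction T P g) {t : ℝ} (ht : t ∈ Ioo 0 T)
    (x a : R3) : ∫ v, phaseDeriv g t x v (0, 0, a) = 0 := by
  have h := integral_mul_fderiv_eq_neg_fderiv_mul_of_integrable (μ := (volume : Measure R3))
    (f := fun _ : R3 => (1 : ℝ)) (g := fun v => g t x v) (v := a) (by simp) ?_ ?_
    (fun v _ => differentiableAt_const _)
    (fun v _ => (hg.hasFDerivAt_velocity ht x v).differentiableAt)
  · simp only [one_mul, (hg.hasFDerivAt_velocity ht x _).fderiv] at h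
    simpa using h
  · simp only [one_mul, (hg.hasFDerivAt_velocity ht x _).fderiv]
    simpa using hg.integrable_phaseDeriv ht x (w := fun _ => (0, 0, a)) continuous_const
  · simp only [one_mul]
    refine integrable_of_continuous_of_eq_zero ?_ (isCompact_closedBall (0 : R3) P)
      fun v hv => hg.eq_zero_of_notMem (Ioo_subset_Icc_self ht) _ hv
    exact (hg.continuous_slice (Ioo_subset_Icc_self ht)).comp (f := fun v : R3 => (x, v))
      (by fun_prop)

theorem integral_mul_integral_phaseDeriv_space (hg : IsPhaseFunction T P g) {t : ℝ}
    (ht : t ∈ Ioo 0 T) {φ : R3 → ℝ} (hφ : ContDiff ℝ 1 φ) (hφc : HasCompactSupport φ) :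
    ∫ x, φ x * ∫ v, phaseDeriv g t x v (0, v, 0) = -∫ x, ∫ v, g t x v * fderiv ℝ φ x v := by
  have ht' := Ioo_subset_Icc_self ht
  have hφ' : Continuous (fderiv ℝ φ) := hφ.continuous_fderiv (by norm_num)
  set k : Set (R3 × R3) := tsupport φ ×ˢ Metric.closedBall (0 : R3) P with hk
  have hkc : IsCompact k := hφc.isCompact.prod (isCompact_closedBall _ _)
  have c1 : Continuous fun z : R3 × R3 => φ z.1 * phaseDeriv g t z.1 z.2 (0, z.2, 0) :=
    (hφ.continuous.comp continuous_fst).mul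
      ((hg.continuous_phaseDeriv_slice ht).clm_apply (by fun_prop))
  have c2 : Continuous fun z : R3 × R3 => g t z.1 z.2 * fderiv ℝ φ z.1 z.2 :=
    (hg.continuous_slice ht').mul ((hφ'.comp continuous_fst).clm_apply continuous_snd)
  have z1 : ∀ z : R3 × R3, z ∉ k → φ z.1 * phaseDeriv g t z.1 z.2 (0, z.2, 0) = 0 := by
    intro z hz
    by_cases h : z.1 ∈ tsupport φ
    · rw [hg.phaseDeriv_eq_zero_of_notMem ht _ fun h' => hz ⟨h, h'⟩]; simp
    · rw [image_eq_zero_of_notMem_tsupport h, zero_mul]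
  have z2 : ∀ z : R3 × R3, z ∉ k → g t z.1 z.2 * fderiv ℝ φ z.1 z.2 = 0 := by
    intro z hz
    by_cases h : z.1 ∈ tsupport φ
    · rw [hg.eq_zero_of_notMem ht' _ fun h' => hz ⟨h, h'⟩]; simp
    · have : fderiv ℝ φ z.1 = 0 := image_eq_zero_of_notMem_tsupport
        fun h' => h (tsupport_fderiv_subset ℝ h')
      rw [this]; simp
  have i1 : Integrable (fun z : R3 × R3 => φ z.1 * phaseDeriv g t z.1 z.2 (0, z.2, 0))
      (volume.prod volume) := integrable_of_continuous_of_eq_zero c1 hkc z1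
  have i2 : Integrable (fun z : R3 × R3 => g t z.1 z.2 * fderiv ℝ φ z.1 z.2)
      (volume.prod volume) := integrable_of_continuous_of_eq_zero c2 hkc z2
  have e1 : ∫ x, φ x * ∫ v, phaseDeriv g t x v (0, v, 0) =
      ∫ v, ∫ x, φ x * phaseDeriv g t x v (0, v, 0) := by
    rw [← integral_integral_swap (f := fun x v => φ x * phaseDeriv g t x v (0, v, 0)) i1]
    simp only [integral_const_mul]
  have e2 : ∫ x, ∫ v, g t x v * fderiv ℝ φ x v = ∫ v, ∫ x, g t x v * fderiv ℝ φ x v :=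
    integral_integral_swap (f := fun x v => g t x v * fderiv ℝ φ x v) i2
  rw [e1, e2, ← integral_neg]
  refine integral_congr_ae (Filter.Eventually.of_forall fun v => ?_)
  have h := integral_mul_fderiv_eq_neg_fderiv_mul_of_integrable (μ := (volume : Measure R3))
    (f := φ) (g := fun x => g t x v) (v := v) ?_ ?_ ?_
    (fun x _ => hφ.differentiable (by norm_num) x)
    (fun x _ => (hg.hasFDerivAt_space ht x v).differentiableAt)
  · simp only [(hg.hasFDerivAt_space ht _ v).fderiv] at h
    simpa [mul_comm] using h
  · refine integrable_of_continuous_of_eq_zero ?_ hφc.isCompact fun x hx => ?_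
    · exact (hφ'.clm_apply continuous_const).mul ((hg.continuous_slice ht').comp
        (f := fun x : R3 => (x, v)) (by fun_prop))
    · have : fderiv ℝ φ x = 0 := image_eq_zero_of_notMem_tsupport
        fun h' => hx (tsupport_fderiv_subset ℝ h')
      rw [this]; simp
  · refine integrable_of_continuous_of_eq_zero ?_ hφc.isCompact fun x hx => ?_
    · simp only [(hg.hasFDerivAt_space ht _ v).fderiv]
      exact hφ.continuous.mul (((hg.continuous_phaseDeriv_slice ht).comp
        (f := fun x : R3 => (x, v)) (by fun_prop)).clm_comp continuous_const |>.clm_apply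
          continuous_const)
    · rw [image_eq_zero_of_notMem_tsupport hx, zero_mul]
  · refine integrable_of_continuous_of_eq_zero ?_ hφc.isCompact fun x hx => ?_
    · exact hφ.continuous.mul ((hg.continuous_slice ht').comp
        (f := fun x : R3 => (x, v)) (by fun_prop))
    · rw [image_eq_zero_of_notMem_tsupport hx, zero_mul]

/-- Time derivative of the moment of a function satisfying a transport equation with source. -/
theorem integral_phaseDeriv_time (hg : IsPhaseFunction T P g) {t : ℝ} (ht : t ∈ Ioo 0 T) {x a : R3}
    {h : R3 → ℝ} (hh : ∀ v, phaseDeriv g t x v (1, v, -a) = h v) :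
    ∫ v, phaseDeriv g t x v (1, 0, 0) = (∫ v, h v) - ∫ v, phaseDeriv g t x v (0, v, 0) := by
  have i1 := hg.integrable_phaseDeriv ht x (w := fun v => (1, v, -a)) (by fun_prop)
  have i2 := hg.integrable_phaseDeriv ht x (w := fun v => (0, v, 0)) (by fun_prop)
  have i3 := hg.integrable_phaseDeriv ht x (w := fun v => (0, 0, -a)) (by fun_prop)
  have e : ∀ v, phaseDeriv g t x v (1, 0, 0) = phaseDeriv g t x v (1, v, -a) -
      phaseDeriv g t x v (0, v, 0) - phaseDeriv g t x v (0, 0, -a) := by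
    intro v
    rw [← map_sub, ← map_sub]
    simp
    rfl
  have i4 : Integrable fun v => phaseDeriv g t x v (1, v, -a) - phaseDeriv g t x v (0, v, 0) :=
    i1.sub i2
  simp only [e]
  rw [integral_sub i4 i3, integral_sub i1 i2, hg.integral_phaseDeriv_velocity ht, sub_zero]
  simp only [hh]

end IsPhaseFunction

/-! ### Charge, current and relative energy of a solution -/

/-- The current `∫ (f - F) v dv`. -/
noncomputable def current (F : R3 → ℝ) (f : ℝ → R3 → R3 → ℝ) (t : ℝ) (x : R3) : R3 :=
  ∫ v, (f t x v - F v) • v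

/-- The spatial density of relative energy. -/
noncomputable def energyDensity (F : R3 → ℝ) (τ : ℝ → ℝ) (f : ℝ → R3 → R3 → ℝ) (t : ℝ) (x : R3) : ℝ :=
  ∫ v, relEnergy F τ v (f t x v)

/-- A solution with velocities bounded by `P`, together with the energy inverse of its background. -/
structure IsRegularSolution (p T P W L : ℝ) (F : R3 → ℝ) (τ : ℝ → ℝ) (f₀ : R3 → R3 → ℝ)
    (A : ℝ → R3 → R3) (f : ℝ → R3 → R3 → ℝ) : Prop where
  background : BackgroundCondition F
  inverse : IsEnergyInverse F W L τ
  sol : IsVlasovPoissonSolution p T F f₀ A f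
  phase : IsPhaseFunction T P f
  pos : 0 < P
  background_zero : ∀ v, P ≤ ‖v‖ → F v = 0

namespace IsRegularSolution

variable {p T P W L : ℝ} {F : R3 → ℝ} {τ : ℝ → ℝ} {f₀ : R3 → R3 → ℝ} {A : ℝ → R3 → R3}
  {f : ℝ → R3 → R3 → ℝ}

theorem continuous_background (h : IsRegularSolution p T P W L F τ f₀ A f) : Continuous F :=
  h.background.contDiff.continuous

theorem background_zero_of_notMem (h : IsRegularSolution p T P W L F τ f₀ A f) {v : R3}
    (hv : v ∉ Metric.closedBall (0 : R3) P) : F v = 0 :=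
  h.background_zero v (not_le.1 (by simpa using hv)).le

theorem continuous_velocity (h : IsRegularSolution p T P W L F τ f₀ A f) {t : ℝ} (ht : t ∈ Icc 0 T)
    (x : R3) : Continuous fun v => f t x v :=
  (h.phase.continuous_slice ht).comp (f := fun v : R3 => (x, v)) (by fun_prop)

theorem integrable_velocity_mul (h : IsRegularSolution p T P W L F τ f₀ A f) {t : ℝ}
    (ht : t ∈ Icc 0 T) (x : R3) {G : Type*} [NormedAddCommGroup G] [NormedSpace ℝ G] {c : R3 → G}
    (hc : Continuous c) : Integrable fun v => f t x v • c v :=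
  integrable_of_continuous_of_eq_zero ((h.continuous_velocity ht x).smul hc)
    (isCompact_closedBall (0 : R3) P) fun v hv => by
      rw [h.phase.eq_zero_of_notMem ht x hv, zero_smul]

theorem integrable_background_mul (h : IsRegularSolution p T P W L F τ f₀ A f)
    {G : Type*} [NormedAddCommGroup G] [NormedSpace ℝ G] {c : R3 → G}
    (hc : Continuous c) : Integrable fun v => F v • c v :=
  integrable_of_continuous_of_eq_zero (h.continuous_background.smul hc)
    (isCompact_closedBall (0 : R3) P) fun v hv => by
      rw [h.background_zero_of_notMem hv, zero_smul]

theorem integrable_background (h : IsRegularSolution p T P W L F τ f₀ A f) : Integrable F := by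
  simpa using h.integrable_background_mul (c := fun _ => (1 : ℝ)) continuous_const

theorem integrable_velocity (h : IsRegularSolution p T P W L F τ f₀ A f) {t : ℝ}
    (ht : t ∈ Icc 0 T) (x : R3) : Integrable fun v => f t x v := by
  simpa using h.integrable_velocity_mul ht x (c := fun _ => (1 : ℝ)) continuous_const

theorem integral_background_smul (h : IsRegularSolution p T P W L F τ f₀ A f) :
    ∫ v, F v • v = 0 := by
  obtain ⟨FR, hFR, -⟩ := h.background.radial
  have h1 := integral_neg_eq_self (fun v : R3 => F v • v) volume
  have h2 : (fun v : R3 => F (-v) • -v) = fun v => -(F v • v) := by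
    funext v; rw [hFR, hFR v, norm_neg, smul_neg]
  rw [h2, integral_neg] at h1
  have h3 : (∫ v, F v • v) + ∫ v, F v • v = 0 := by nth_rewrite 1 [← h1]; simp
  simpa [← two_smul ℝ] using h3

theorem current_eq (h : IsRegularSolution p T P W L F τ f₀ A f) {t : ℝ} (ht : t ∈ Icc 0 T)
    (x : R3) : current F f t x = ∫ v, f t x v • v := by
  have e : ∀ v, (f t x v - F v) • v = f t x v • v - F v • v := fun v => sub_smul _ _ _
  rw [current]
  simp only [e]
  rw [integral_sub (h.integrable_velocity_mul ht x (c := fun v => v) continuous_id)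
    (h.integrable_background_mul (c := fun v => v) continuous_id), h.integral_background_smul,
    sub_zero]

theorem chargeDensity_eq (h : IsRegularSolution p T P W L F τ f₀ A f) {t : ℝ} (ht : t ∈ Icc 0 T)
    (x : R3) : chargeDensity F f t x = (∫ v, F v) - ∫ v, f t x v :=
  integral_sub h.integrable_background (h.integrable_velocity ht x)

theorem continuousOn_chargeDensity (h : IsRegularSolution p T P W L F τ f₀ A f) :
    ContinuousOn (fun z : ℝ × R3 => chargeDensity F f z.1 z.2) (Icc 0 T ×ˢ univ) := by
  refine ((continuousOn_const (c := ∫ v, F v)).sub h.phase.continuousOn_moment).congr fun z hz => ?_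
  exact h.chargeDensity_eq hz.1 z.2

theorem continuous_chargeDensity (h : IsRegularSolution p T P W L F τ f₀ A f) {t : ℝ}
    (ht : t ∈ Icc 0 T) : Continuous (chargeDensity F f t) :=
  continuousOn_univ.1 (h.continuousOn_chargeDensity.comp (f := fun x : R3 => (t, x)) (by fun_prop)
    fun z _ => ⟨ht, mem_univ _⟩)

theorem continuous_current (h : IsRegularSolution p T P W L F τ f₀ A f) {t : ℝ}
    (ht : t ∈ Icc 0 T) : Continuous (current F f t) := by
  have e : current F f t = fun x => ∫ v, f t x v • v := funext fun x => h.current_eq ht x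
  rw [e, ← continuousOn_univ]
  refine continuousOn_integral_of_compact_support (isCompact_closedBall (0 : R3) P) ?_ ?_
  · exact ((h.phase.continuous_slice ht).smul continuous_snd).continuousOn
  · intro x v _ hv
    rw [h.phase.eq_zero_of_notMem ht x hv, zero_smul]

theorem phaseDeriv_eq_zero (h : IsRegularSolution p T P W L F τ f₀ A f) {t : ℝ} (ht : t ∈ Ioo 0 T)
    (x v : R3) : phaseDeriv f t x v (1, v, -(electricField F f t x + A t x)) = 0 :=
  h.sol.fderiv_eq_zero ht x v

theorem hasDerivAt_chargeDensity (h : IsRegularSolution p T P W L F τ f₀ A f) {t : ℝ}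
    (ht : t ∈ Ioo 0 T) (x : R3) :
    HasDerivAt (fun s => chargeDensity F f s x) (∫ v, phaseDeriv f t x v (0, v, 0)) t := by
  have h1 := (h.phase.hasDerivAt_moment ht x).const_sub (∫ v, F v)
  rw [h.phase.integral_phaseDeriv_time ht (h := fun _ => 0) (h.phaseDeriv_eq_zero ht x)] at h1
  simp only [integral_zero, zero_sub, neg_neg] at h1
  refine h1.congr_of_eventuallyEq ?_
  filter_upwards [Icc_mem_nhds ht.1 ht.2] with s hs using h.chargeDensity_eq hs x

/-- Weak form of the continuity equation. -/
theorem integral_mul_deriv_chargeDensity (h : IsRegularSolution p T P W L F τ f₀ A f) {t : ℝ}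
    (ht : t ∈ Ioo 0 T) {φ : R3 → ℝ} (hφ : ContDiff ℝ 1 φ) (hφc : HasCompactSupport φ) :
    ∫ x, φ x * ∫ v, phaseDeriv f t x v (0, v, 0) = -∫ x, fderiv ℝ φ x (current F f t x) := by
  rw [h.phase.integral_mul_integral_phaseDeriv_space ht hφ hφc]
  congr 1
  refine integral_congr_ae (Filter.Eventually.of_forall fun x => ?_)
  have ht' := Ioo_subset_Icc_self ht
  simp only
  rw [h.current_eq ht' x, ← ContinuousLinearMap.integral_comp_comm _
    (h.integrable_velocity_mul ht' x (c := fun v => v) continuous_id)]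
  simp

theorem isPhaseFunction_relEnergy (h : IsRegularSolution p T P W L F τ f₀ A f) :
    IsPhaseFunction T P fun t x v => relEnergy F τ v (f t x v) where
  contDiff := (h.inverse.contDiff_relEnergy h.background.contDiff).comp_contDiffOn
    (f := fun z : ℝ × R3 × R3 => (z.2.2, f z.1 z.2.1 z.2.2))
    ((contDiff_snd.comp contDiff_snd).contDiffOn.prodMk h.phase.contDiff)
  eq_zero := fun t ht x v hv => by
    have h1 := h.inverse.relEnergy_background v
    rw [h.background_zero v hv] at h1
    rw [h.phase.eq_zero t ht x v hv, h1]

theorem phaseDeriv_relEnergy (h : IsRegularSolution p T P W L F τ f₀ A f) {t : ℝ} (ht : t ∈ Ioo 0 T)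
    (x v : R3) : phaseDeriv (fun t x v => relEnergy F τ v (f t x v)) t x v
      (1, v, -(electricField F f t x + A t x)) =
      -inner ℝ (electricField F f t x + A t x) ((f t x v - F v) • v) := by
  set a := electricField F f t x + A t x with ha
  have hx : HasDerivAt (fun s : ℝ => x + (s - t) • v) v t := by
    have := (((hasDerivAt_id t).sub_const t).smul_const v).const_add x
    simpa using this
  have hv : HasDerivAt (fun s : ℝ => v - (s - t) • a) (-a) t := by
    have := (((hasDerivAt_id t).sub_const t).smul_const a).const_sub v
    simpa using this
  have hc : HasDerivAt (fun s : ℝ => (s, x + (s - t) • v, v - (s - t) • a)) (1, v, -a) t :=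
    (hasDerivAt_id t).prodMk (hx.prodMk hv)
  have h1 := HasFDerivAt.comp_hasDerivAt_of_eq t (h.phase.hasFDerivAt ht x v) hc (by simp)
  rw [ha, h.phaseDeriv_eq_zero ht] at h1
  have h2 := HasFDerivAt.comp_hasDerivAt_of_eq t (h.isPhaseFunction_relEnergy.hasFDerivAt ht x v) hc
    (by simp)
  have h3 := h.inverse.hasDerivAt_relEnergy h.background.contDiff hv h1
  refine (h2.unique h3).trans ?_
  simp only [Function.comp, sub_self, zero_smul, add_zero, sub_zero, mul_zero]
  rw [inner_neg_right, inner_smul_right, real_inner_comm]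
  ring

theorem integral_inner_current (h : IsRegularSolution p T P W L F τ f₀ A f) {t : ℝ} (ht : t ∈ Icc 0 T)
    (x a : R3) : ∫ v, inner ℝ a ((f t x v - F v) • v) = inner ℝ a (current F f t x) := by
  refine integral_inner ?_ a
  have e : ∀ v, (f t x v - F v) • v = f t x v • v - F v • v := fun v => sub_smul _ _ _
  simp only [e]
  exact (h.integrable_velocity_mul ht x (c := fun v => v) continuous_id).sub
    (h.integrable_background_mul (c := fun v => v) continuous_id)

/-- Time derivative of the relative energy density. -/
theorem integral_phaseDeriv_relEnergy (h : IsRegularSolution p T P W L F τ f₀ A f) {t : ℝ}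
    (ht : t ∈ Ioo 0 T) (x : R3) :
    ∫ v, phaseDeriv (fun t x v => relEnergy F τ v (f t x v)) t x v (1, 0, 0) =
      -inner ℝ (electricField F f t x + A t x) (current F f t x) -
        ∫ v, phaseDeriv (fun t x v => relEnergy F τ v (f t x v)) t x v (0, v, 0) := by
  rw [h.isPhaseFunction_relEnergy.integral_phaseDeriv_time ht (h.phaseDeriv_relEnergy ht x),
    integral_neg, h.integral_inner_current (Ioo_subset_Icc_self ht)]

theorem continuous_inner_field_current (h : IsRegularSolution p T P W L F τ f₀ A f) {t : ℝ}
    (ht : t ∈ Ioo 0 T) :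
    Continuous fun x => inner ℝ (electricField F f t x + A t x) (current F f t x) := by
  have hg := h.isPhaseFunction_relEnergy
  have c1 := hg.continuousOn_integral_phaseDeriv (w := fun _ => (1, 0, 0)) continuous_const
  have c2 := hg.continuousOn_integral_phaseDeriv (w := fun v => (0, v, 0)) (by fun_prop)
  have c3 := continuousOn_univ.1 ((c1.add c2).neg.comp (f := fun x : R3 => (t, x)) (by fun_prop)
    fun z _ => ⟨ht, mem_univ _⟩)
  refine c3.congr fun x => ?_
  have := h.integral_phaseDeriv_relEnergy ht x
  simp only [Function.comp, Pi.neg_apply, Pi.add_apply]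
  linarith

/-- Weak form of the local balance of relative energy. -/
theorem integral_mul_deriv_energyDensity (h : IsRegularSolution p T P W L F τ f₀ A f) {t : ℝ}
    (ht : t ∈ Ioo 0 T) {φ : R3 → ℝ} (hφ : ContDiff ℝ 1 φ) (hφc : HasCompactSupport φ) :
    ∫ x, φ x * ∫ v, phaseDeriv (fun t x v => relEnergy F τ v (f t x v)) t x v (1, 0, 0) =
      (∫ x, ∫ v, relEnergy F τ v (f t x v) * fderiv ℝ φ x v) -
        ∫ x, φ x * inner ℝ (electricField F f t x + A t x) (current F f t x) := by
  have hg := h.isPhaseFunction_relEnergy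
  have h1 := hg.integral_mul_integral_phaseDeriv_space ht hφ hφc
  simp only [h.integral_phaseDeriv_relEnergy ht, mul_sub, mul_neg]
  have c2 := hg.continuousOn_integral_phaseDeriv (w := fun v => (0, v, 0)) (by fun_prop)
  have c3 := continuousOn_univ.1 (c2.comp (f := fun x : R3 => (t, x)) (by fun_prop)
    fun z _ => ⟨ht, mem_univ _⟩)
  have i1 : Integrable fun x => φ x * inner ℝ (electricField F f t x + A t x) (current F f t x) :=
    (hφ.continuous.mul (h.continuous_inner_field_current ht)).integrable_of_hasCompactSupport
      hφc.mul_right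
  have i2 : Integrable fun x => φ x *
      ∫ v, phaseDeriv (fun t x v => relEnergy F τ v (f t x v)) t x v (0, v, 0) :=
    (hφ.continuous.mul c3).integrable_of_hasCompactSupport hφc.mul_right
  have i3 : Integrable fun x =>
      -(φ x * inner ℝ (electricField F f t x + A t x) (current F f t x)) := i1.neg
  rw [integral_sub i3 i2, integral_neg, h1]
  ring

theorem energyDensity_nonneg (h : IsRegularSolution p T P W L F τ f₀ A f) {t : ℝ} (ht : t ∈ Icc 0 T)
    (x : R3) : 0 ≤ energyDensity F τ f t x :=
  integral_nonneg fun v => h.inverse.relEnergy_nonneg v (h.sol.nonneg t ht x v)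

theorem hasDerivAt_energyDensity (h : IsRegularSolution p T P W L F τ f₀ A f) {t : ℝ}
    (ht : t ∈ Ioo 0 T) (x : R3) : HasDerivAt (fun s => energyDensity F τ f s x)
      (∫ v, phaseDeriv (fun t x v => relEnergy F τ v (f t x v)) t x v (1, 0, 0)) t :=
  h.isPhaseFunction_relEnergy.hasDerivAt_moment ht x

theorem continuousOn_energyDensity (h : IsRegularSolution p T P W L F τ f₀ A f) :
    ContinuousOn (fun z : ℝ × R3 => energyDensity F τ f z.1 z.2) (Icc 0 T ×ˢ univ) :=
  h.isPhaseFunction_relEnergy.continuousOn_moment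

theorem continuous_energyDensity (h : IsRegularSolution p T P W L F τ f₀ A f) {t : ℝ}
    (ht : t ∈ Icc 0 T) : Continuous (energyDensity F τ f t) :=
  continuousOn_univ.1 (h.continuousOn_energyDensity.comp (f := fun x : R3 => (t, x)) (by fun_prop)
    fun z _ => ⟨ht, mem_univ _⟩)

end IsRegularSolution

/-! ### Moments are controlled by the relative energy -/

theorem IsEnergyInverse.exists_mul_le {F : R3 → ℝ} {W L : ℝ} {τ : ℝ → ℝ}
    (H : IsEnergyInverse F W L τ) :
    ∃ C : ℝ, 0 < C ∧ ∀ (v : R3) (h l : ℝ), 0 ≤ h → 0 ≤ l →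
      l * ((1 + ‖v‖) * |h - F v|) ≤
        C * ((Metric.closedBall (0 : R3) (2 * W)).indicator (fun _ => l ^ 2) v +
          (1 + l) * relEnergy F τ v h) := by
  have hW := H.W_pos
  have hL := H.L_pos
  set C₁ := (1 + 2 * W) * (1 + L) with hC₁
  set C₂ := 8 / 3 * (1 / (4 * W ^ 2) + 1 / (2 * W)) with hC₂
  have hC₁0 : 0 < C₁ := by positivity
  have hC₂0 : 0 < C₂ := by positivity
  refine ⟨C₁ + C₂, by positivity, fun v h l hh hl => ?_⟩
  have he := H.relEnergy_nonneg v hh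
  by_cases hv : v ∈ Metric.closedBall (0 : R3) (2 * W)
  · rw [indicator_of_mem hv]
    have hv' : ‖v‖ ≤ 2 * W := by simpa using hv
    have h1 := H.sq_le_relEnergy v hh
    rw [div_le_iff₀ (by positivity)] at h1
    have h2 : l * |h - F v| ≤ l ^ 2 / 2 + (h - F v) ^ 2 / 2 := by
      nlinarith [sq_nonneg (l - |h - F v|), sq_abs (h - F v)]
    have h3 : l * |h - F v| ≤ (1 + L) * (l ^ 2 + relEnergy F τ v h) := by nlinarith [sq_nonneg l]
    calc l * ((1 + ‖v‖) * |h - F v|) = (1 + ‖v‖) * (l * |h - F v|) := by ring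
      _ ≤ (1 + 2 * W) * ((1 + L) * (l ^ 2 + relEnergy F τ v h)) := by gcongr
      _ = C₁ * (l ^ 2 + 1 * relEnergy F τ v h) := by rw [hC₁]; ring
      _ ≤ (C₁ + C₂) * (l ^ 2 + (1 + l) * relEnergy F τ v h) := by
        gcongr <;> linarith
  · rw [indicator_of_notMem hv, zero_add]
    have hv' : 2 * W < ‖v‖ := not_le.1 (by simpa using hv)
    have h1 := H.mul_le_relEnergy (by linarith : W ≤ ‖v‖) h
    rw [H.background_eq_zero v (by linarith), sub_zero, abs_of_nonneg hh]
    have h2 : 3 / 8 * ‖v‖ ^ 2 * h ≤ relEnergy F τ v h := by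
      refine le_trans ?_ h1
      gcongr
      nlinarith
    have h3 : 1 + ‖v‖ ≤ (1 / (4 * W ^ 2) + 1 / (2 * W)) * ‖v‖ ^ 2 := by
      have e1 : 1 ≤ 1 / (4 * W ^ 2) * ‖v‖ ^ 2 := by
        rw [one_div, ← div_eq_inv_mul, le_div_iff₀ (by positivity)]; nlinarith
      have e2 : ‖v‖ ≤ 1 / (2 * W) * ‖v‖ ^ 2 := by
        rw [one_div, ← div_eq_inv_mul, le_div_iff₀ (by positivity)]; nlinarith
      linarith
    calc l * ((1 + ‖v‖) * h) ≤ l * (((1 / (4 * W ^ 2) + 1 / (2 * W)) * ‖v‖ ^ 2) * h) := by gcongr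
      _ = l * (C₂ * (3 / 8 * ‖v‖ ^ 2 * h)) := by rw [hC₂]; ring
      _ ≤ l * (C₂ * relEnergy F τ v h) := by gcongr
      _ = C₂ * (l * relEnergy F τ v h) := by ring
      _ ≤ (C₁ + C₂) * ((1 + l) * relEnergy F τ v h) := by gcongr <;> linarith

theorem IsEnergyInverse.exists_moment_bound {F : R3 → ℝ} {W L : ℝ} {τ : ℝ → ℝ}
    (H : IsEnergyInverse F W L τ) :
    ∃ C : ℝ, 0 < C ∧ ∀ g : R3 → ℝ, (∀ v, 0 ≤ g v) → Integrable (fun v => relEnergy F τ v (g v)) →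
      Integrable (fun v => (1 + ‖v‖) * |g v - F v|) → ∀ l, 0 ≤ l →
        l * ∫ v, (1 + ‖v‖) * |g v - F v| ≤ C * (l ^ 2 + (1 + l) * ∫ v, relEnergy F τ v (g v)) := by
  obtain ⟨C, hC, h⟩ := H.exists_mul_le
  set B := Metric.closedBall (0 : R3) (2 * W) with hB
  have hBm : MeasurableSet B := measurableSet_closedBall
  have hBf : volume B ≠ ⊤ := (isCompact_closedBall _ _).measure_ne_top
  set V := volume.real B with hV
  have hV0 : 0 ≤ V := measureReal_nonneg
  refine ⟨C * (V + 1), by positivity, fun g hg hi hi' l hl => ?_⟩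
  have i1 : Integrable (B.indicator fun _ : R3 => l ^ 2) :=
    (integrable_indicator_iff hBm).2 (integrableOn_const hBf)
  have hE : 0 ≤ ∫ v, relEnergy F τ v (g v) := integral_nonneg fun v => H.relEnergy_nonneg v (hg v)
  rw [← integral_const_mul]
  calc ∫ v, l * ((1 + ‖v‖) * |g v - F v|)
      ≤ ∫ v, C * (B.indicator (fun _ => l ^ 2) v + (1 + l) * relEnergy F τ v (g v)) :=
        integral_mono (hi'.const_mul l) ((i1.add (hi.const_mul _)).const_mul C)
          fun v => h v (g v) l (hg v) hl
    _ = C * (V * l ^ 2 + (1 + l) * ∫ v, relEnergy F τ v (g v)) := by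
        rw [integral_const_mul, integral_add i1 (hi.const_mul _), integral_const_mul,
          integral_indicator hBm, setIntegral_const, smul_eq_mul]
    _ ≤ C * ((V + 1) * l ^ 2 + (V + 1) * ((1 + l) * ∫ v, relEnergy F τ v (g v))) := by
        have : 0 ≤ (1 + l) * ∫ v, relEnergy F τ v (g v) := by positivity
        refine mul_le_mul_of_nonneg_left (add_le_add ?_ ?_) hC.le
        · nlinarith [sq_nonneg l]
        · nlinarith
    _ = _ := by ring

theorem sq_le_of_forall_mul_le {C q k r M : ℝ} (hC : 0 < C)
    (h : ∀ l, 0 ≤ l → l * q ≤ C * (l ^ 2 + (1 + l) * k)) (hk : 0 ≤ k) (hrq : |r| ≤ q)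
    (hrM : |r| ≤ M) : r ^ 2 ≤ (4 * C ^ 2 + 2 * C * M) * k := by
  have h1 := h (|r| / (2 * C)) (by positivity)
  have h2 : |r| / (2 * C) * |r| ≤ |r| / (2 * C) * q := by gcongr
  have h3 := h2.trans h1
  have h4 : |r| / (2 * C) * |r| = r ^ 2 / (2 * C) := by rw [← sq_abs r]; ring
  have h5 : (|r| / (2 * C)) ^ 2 = r ^ 2 / (4 * C ^ 2) := by rw [div_pow, sq_abs]; ring
  rw [h4, h5] at h3
  have h6 : C * (r ^ 2 / (4 * C ^ 2) + (1 + |r| / (2 * C)) * k) =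
      r ^ 2 / (4 * C) + (C + |r| / 2) * k := by
    field_simp
  rw [h6] at h3
  have h7 : (C + |r| / 2) * k ≤ (C + M / 2) * k := by gcongr
  have h8 : r ^ 2 / (2 * C) - r ^ 2 / (4 * C) = r ^ 2 / (4 * C) := by field_simp; ring
  have h9 : r ^ 2 / (4 * C) ≤ (C + M / 2) * k := by linarith
  rw [div_le_iff₀ (by positivity)] at h9
  linarith

namespace IsRegularSolution

variable {p T P W L : ℝ} {F : R3 → ℝ} {τ : ℝ → ℝ} {f₀ : R3 → R3 → ℝ} {A : ℝ → R3 → R3}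
  {f : ℝ → R3 → R3 → ℝ}

theorem integrable_absMoment (h : IsRegularSolution p T P W L F τ f₀ A f) {t : ℝ} (ht : t ∈ Icc 0 T)
    (x : R3) : Integrable fun v => (1 + ‖v‖) * |f t x v - F v| := by
  refine integrable_of_continuous_of_eq_zero ?_ (isCompact_closedBall (0 : R3) P) fun v hv => ?_
  · have := h.continuous_velocity ht x
    have := h.continuous_background
    fun_prop
  · rw [h.phase.eq_zero_of_notMem ht x hv, h.background_zero_of_notMem hv]; simp

theorem integrable_relEnergy (h : IsRegularSolution p T P W L F τ f₀ A f) {t : ℝ} (ht : t ∈ Icc 0 T)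
    (x : R3) : Integrable fun v => relEnergy F τ v (f t x v) := by
  refine integrable_of_continuous_of_eq_zero ?_ (isCompact_closedBall (0 : R3) P) fun v hv =>
    h.isPhaseFunction_relEnergy.eq_zero_of_notMem ht x hv
  exact (h.isPhaseFunction_relEnergy.continuous_slice ht).comp (f := fun v : R3 => (x, v))
    (by fun_prop)

theorem abs_chargeDensity_le (h : IsRegularSolution p T P W L F τ f₀ A f) {t : ℝ} (ht : t ∈ Icc 0 T)
    (x : R3) : |chargeDensity F f t x| ≤ ∫ v, (1 + ‖v‖) * |f t x v - F v| := by
  rw [← Real.norm_eq_abs, chargeDensity]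
  refine norm_integral_le_of_norm_le (h.integrable_absMoment ht x)
    (Filter.Eventually.of_forall fun v => ?_)
  rw [Real.norm_eq_abs, abs_sub_comm]
  nlinarith [norm_nonneg v, abs_nonneg (f t x v - F v)]

theorem norm_current_le (h : IsRegularSolution p T P W L F τ f₀ A f) {t : ℝ} (ht : t ∈ Icc 0 T)
    (x : R3) : ‖current F f t x‖ ≤ ∫ v, (1 + ‖v‖) * |f t x v - F v| := by
  refine norm_integral_le_of_norm_le (h.integrable_absMoment ht x)
    (Filter.Eventually.of_forall fun v => ?_)
  rw [norm_smul, Real.norm_eq_abs]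
  nlinarith [norm_nonneg v, abs_nonneg (f t x v - F v)]

theorem norm_current_le_of_density (h : IsRegularSolution p T P W L F τ f₀ A f) {t : ℝ}
    (ht : t ∈ Icc 0 T) (x : R3) :
    ‖current F f t x‖ ≤ P * ((∫ v, F v) + |chargeDensity F f t x|) := by
  rw [h.current_eq ht]
  have h1 : ‖∫ v, f t x v • v‖ ≤ ∫ v, P * f t x v := by
    refine norm_integral_le_of_norm_le ((h.integrable_velocity ht x).const_mul P)
      (Filter.Eventually.of_forall fun v => ?_)
    rw [norm_smul, Real.norm_of_nonneg (h.sol.nonneg t ht x v), mul_comm]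
    by_cases hv : P ≤ ‖v‖
    · rw [h.phase.eq_zero t ht x v hv]; simp
    · exact mul_le_mul_of_nonneg_right (not_le.1 hv).le (h.sol.nonneg t ht x v)
  rw [integral_const_mul] at h1
  refine h1.trans (mul_le_mul_of_nonneg_left ?_ h.pos.le)
  have h2 := h.chargeDensity_eq ht x
  have h3 := neg_abs_le (chargeDensity F f t x)
  linarith

end IsRegularSolution

/-! ### Cutoff functions decreasing along all admissible velocities -/

/-- The positive part of `1 - (R(x) + P t) / r`. -/
noncomputable def cutRoot (P r t : ℝ) (x : R3) : ℝ := max (1 - (weightR x + P * t) / r) 0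

/-- A `C¹` cutoff. -/
noncomputable def cutoff (P r t : ℝ) (x : R3) : ℝ := cutRoot P r t x ^ 2

section cutoff

variable {P r t : ℝ}

theorem cutRoot_nonneg (P r t : ℝ) (x : R3) : 0 ≤ cutRoot P r t x := le_max_right _ _

theorem cutRoot_le_one (hP : 0 ≤ P) (hr : 0 < r) (ht : 0 ≤ t) (x : R3) : cutRoot P r t x ≤ 1 := by
  have := weightR_pos x
  have : 0 ≤ (weightR x + P * t) / r := by positivity
  exact max_le (by linarith) zero_le_one

theorem cutoff_nonneg (P r t : ℝ) (x : R3) : 0 ≤ cutoff P r t x := sq_nonneg _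

theorem cutoff_le_one (hP : 0 ≤ P) (hr : 0 < r) (ht : 0 ≤ t) (x : R3) : cutoff P r t x ≤ 1 :=
  pow_le_one₀ (cutRoot_nonneg P r t x) (cutRoot_le_one hP hr ht x)

theorem cutRoot_eq_zero (hP : 0 ≤ P) (hr : 0 < r) (ht : 0 ≤ t) {x : R3} (hx : r ≤ weightR x) :
    cutRoot P r t x = 0 := by
  refine max_eq_right ?_
  have : 1 ≤ (weightR x + P * t) / r := by
    rw [le_div_iff₀ hr]; nlinarith [mul_nonneg hP ht]
  linarith

theorem cutoff_eq_zero (hP : 0 ≤ P) (hr : 0 < r) (ht : 0 ≤ t) {x : R3}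
    (hx : x ∉ Metric.closedBall (0 : R3) r) : cutoff P r t x = 0 := by
  rw [cutoff, cutRoot_eq_zero hP hr ht]
  · norm_num
  · exact (not_le.1 (by simpa using hx)).le.trans (norm_le_weightR x)

theorem hasCompactSupport_cutoff (hP : 0 ≤ P) (hr : 0 < r) (ht : 0 ≤ t) :
    HasCompactSupport (cutoff P r t) :=
  HasCompactSupport.intro (isCompact_closedBall (0 : R3) r) fun _ hx => cutoff_eq_zero hP hr ht hx

theorem continuous_cutRoot (P r : ℝ) : Continuous fun z : ℝ × R3 => cutRoot P r z.1 z.2 := by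
  have := continuous_weightR
  unfold cutRoot
  fun_prop

theorem continuous_cutoff (P r : ℝ) : Continuous fun z : ℝ × R3 => cutoff P r z.1 z.2 :=
  (continuous_cutRoot P r).pow 2

theorem contDiff_cutoff (P r t : ℝ) : ContDiff ℝ 1 (cutoff P r t) :=
  contDiff_max_zero_sq.comp
    (contDiff_const.sub ((contDiff_weightR.add contDiff_const).div_const r))

theorem hasDerivAt_cutoff (P r t : ℝ) (x : R3) :
    HasDerivAt (fun s => cutoff P r s x) (-(2 * P / r) * cutRoot P r t x) t := by
  have h1 : HasDerivAt (fun s : ℝ => 1 - (weightR x + P * s) / r) (-(P / r)) t := by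
    have := ((((hasDerivAt_id t).const_mul P).const_add (weightR x)).div_const r).const_sub 1
    simpa using this
  refine ((hasDerivAt_max_zero_sq _).comp t h1).congr_deriv ?_
  rw [cutRoot]; ring

theorem fderiv_cutoff (P r t : ℝ) (x : R3) :
    fderiv ℝ (cutoff P r t) x = (-(2 / r) * cutRoot P r t x) • fderiv ℝ weightR x := by
  have hd := ((contDiff_weightR (n := 1)).differentiable (by norm_num) x).hasFDerivAt
  have h1 : HasFDerivAt (fun x : R3 => 1 - (weightR x + P * t) / r)
      (-(r⁻¹ • fderiv ℝ weightR x)) x := by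
    have := ((hd.add_const (P * t)).mul_const r⁻¹).const_sub 1
    simpa only [div_eq_mul_inv] using this
  have h2 := (hasDerivAt_max_zero_sq (1 - (weightR x + P * t) / r)).comp_hasFDerivAt x h1
  have h3 : HasFDerivAt (cutoff P r t) _ x := h2
  rw [h3.fderiv, cutRoot]
  ext w
  simp
  ring

theorem norm_fderiv_cutoff_le (P : ℝ) (hr : 0 < r) (t : ℝ) (x : R3) :
    ‖fderiv ℝ (cutoff P r t) x‖ ≤ 2 / r * cutRoot P r t x := by
  have h0 := cutRoot_nonneg P r t x
  rw [fderiv_cutoff, norm_smul, norm_mul, norm_neg, Real.norm_of_nonneg (by positivity : 0 ≤ 2 / r),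
    Real.norm_of_nonneg h0]
  have := norm_fderiv_weightR_le x
  have h1 : 0 ≤ 2 / r * cutRoot P r t x := by positivity
  nlinarith

theorem deriv_cutoff_add_fderiv_nonpos (P : ℝ) (hr : 0 < r) (t : ℝ) (x : R3) {v : R3}
    (hv : ‖v‖ ≤ P) :
    -(2 * P / r) * cutRoot P r t x + fderiv ℝ (cutoff P r t) x v ≤ 0 := by
  have h0 := cutRoot_nonneg P r t x
  have h1 : |fderiv ℝ (cutoff P r t) x v| ≤ (2 / r * cutRoot P r t x) * P :=
    ((fderiv ℝ (cutoff P r t) x).le_opNorm v).trans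
      (mul_le_mul (norm_fderiv_cutoff_le P hr t x) hv (norm_nonneg _) (by positivity))
  have h2 := (abs_le.1 h1).2
  have e : (2 / r * cutRoot P r t x) * P = 2 * P / r * cutRoot P r t x := by ring
  linarith

theorem one_sub_cutoff_le (hP : 0 ≤ P) (hr : 0 < r) {T : ℝ} (ht : t ∈ Icc 0 T) (x : R3) {α : ℝ}
    (hα : 0 ≤ α) (hα1 : α ≤ 1) :
    1 - cutoff P r t x ≤ (2 * (1 + P * T)) * (r ^ (-α) * weightR x ^ α) := by
  have hx := weightR_pos x
  have hT : 0 ≤ P * T := mul_nonneg hP (ht.1.trans ht.2)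
  have h0 := cutoff_nonneg P r t x
  have e : r ^ (-α) * weightR x ^ α = (weightR x / r) ^ α := by
    rw [Real.div_rpow hx.le hr.le, Real.rpow_neg hr.le]; ring
  rw [e]
  set u := weightR x / r with hu
  have hu0 : 0 < u := by positivity
  rcases le_total 1 u with h | h
  · have : 1 ≤ u ^ α := Real.one_le_rpow h hα
    nlinarith
  · have h1 : u ≤ u ^ α := by
      simpa using Real.rpow_le_rpow_of_exponent_ge hu0 h hα1
    have h2 : (weightR x + P * t) / r ≤ (1 + P * T) * u := by
      rw [hu, ← mul_div_assoc]
      gcongr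
      have := one_le_weightR x
      nlinarith [mul_le_mul_of_nonneg_left ht.2 hP]
    have h3 : 1 - (weightR x + P * t) / r ≤ cutRoot P r t x := le_max_left _ _
    have h4 : 1 - cutoff P r t x ≤ 2 * (1 - cutRoot P r t x) := by
      rw [cutoff]; nlinarith [sq_nonneg (1 - cutRoot P r t x)]
    nlinarith

end cutoff

/-! ### Regularized Coulomb potentials -/

/-- The regularized Coulomb kernel `(|z|² + δ²)^{-1/2}`. -/
noncomputable def coulomb (δ : ℝ) (z : R3) : ℝ := (‖z‖ ^ 2 + δ ^ 2) ^ (-(1 / 2) : ℝ)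

/-- The factor `(|z|² + δ²)^{-3/2}` of the regularized Coulomb force. -/
noncomputable def forceFactor (δ : ℝ) (z : R3) : ℝ := (‖z‖ ^ 2 + δ ^ 2) ^ (-(3 / 2) : ℝ)

/-- The potential of `σ` with regularized kernel. -/
noncomputable def regPotential (δ : ℝ) (σ : R3 → ℝ) (x : R3) : ℝ := ∫ y, σ y * coulomb δ (x - y)

/-- The field of `σ` with regularized kernel. -/
noncomputable def regField (δ : ℝ) (σ : R3 → ℝ) (x : R3) : R3 :=
  ∫ y, (σ y * forceFactor δ (x - y)) • (x - y)

section kernel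

variable {δ : ℝ}

theorem coulomb_nonneg (δ : ℝ) (z : R3) : 0 ≤ coulomb δ z := by unfold coulomb; positivity

theorem forceFactor_nonneg (δ : ℝ) (z : R3) : 0 ≤ forceFactor δ z := by unfold forceFactor; positivity

theorem coulomb_neg (δ : ℝ) (z : R3) : coulomb δ (-z) = coulomb δ z := by simp [coulomb]

theorem coulomb_sub_comm (δ : ℝ) (x y : R3) : coulomb δ (x - y) = coulomb δ (y - x) := by
  rw [← coulomb_neg, neg_sub]

theorem continuous_coulomb (hδ : 0 < δ) : Continuous (coulomb δ) := by
  unfold coulomb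
  exact (by fun_prop : Continuous fun z : R3 => ‖z‖ ^ 2 + δ ^ 2).rpow_const
    fun z => Or.inl (by positivity)

theorem continuous_forceFactor (hδ : 0 < δ) : Continuous (forceFactor δ) := by
  unfold forceFactor
  exact (by fun_prop : Continuous fun z : R3 => ‖z‖ ^ 2 + δ ^ 2).rpow_const
    fun z => Or.inl (by positivity)

theorem hasFDerivAt_coulomb (hδ : 0 < δ) (z : R3) :
    HasFDerivAt (coulomb δ) ((-forceFactor δ z) • innerSL ℝ z) z := by
  have h1 : HasFDerivAt (fun z : R3 => ‖z‖ ^ 2 + δ ^ 2) (2 • innerSL ℝ z) z :=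
    (hasStrictFDerivAt_norm_sq z).hasFDerivAt.add_const _
  have h2 := h1.rpow_const (p := (-(1 / 2) : ℝ)) (Or.inl (by positivity))
  refine h2.congr_fderiv ?_
  ext w
  simp only [forceFactor]
  norm_num
  ring

theorem coulomb_le (δ : ℝ) {z : R3} : coulomb δ z ≤ ‖z‖ ^ (-1 : ℝ) ∨ z = 0 := by
  rcases eq_or_ne z 0 with h | h
  · exact Or.inr h
  · left
    have hz : 0 < ‖z‖ := norm_pos_iff.2 h
    have : ‖z‖ ^ (-1 : ℝ) = (‖z‖ ^ 2) ^ (-(1 / 2) : ℝ) := by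
      rw [← Real.rpow_natCast, ← Real.rpow_mul hz.le]; norm_num
    rw [this, coulomb]
    exact Real.rpow_le_rpow_of_nonpos (by positivity) (by nlinarith) (by norm_num)

theorem coulomb_le_const (hδ : 0 < δ) (z : R3) : coulomb δ z ≤ δ⁻¹ := by
  have : δ⁻¹ = (δ ^ 2) ^ (-(1 / 2) : ℝ) := by
    rw [← Real.rpow_natCast, ← Real.rpow_mul hδ.le, ← Real.rpow_neg_one]; norm_num
  rw [this, coulomb]
  exact Real.rpow_le_rpow_of_nonpos (by positivity) (by nlinarith [norm_nonneg z]) (by norm_num)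

theorem forceFactor_mul_norm_le_const (hδ : 0 < δ) (z : R3) : forceFactor δ z * ‖z‖ ≤ (δ ^ 2)⁻¹ := by
  have hs : 0 < ‖z‖ ^ 2 + δ ^ 2 := by positivity
  have h1 : ‖z‖ ≤ (‖z‖ ^ 2 + δ ^ 2) ^ (1 / 2 : ℝ) := by
    rw [← Real.sqrt_eq_rpow]
    exact Real.le_sqrt_of_sq_le (by nlinarith)
  calc forceFactor δ z * ‖z‖ ≤ forceFactor δ z * (‖z‖ ^ 2 + δ ^ 2) ^ (1 / 2 : ℝ) := by
        have := forceFactor_nonneg δ z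
        gcongr
    _ = (‖z‖ ^ 2 + δ ^ 2)⁻¹ := by
        rw [forceFactor, ← Real.rpow_add hs, ← Real.rpow_neg_one]; norm_num
    _ ≤ (δ ^ 2)⁻¹ := by gcongr; nlinarith [norm_nonneg z]

/-- Comparison of the regularized force with the Coulomb force. -/
theorem abs_inv_cube_sub_forceFactor_mul_norm_le (hδ : 0 < δ) (z : R3) :
    |1 / ‖z‖ ^ 3 - forceFactor δ z| * ‖z‖ ≤ 2 * δ ^ (1 / 2 : ℝ) * ‖z‖ ^ (-(5 / 2) : ℝ) := by
  rcases eq_or_ne z 0 with rfl | hz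
  · simp
  have hn : 0 < ‖z‖ := norm_pos_iff.2 hz
  set n := ‖z‖ with hn'
  have hs : 0 < n ^ 2 + δ ^ 2 := by positivity
  set s := √(n ^ 2 + δ ^ 2) with hs'
  have hs0 : 0 < s := Real.sqrt_pos.2 hs
  have hs2 : s ^ 2 = n ^ 2 + δ ^ 2 := Real.sq_sqrt hs.le
  have e1 : forceFactor δ z = 1 / s ^ 3 := by
    rw [forceFactor, ← hn', ← hs2, ← Real.rpow_natCast, ← Real.rpow_mul hs0.le, one_div,
      ← Real.rpow_natCast, ← Real.rpow_neg hs0.le]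
    norm_num
  have hns : n ≤ s := by nlinarith
  have hsn : s ≤ n + δ := by nlinarith
  have e2 : 0 ≤ 1 / n ^ 3 - 1 / s ^ 3 := by
    rw [sub_nonneg]
    gcongr
  rw [e1, abs_of_nonneg e2]
  have e3 : n ^ (-(5 / 2) : ℝ) = n ^ (-2 : ℝ) * n ^ (-(1 / 2) : ℝ) := by
    rw [← Real.rpow_add hn]; norm_num
  have e4 : 2 * δ ^ (1 / 2 : ℝ) * n ^ (-(5 / 2) : ℝ) = 2 * (δ / n) ^ (1 / 2 : ℝ) * (1 / n ^ 2) := by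
    rw [e3, Real.div_rpow hδ.le hn.le, Real.rpow_neg hn.le, Real.rpow_neg hn.le]
    norm_num
    ring
  rw [e4]
  have e5 : (1 / n ^ 3 - 1 / s ^ 3) * n = (1 - (n / s) ^ 3) * (1 / n ^ 2) := by
    field_simp
  rw [e5]
  refine mul_le_mul_of_nonneg_right ?_ (by positivity)
  set u := n / s with hu
  have hu0 : 0 < u := by positivity
  have hu1 : u ≤ 1 := (div_le_one hs0).2 hns
  rcases le_total 1 (δ / n) with h | h
  · have : 1 ≤ (δ / n) ^ (1 / 2 : ℝ) := Real.one_le_rpow h (by norm_num)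
    have : 0 < u ^ 3 := by positivity
    linarith
  · -- here `1 - u³ ≤ 3 (1 - u)` is improved using `s² = n² + δ²`
    have h1 : δ / n ≤ (δ / n) ^ (1 / 2 : ℝ) := by
      simpa using Real.rpow_le_rpow_of_exponent_ge (by positivity) h (by norm_num : (1 / 2 : ℝ) ≤ 1)
    have h2 : 1 - u ^ 2 = δ ^ 2 / s ^ 2 := by
      rw [hu, div_pow, hs2]; field_simp; ring
    have h3 : δ ^ 2 / s ^ 2 ≤ δ ^ 2 / n ^ 2 := by gcongr
    have h4 : δ ^ 2 / n ^ 2 = (δ / n) ^ 2 := by rw [div_pow]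
    have h5 : (δ / n) ^ 2 ≤ δ / n := by
      have : 0 < δ / n := by positivity
      nlinarith
    have h6 : 1 - u ^ 3 ≤ 2 * (1 - u ^ 2) := by nlinarith [sq_nonneg u, sq_nonneg (1 - u)]
    linarith

end kernel

section potential

variable {δ : ℝ} {σ : R3 → ℝ}

theorem integrable_mul_coulomb (hδ : 0 < δ) (hσ : Integrable σ) (x : R3) :
    Integrable fun y => σ y * coulomb δ (x - y) := by
  refine hσ.mul_bdd (c := δ⁻¹) ?_ (Filter.Eventually.of_forall fun y => ?_)
  · exact ((continuous_coulomb hδ).comp (by fun_prop)).aestronglyMeasurable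
  · rw [Real.norm_of_nonneg (coulomb_nonneg _ _)]; exact coulomb_le_const hδ _

theorem norm_forceFactor_smul_le (hδ : 0 < δ) (s : ℝ) (z : R3) :
    ‖(s * forceFactor δ z) • z‖ ≤ |s| * (δ ^ 2)⁻¹ := by
  rw [norm_smul, norm_mul, Real.norm_of_nonneg (forceFactor_nonneg _ _), mul_assoc, Real.norm_eq_abs]
  exact mul_le_mul_of_nonneg_left (forceFactor_mul_norm_le_const hδ z) (abs_nonneg s)

theorem integrable_forceFactor_smul (hδ : 0 < δ) (hσ : Integrable σ) (x : R3) :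
    Integrable fun y => (σ y * forceFactor δ (x - y)) • (x - y) := by
  refine (hσ.abs.mul_const (δ ^ 2)⁻¹).mono' ?_
    (Filter.Eventually.of_forall fun y => norm_forceFactor_smul_le hδ _ _)
  refine (hσ.aestronglyMeasurable.mul ?_).smul ?_
  · exact ((continuous_forceFactor hδ).comp (by fun_prop)).aestronglyMeasurable
  · exact (by fun_prop : Continuous fun y : R3 => x - y).aestronglyMeasurable

theorem continuous_regField (hδ : 0 < δ) (hσ : Integrable σ) : Continuous (regField δ σ) := by
  refine continuous_of_dominated (bound := fun y => |σ y| * (δ ^ 2)⁻¹)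
    (fun x => (integrable_forceFactor_smul hδ hσ x).aestronglyMeasurable)
    (fun x => Filter.Eventually.of_forall fun y => norm_forceFactor_smul_le hδ _ _)
    (hσ.abs.mul_const _) (Filter.Eventually.of_forall fun y => ?_)
  have := continuous_forceFactor hδ
  fun_prop

theorem hasFDerivAt_regPotential (hδ : 0 < δ) (hσ : Integrable σ) (x : R3) :
    HasFDerivAt (regPotential δ σ) (-innerSL ℝ (regField δ σ x)) x := by
  have h := hasFDerivAt_integral_of_dominated_of_fderiv_le (𝕜 := ℝ) (μ := (volume : Measure R3))
    (F := fun x y => σ y * coulomb δ (x - y)) (x₀ := x) (s := univ)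
    (F' := fun x y => -innerSL ℝ ((σ y * forceFactor δ (x - y)) • (x - y)))
    (bound := fun y => |σ y| * (δ ^ 2)⁻¹) Filter.univ_mem
    (Filter.Eventually.of_forall fun x => (integrable_mul_coulomb hδ hσ x).aestronglyMeasurable)
    (integrable_mul_coulomb hδ hσ x) ?_ ?_ (hσ.abs.mul_const _) ?_
  · refine h.congr_fderiv ?_
    rw [integral_neg]
    congr 1
    exact ContinuousLinearMap.integral_comp_comm (innerSL ℝ : R3 →L[ℝ] R3 →L[ℝ] ℝ)
      (integrable_forceFactor_smul hδ hσ x)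
  · exact ((innerSL ℝ : R3 →L[ℝ] R3 →L[ℝ] ℝ).continuous.comp_aestronglyMeasurable
      (integrable_forceFactor_smul hδ hσ x).aestronglyMeasurable).neg
  · refine Filter.Eventually.of_forall fun y x _ => ?_
    rw [norm_neg, innerSL_apply_norm]
    exact norm_forceFactor_smul_le hδ _ _
  · refine Filter.Eventually.of_forall fun y x _ => ?_
    have h1 : HasFDerivAt (fun x => coulomb δ (x - y)) ((-forceFactor δ (x - y)) • innerSL ℝ (x - y)) x := by
      have := HasFDerivAt.comp (f := fun x => x - y) x (hasFDerivAt_coulomb hδ (x - y))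
        ((hasFDerivAt_id x).sub_const y)
      simpa using! this
    refine (h1.const_mul (σ y)).congr_fderiv ?_
    ext w
    simp
    ring

theorem contDiff_regPotential (hδ : 0 < δ) (hσ : Integrable σ) : ContDiff ℝ 1 (regPotential δ σ) := by
  rw [contDiff_one_iff_fderiv]
  refine ⟨fun x => (hasFDerivAt_regPotential hδ hσ x).differentiableAt, ?_⟩
  have : fderiv ℝ (regPotential δ σ) = fun x => -innerSL ℝ (regField δ σ x) :=
    funext fun x => (hasFDerivAt_regPotential hδ hσ x).fderiv
  rw [this]
  exact ((innerSL ℝ : R3 →L[ℝ] R3 →L[ℝ] ℝ).continuous.comp (continuous_regField hδ hσ)).neg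

end potential

/-! ### Positivity of the regularized Coulomb energy -/

theorem integrable_exp_neg_mul_norm_sq {s : ℝ} (hs : 0 < s) (x : R3) :
    Integrable fun z : R3 => Real.exp (-s * ‖z - x‖ ^ 2) := by
  have h := GaussianFourier.integrable_cexp_neg_mul_sq_norm_add (V := R3) (b := (s : ℂ)) (by simpa using hs) 0 0
  have h1 : Integrable fun z : R3 => Real.exp (-s * ‖z‖ ^ 2) := by
    refine h.norm.congr (Filter.Eventually.of_forall fun z => ?_)
    simp only [Complex.norm_exp]
    congr 1
    simp [← Complex.ofReal_pow]
  exact h1.comp_sub_right x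

theorem exp_mul_exp_eq (s : ℝ) (x y z : R3) :
    Real.exp (-(2 * s) * ‖z - x‖ ^ 2) * Real.exp (-(2 * s) * ‖z - y‖ ^ 2) =
      Real.exp (-s * ‖x - y‖ ^ 2) * Real.exp (-(4 * s) * ‖z - (1 / 2 : ℝ) • (x + y)‖ ^ 2) := by
  rw [← Real.exp_add, ← Real.exp_add]
  congr 1
  have h := parallelogram_law_with_norm ℝ (z - x) (z - y)
  have e1 : z - x + (z - y) = (2 : ℝ) • (z - (1 / 2 : ℝ) • (x + y)) := by module
  have e2 : z - x - (z - y) = -(x - y) := by abel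
  rw [e1, e2, norm_neg, norm_smul, Real.norm_of_nonneg (by norm_num : (0 : ℝ) ≤ 2)] at h
  linear_combination (-s) * h.symm

/-- Gaussian kernels are positive definite. -/
theorem integral_mul_gaussian_nonneg {σ : R3 → ℝ} (hσ : Integrable σ) {s : ℝ} (hs : 0 < s) :
    0 ≤ ∫ w : R3 × R3, σ w.1 * σ w.2 * Real.exp (-s * ‖w.1 - w.2‖ ^ 2) := by
  set c : ℝ := ∫ z : R3, Real.exp (-(4 * s) * ‖z‖ ^ 2) with hc
  have hg : ∀ w : R3, Integrable fun z : R3 => Real.exp (-(4 * s) * ‖z - w‖ ^ 2) := fun w =>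
    integrable_exp_neg_mul_norm_sq (by positivity) w
  have hcw : ∀ w : R3, ∫ z : R3, Real.exp (-(4 * s) * ‖z - w‖ ^ 2) = c := fun w =>
    integral_sub_right_eq_self (fun z : R3 => Real.exp (-(4 * s) * ‖z‖ ^ 2)) w
  have hcpos : 0 < c := by
    rw [hc]
    refine integral_exp_pos ?_
    simpa using hg 0
  set H : (R3 × R3) → R3 → ℝ := fun w z => σ w.1 * σ w.2 *
    (Real.exp (-(2 * s) * ‖z - w.1‖ ^ 2) * Real.exp (-(2 * s) * ‖z - w.2‖ ^ 2)) with hH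
  have hHint : ∀ w : R3 × R3, ∫ z, H w z = c * (σ w.1 * σ w.2 * Real.exp (-s * ‖w.1 - w.2‖ ^ 2)) := by
    intro w
    simp only [hH, exp_mul_exp_eq, integral_const_mul, hcw]
    ring
  have hσσ : Integrable (fun w : R3 × R3 => σ w.1 * σ w.2) (volume.prod volume) := hσ.mul_prod hσ
  have hmeas : AEStronglyMeasurable (fun q : (R3 × R3) × R3 => H q.1 q.2)
      ((volume.prod volume).prod volume) := by
    refine AEStronglyMeasurable.mul hσσ.aestronglyMeasurable.comp_fst ?_
    exact (by fun_prop : Continuous fun q : (R3 × R3) × R3 =>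
      Real.exp (-(2 * s) * ‖q.2 - q.1.1‖ ^ 2) *
        Real.exp (-(2 * s) * ‖q.2 - q.1.2‖ ^ 2)).aestronglyMeasurable
  have hInt : Integrable (fun q : (R3 × R3) × R3 => H q.1 q.2)
      ((volume.prod volume).prod volume) := by
    rw [integrable_prod_iff hmeas]
    constructor
    · refine Filter.Eventually.of_forall fun w => ?_
      simp only [hH, exp_mul_exp_eq]
      exact ((hg _).const_mul _).const_mul _
    · have e : ∀ w : R3 × R3, ∫ z, ‖H w z‖ =
          |σ w.1 * σ w.2| * (Real.exp (-s * ‖w.1 - w.2‖ ^ 2) * c) := by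
        intro w
        simp only [hH, exp_mul_exp_eq, norm_mul _ (_ * _), Real.norm_of_nonneg (Real.exp_nonneg _),
          norm_mul (Real.exp _), integral_const_mul, hcw]
        rfl
      simp only [e]
      refine hσσ.abs.mul_bdd (c := c) ?_ (Filter.Eventually.of_forall fun w => ?_)
      · exact (by fun_prop : Continuous fun w : R3 × R3 =>
          Real.exp (-s * ‖w.1 - w.2‖ ^ 2) * c).aestronglyMeasurable
      · rw [Real.norm_of_nonneg (by positivity)]
        have : Real.exp (-s * ‖w.1 - w.2‖ ^ 2) ≤ 1 := Real.exp_le_one_iff.2 (by nlinarith [sq_nonneg ‖w.1 - w.2‖])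
        nlinarith
  have hswap := integral_integral_swap (f := H) hInt
  simp only [hHint, integral_const_mul] at hswap
  have hnonneg : 0 ≤ ∫ z, ∫ w : R3 × R3, H w z ∂(volume.prod volume) := by
    refine integral_nonneg fun z => ?_
    have e : ∀ w : R3 × R3, H w z = (σ w.1 * Real.exp (-(2 * s) * ‖z - w.1‖ ^ 2)) *
        (σ w.2 * Real.exp (-(2 * s) * ‖z - w.2‖ ^ 2)) := fun w => by simp only [hH]; ring
    simp only [Pi.zero_apply, e]
    rw [integral_prod_mul (fun x => σ x * Real.exp (-(2 * s) * ‖z - x‖ ^ 2))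
      (fun x => σ x * Real.exp (-(2 * s) * ‖z - x‖ ^ 2))]
    exact mul_self_nonneg _
  rw [← hswap] at hnonneg
  exact nonneg_of_mul_nonneg_right hnonneg hcpos

theorem integral_gaussian_eq_coulomb {δ : ℝ} (hδ : 0 < δ) (z : R3) :
    ∫ s in Ioi (0 : ℝ), s ^ (-(1 / 2) : ℝ) * Real.exp (-((‖z‖ ^ 2 + δ ^ 2) * s)) =
      Real.Gamma (1 / 2) * coulomb δ z := by
  have hr : 0 < ‖z‖ ^ 2 + δ ^ 2 := by positivity
  have h := Real.integral_rpow_mul_exp_neg_mul_Ioi (a := 1 / 2) (r := ‖z‖ ^ 2 + δ ^ 2)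
    (by norm_num) hr
  have e : (1 / 2 - 1 : ℝ) = -(1 / 2) := by norm_num
  rw [e] at h
  rw [h, coulomb, one_div (‖z‖ ^ 2 + δ ^ 2), Real.inv_rpow hr.le, Real.rpow_neg hr.le, mul_comm]

theorem integrable_mul_mul_coulomb {δ : ℝ} (hδ : 0 < δ) {σ : R3 → ℝ} (hσ : Integrable σ) :
    Integrable (fun w : R3 × R3 => σ w.1 * (σ w.2 * coulomb δ (w.1 - w.2))) (volume.prod volume) := by
  have hσσ : Integrable (fun w : R3 × R3 => σ w.1 * σ w.2) (volume.prod volume) := hσ.mul_prod hσ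
  simp only [← mul_assoc]
  refine hσσ.mul_bdd (c := δ⁻¹) ?_ (Filter.Eventually.of_forall fun w => ?_)
  · exact ((continuous_coulomb hδ).comp (by fun_prop)).aestronglyMeasurable
  · rw [Real.norm_of_nonneg (coulomb_nonneg _ _)]; exact coulomb_le_const hδ _

/-- The regularized Coulomb energy is nonnegative. -/
theorem integral_mul_regPotential_nonneg {δ : ℝ} (hδ : 0 < δ) {σ : R3 → ℝ} (hσ : Integrable σ) :
    0 ≤ ∫ x, σ x * regPotential δ σ x := by
  have hσσ : Integrable (fun w : R3 × R3 => σ w.1 * σ w.2) (volume.prod volume) := hσ.mul_prod hσ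
  have e1 : ∫ x, σ x * regPotential δ σ x =
      ∫ w : R3 × R3, σ w.1 * (σ w.2 * coulomb δ (w.1 - w.2)) := by
    have := integral_prod _ (integrable_mul_mul_coulomb hδ hσ)
    simp only [integral_const_mul] at this
    exact this.symm
  rw [e1]
  have hΓ : 0 < Real.Gamma (1 / 2) := Real.Gamma_pos_of_pos (by norm_num)
  refine nonneg_of_mul_nonneg_right (a := Real.Gamma (1 / 2)) ?_ hΓ
  set H : (R3 × R3) → ℝ → ℝ := fun w s => σ w.1 * σ w.2 *
    (s ^ (-(1 / 2) : ℝ) * Real.exp (-((‖w.1 - w.2‖ ^ 2 + δ ^ 2) * s))) with hH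
  have hg : Integrable (fun s : ℝ => s ^ (-(1 / 2) : ℝ) * Real.exp (-(δ ^ 2 * s)))
      (volume.restrict (Ioi 0)) := by
    have := integrableOn_rpow_mul_exp_neg_mul_rpow (p := 1) (s := -(1 / 2)) (b := δ ^ 2) (by norm_num)
      (by norm_num) (by positivity)
    simpa [IntegrableOn] using this
  have hInt : Integrable (fun q : (R3 × R3) × ℝ => H q.1 q.2)
      ((volume.prod volume).prod (volume.restrict (Ioi 0))) := by
    refine (hσσ.mul_prod hg).mono ?_ ?_
    · refine AEStronglyMeasurable.mul hσσ.aestronglyMeasurable.comp_fst ?_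
      refine Measurable.aestronglyMeasurable ?_
      refine Measurable.mul (measurable_snd.pow_const _) ?_
      exact (by fun_prop : Continuous fun q : (R3 × R3) × ℝ =>
        Real.exp (-((‖q.1.1 - q.1.2‖ ^ 2 + δ ^ 2) * q.2))).measurable
    · have hpos : ∀ᵐ q : (R3 × R3) × ℝ ∂((volume.prod volume).prod (volume.restrict (Ioi 0))),
          0 < q.2 :=
        Measure.quasiMeasurePreserving_snd.ae (ae_restrict_mem measurableSet_Ioi)
      filter_upwards [hpos] with q hq
      simp only [hH, norm_mul]
      gcongr
      rw [Real.norm_of_nonneg (Real.exp_nonneg _), Real.norm_of_nonneg (Real.exp_nonneg _)]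
      refine Real.exp_le_exp.2 (neg_le_neg ?_)
      gcongr
      nlinarith [norm_nonneg (q.1.1 - q.1.2)]
  have hswap := integral_integral_swap (f := H) hInt
  have e2 : ∀ w : R3 × R3, ∫ s in Ioi (0 : ℝ), H w s =
      Real.Gamma (1 / 2) * (σ w.1 * (σ w.2 * coulomb δ (w.1 - w.2))) := by
    intro w
    simp only [hH, integral_const_mul, integral_gaussian_eq_coulomb hδ]
    ring
  simp only [e2, integral_const_mul] at hswap
  refine le_of_le_of_eq ?_ hswap.symm
  refine setIntegral_nonneg measurableSet_Ioi fun s hs => ?_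
  have hs' : (0 : ℝ) < s := hs
  have e3 : ∀ w : R3 × R3, H w s = (s ^ (-(1 / 2) : ℝ) * Real.exp (-(δ ^ 2 * s))) *
      (σ w.1 * σ w.2 * Real.exp (-s * ‖w.1 - w.2‖ ^ 2)) := by
    intro w
    simp only [hH]
    rw [show -((‖w.1 - w.2‖ ^ 2 + δ ^ 2) * s) = -(δ ^ 2 * s) + -s * ‖w.1 - w.2‖ ^ 2 by ring,
      Real.exp_add]
    ring
  simp only [e3, integral_const_mul]
  exact mul_nonneg (by positivity) (integral_mul_gaussian_nonneg hσ hs')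

/-! ### Localized energies and their time derivatives -/

/-- Symmetry of the regularized Coulomb interaction. -/
theorem integral_add_mul_coulomb {δ : ℝ} (hδ : 0 < δ) {σ σ' : R3 → ℝ} (hσ : Integrable σ)
    (hσ' : Integrable σ') :
    ∫ w : R3 × R3, (σ' w.1 * σ w.2 + σ w.1 * σ' w.2) * coulomb δ (w.1 - w.2) =
      2 * ∫ x, σ' x * regPotential δ σ x := by
  have hb : ∀ {μ ν : R3 → ℝ}, Integrable μ → Integrable ν →
      Integrable (fun w : R3 × R3 => μ w.1 * (ν w.2 * coulomb δ (w.1 - w.2))) (volume.prod volume) := by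
    intro μ ν hμ hν
    have hμν : Integrable (fun w : R3 × R3 => μ w.1 * ν w.2) (volume.prod volume) := hμ.mul_prod hν
    simp only [← mul_assoc]
    refine hμν.mul_bdd (c := δ⁻¹) ?_ (Filter.Eventually.of_forall fun w => ?_)
    · exact ((continuous_coulomb hδ).comp (by fun_prop)).aestronglyMeasurable
    · rw [Real.norm_of_nonneg (coulomb_nonneg _ _)]; exact coulomb_le_const hδ _
  have e0 : ∀ w : R3 × R3, (σ' w.1 * σ w.2 + σ w.1 * σ' w.2) * coulomb δ (w.1 - w.2) =
      σ' w.1 * (σ w.2 * coulomb δ (w.1 - w.2)) + σ w.1 * (σ' w.2 * coulomb δ (w.1 - w.2)) :=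
    fun w => by ring
  have e1 : ∫ w : R3 × R3, σ' w.1 * (σ w.2 * coulomb δ (w.1 - w.2)) =
      ∫ x, σ' x * regPotential δ σ x := by
    have := integral_prod _ (hb hσ' hσ)
    simp only [integral_const_mul] at this
    exact this
  have e2 : ∫ w : R3 × R3, σ w.1 * (σ' w.2 * coulomb δ (w.1 - w.2)) =
      ∫ x, σ' x * regPotential δ σ x := by
    have := integral_prod_symm _ (hb hσ hσ')
    refine this.trans (integral_congr_ae (Filter.Eventually.of_forall fun y => ?_))
    simp only [regPotential]
    rw [← integral_const_mul]
    refine integral_congr_ae (Filter.Eventually.of_forall fun x => ?_)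
    simp only
    rw [coulomb_sub_comm]
    ring
  simp only [e0]
  have h3 := integral_add (hb hσ' hσ) (hb hσ hσ')
  refine h3.trans ?_
  refine (congrArg₂ (· + ·) e1 e2).trans ?_
  ring

/-- The localized relative energy. -/
noncomputable def localEnergy (F : R3 → ℝ) (τ : ℝ → ℝ) (f : ℝ → R3 → R3 → ℝ) (P r t : ℝ) : ℝ :=
  ∫ x, cutoff P r t x * energyDensity F τ f t x

/-- The localized charge density. -/
noncomputable def localCharge (F : R3 → ℝ) (f : ℝ → R3 → R3 → ℝ) (P r t : ℝ) (x : R3) : ℝ :=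
  cutoff P r t x * chargeDensity F f t x

/-- The localized and regularized electrostatic energy. -/
noncomputable def localPotentialEnergy (F : R3 → ℝ) (f : ℝ → R3 → R3 → ℝ) (P r δ t : ℝ) : ℝ :=
  1 / 2 * ∫ x, localCharge F f P r t x * regPotential δ (localCharge F f P r t) x

namespace IsRegularSolution

variable {p T P W L : ℝ} {F : R3 → ℝ} {τ : ℝ → ℝ} {f₀ : R3 → R3 → ℝ} {A : ℝ → R3 → R3}
  {f : ℝ → R3 → R3 → ℝ} {r δ : ℝ}

theorem continuousOn_localEnergy (h : IsRegularSolution p T P W L F τ f₀ A f) (hr : 0 < r) :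
    ContinuousOn (localEnergy F τ f P r) (Icc 0 T) := by
  refine continuousOn_integral_of_compact_support (isCompact_closedBall (0 : R3) r) ?_ ?_
  · exact (continuous_cutoff P r).continuousOn.mul h.continuousOn_energyDensity
  · intro t x ht hx
    rw [cutoff_eq_zero h.pos.le hr ht.1 hx, zero_mul]

theorem hasDerivAt_localEnergy (h : IsRegularSolution p T P W L F τ f₀ A f) (hr : 0 < r) {t : ℝ}
    (ht : t ∈ Ioo 0 T) : HasDerivAt (localEnergy F τ f P r)
      (∫ x, (-(2 * P / r) * cutRoot P r t x * energyDensity F τ f t x + cutoff P r t x *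
        ∫ v, phaseDeriv (fun t x v => relEnergy F τ v (f t x v)) t x v (1, 0, 0))) t := by
  refine hasDerivAt_integral_of_compact (Ψ := fun t x => cutoff P r t x * energyDensity F τ f t x)
    (Ψ' := fun t x => -(2 * P / r) * cutRoot P r t x * energyDensity F τ f t x + cutoff P r t x *
        ∫ v, phaseDeriv (fun t x v => relEnergy F τ v (f t x v)) t x v (1, 0, 0))
    (isCompact_closedBall (0 : R3) r) ht ?_ ?_ ?_ ?_
  · exact (continuous_cutoff P r).continuousOn.mul (h.continuousOn_energyDensity.mono
      (prod_mono Ioo_subset_Icc_self subset_rfl))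
  · refine ContinuousOn.add ?_ ?_
    · exact (continuousOn_const.mul (continuous_cutRoot P r).continuousOn).mul
        (h.continuousOn_energyDensity.mono (prod_mono Ioo_subset_Icc_self subset_rfl))
    · exact (continuous_cutoff P r).continuousOn.mul
        (h.isPhaseFunction_relEnergy.continuousOn_integral_phaseDeriv continuous_const)
  · intro s hs x
    exact (hasDerivAt_cutoff P r s x).mul (h.hasDerivAt_energyDensity hs x)
  · intro s hs x hx
    rw [cutoff_eq_zero h.pos.le hr hs.1.le hx, zero_mul]

theorem deriv_localEnergy_le (h : IsRegularSolution p T P W L F τ f₀ A f) (hr : 0 < r) {t : ℝ}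
    (ht : t ∈ Ioo 0 T) :
    ∫ x, (-(2 * P / r) * cutRoot P r t x * energyDensity F τ f t x + cutoff P r t x *
        ∫ v, phaseDeriv (fun t x v => relEnergy F τ v (f t x v)) t x v (1, 0, 0)) ≤
      -∫ x, cutoff P r t x * inner ℝ (electricField F f t x + A t x) (current F f t x) := by
  have ht' := Ioo_subset_Icc_self ht
  have hB := isCompact_closedBall (0 : R3) r
  have hg := h.isPhaseFunction_relEnergy
  have hcr : Continuous (cutRoot P r t) := (continuous_cutRoot P r).comp (f := fun x => (t, x)) (by fun_prop)
  have hcz : ∀ x, x ∉ Metric.closedBall (0 : R3) r → cutRoot P r t x = 0 := fun x hx => by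
    have := cutoff_eq_zero h.pos.le hr ht.1.le hx
    exact pow_eq_zero_iff (two_ne_zero) |>.1 this
  have hφ := contDiff_cutoff P r t
  have hφ' : Continuous (fderiv ℝ (cutoff P r t)) := hφ.continuous_fderiv (by norm_num)
  have i1 : Integrable fun x => -(2 * P / r) * cutRoot P r t x * energyDensity F τ f t x :=
    integrable_of_continuous_of_eq_zero
      ((continuous_const.mul hcr).mul (h.continuous_energyDensity ht')) hB fun x hx => by
        rw [hcz x hx]; simp
  have c2 := hg.continuousOn_integral_phaseDeriv (w := fun _ => (1, 0, 0)) continuous_const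
  have c3 := continuousOn_univ.1 (c2.comp (f := fun x : R3 => (t, x)) (by fun_prop)
    fun z _ => ⟨ht, mem_univ _⟩)
  have i2 : Integrable fun x => cutoff P r t x *
      ∫ v, phaseDeriv (fun t x v => relEnergy F τ v (f t x v)) t x v (1, 0, 0) :=
    (hφ.continuous.mul c3).integrable_of_hasCompactSupport
      (hasCompactSupport_cutoff h.pos.le hr ht.1.le).mul_right
  have i3 : Integrable fun x => ∫ v, relEnergy F τ v (f t x v) * fderiv ℝ (cutoff P r t) x v := by
    refine integrable_of_continuous_of_eq_zero ?_ hB fun x hx => ?_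
    · rw [← continuousOn_univ]
      refine continuousOn_integral_of_compact_support (isCompact_closedBall (0 : R3) P) ?_ ?_
      · exact ((hg.continuous_slice ht').mul
          ((hφ'.comp continuous_fst).clm_apply continuous_snd)).continuousOn
      · intro x v _ hv
        rw [hg.eq_zero_of_notMem ht' x hv, zero_mul]
    · rw [fderiv_cutoff, hcz x hx]; simp
  rw [integral_add i1 i2, h.integral_mul_deriv_energyDensity ht hφ
    (hasCompactSupport_cutoff h.pos.le hr ht.1.le)]
  suffices H : (∫ x, -(2 * P / r) * cutRoot P r t x * energyDensity F τ f t x) +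
      ∫ x, ∫ v, relEnergy F τ v (f t x v) * fderiv ℝ (cutoff P r t) x v ≤ 0 by linarith
  rw [← integral_add i1 i3]
  refine integral_nonpos fun x => ?_
  have j1 := h.integrable_relEnergy ht' x
  have j2 : Integrable fun v => relEnergy F τ v (f t x v) * fderiv ℝ (cutoff P r t) x v := by
    refine integrable_of_continuous_of_eq_zero ?_ (isCompact_closedBall (0 : R3) P) fun v hv => ?_
    · exact ((hg.continuous_slice ht').comp (f := fun v : R3 => (x, v)) (by fun_prop)).mul
        (fderiv ℝ (cutoff P r t) x).continuous
    · rw [hg.eq_zero_of_notMem ht' x hv, zero_mul]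
  simp only [energyDensity, Pi.zero_apply]
  rw [← integral_const_mul, ← integral_add (j1.const_mul _) j2]
  refine integral_nonpos fun v => ?_
  simp only [Pi.zero_apply]
  by_cases hv : ‖v‖ ≤ P
  · have h1 := deriv_cutoff_add_fderiv_nonpos P hr t x hv
    have h2 := h.inverse.relEnergy_nonneg v (h.sol.nonneg t ht' x v)
    nlinarith
  · rw [hg.eq_zero t ht' x v (not_le.1 hv).le]; simp

theorem continuousOn_localCharge (h : IsRegularSolution p T P W L F τ f₀ A f) (r : ℝ) :
    ContinuousOn (fun z : ℝ × R3 => localCharge F f P r z.1 z.2) (Icc 0 T ×ˢ univ) :=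
  (continuous_cutoff P r).continuousOn.mul h.continuousOn_chargeDensity

theorem continuous_localCharge (h : IsRegularSolution p T P W L F τ f₀ A f) (r : ℝ) {t : ℝ}
    (ht : t ∈ Icc 0 T) : Continuous (localCharge F f P r t) :=
  (contDiff_cutoff P r t).continuous.mul (h.continuous_chargeDensity ht)

theorem localCharge_eq_zero (h : IsRegularSolution p T P W L F τ f₀ A f) (hr : 0 < r) {t : ℝ}
    (ht : t ∈ Icc 0 T) {x : R3} (hx : x ∉ Metric.closedBall (0 : R3) r) :
    localCharge F f P r t x = 0 := by
  rw [localCharge, cutoff_eq_zero h.pos.le hr ht.1 hx, zero_mul]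

theorem integrable_localCharge (h : IsRegularSolution p T P W L F τ f₀ A f) (hr : 0 < r) {t : ℝ}
    (ht : t ∈ Icc 0 T) : Integrable (localCharge F f P r t) :=
  integrable_of_continuous_of_eq_zero (h.continuous_localCharge r ht) (isCompact_closedBall (0 : R3) r)
    fun _ hx => h.localCharge_eq_zero hr ht hx

theorem localPotentialEnergy_eq (h : IsRegularSolution p T P W L F τ f₀ A f) (hr : 0 < r)
    (hδ : 0 < δ) {t : ℝ} (ht : t ∈ Icc 0 T) : localPotentialEnergy F f P r δ t =
      1 / 2 * ∫ w : R3 × R3, localCharge F f P r t w.1 * localCharge F f P r t w.2 *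
        coulomb δ (w.1 - w.2) := by
  have hσ := h.integrable_localCharge hr ht
  have := integral_prod _ (integrable_mul_mul_coulomb hδ hσ)
  simp only [integral_const_mul] at this
  rw [localPotentialEnergy]
  congr 1
  simp only [mul_assoc]
  exact this.symm

theorem continuousOn_localPotentialEnergy (h : IsRegularSolution p T P W L F τ f₀ A f) (hr : 0 < r)
    (hδ : 0 < δ) : ContinuousOn (localPotentialEnergy F f P r δ) (Icc 0 T) := by
  have hB := (isCompact_closedBall (0 : R3) r).prod (isCompact_closedBall (0 : R3) r)
  have hc : ContinuousOn (fun t => 1 / 2 * ∫ w : R3 × R3, localCharge F f P r t w.1 *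
      localCharge F f P r t w.2 * coulomb δ (w.1 - w.2)) (Icc 0 T) := by
    refine continuousOn_const.mul (continuousOn_integral_of_compact_support hB ?_ ?_)
    · refine ContinuousOn.mul (ContinuousOn.mul ?_ ?_) ?_
      · exact (h.continuousOn_localCharge r).comp (f := fun q : ℝ × R3 × R3 => (q.1, q.2.1))
          (by fun_prop) fun q hq => ⟨hq.1, mem_univ _⟩
      · exact (h.continuousOn_localCharge r).comp (f := fun q : ℝ × R3 × R3 => (q.1, q.2.2))
          (by fun_prop) fun q hq => ⟨hq.1, mem_univ _⟩
      · exact ((continuous_coulomb hδ).comp (by fun_prop)).continuousOn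
    · intro t w ht hw
      by_cases h1 : w.1 ∈ Metric.closedBall (0 : R3) r
      · rw [h.localCharge_eq_zero hr ht (x := w.2) fun h2 => hw ⟨h1, h2⟩]; simp
      · rw [h.localCharge_eq_zero hr ht h1]; simp
  exact hc.congr fun t ht => h.localPotentialEnergy_eq hr hδ ht

theorem hasDerivAt_localPotentialEnergy (h : IsRegularSolution p T P W L F τ f₀ A f) (hr : 0 < r)
    (hδ : 0 < δ) {t : ℝ} (ht : t ∈ Ioo 0 T) : HasDerivAt (localPotentialEnergy F f P r δ)
      (∫ x, (-(2 * P / r) * cutRoot P r t x * chargeDensity F f t x + cutoff P r t x *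
        ∫ v, phaseDeriv f t x v (0, v, 0)) * regPotential δ (localCharge F f P r t) x) t := by
  have ht' := Ioo_subset_Icc_self ht
  have hB := (isCompact_closedBall (0 : R3) r).prod (isCompact_closedBall (0 : R3) r)
  set σ' : ℝ → R3 → ℝ := fun t x => -(2 * P / r) * cutRoot P r t x * chargeDensity F f t x +
    cutoff P r t x * ∫ v, phaseDeriv f t x v (0, v, 0) with hσ'
  have hσd : ∀ s ∈ Ioo 0 T, ∀ x, HasDerivAt (fun s => localCharge F f P r s x) (σ' s x) s :=
    fun s hs x => (hasDerivAt_cutoff P r s x).mul (h.hasDerivAt_chargeDensity hs x)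
  have hσc : ContinuousOn (fun z : ℝ × R3 => localCharge F f P r z.1 z.2) (Ioo 0 T ×ˢ univ) :=
    (h.continuousOn_localCharge r).mono (prod_mono Ioo_subset_Icc_self subset_rfl)
  have hσ'c : ContinuousOn (fun z : ℝ × R3 => σ' z.1 z.2) (Ioo 0 T ×ˢ univ) := by
    refine ContinuousOn.add ?_ ?_
    · exact (continuousOn_const.mul (continuous_cutRoot P r).continuousOn).mul
        (h.continuousOn_chargeDensity.mono (prod_mono Ioo_subset_Icc_self subset_rfl))
    · exact (continuous_cutoff P r).continuousOn.mul
        (h.phase.continuousOn_integral_phaseDeriv (by fun_prop))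
  have hσ't : Continuous (σ' t) := continuousOn_univ.1 (hσ'c.comp (f := fun x : R3 => (t, x))
    (by fun_prop) fun z _ => ⟨ht, mem_univ _⟩)
  have hσ'i : Integrable (σ' t) := by
    refine integrable_of_continuous_of_eq_zero hσ't (isCompact_closedBall (0 : R3) r) fun x hx => ?_
    have h1 := cutoff_eq_zero h.pos.le hr ht.1.le hx
    have h2 : cutRoot P r t x = 0 := pow_eq_zero_iff (two_ne_zero) |>.1 h1
    simp only [hσ', h1, h2]; simp
  have hd := hasDerivAt_integral_of_compact (μ := (volume : Measure (R3 × R3)))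
    (Ψ := fun t w => localCharge F f P r t w.1 * localCharge F f P r t w.2 * coulomb δ (w.1 - w.2))
    (Ψ' := fun t w => (σ' t w.1 * localCharge F f P r t w.2 + localCharge F f P r t w.1 * σ' t w.2) *
      coulomb δ (w.1 - w.2)) hB ht ?_ ?_ ?_ ?_
  · rw [integral_add_mul_coulomb hδ (h.integrable_localCharge hr ht') hσ'i] at hd
    have hd2 := hd.const_mul (1 / 2)
    refine (hd2.congr_of_eventuallyEq ?_).congr_deriv (by ring)
    filter_upwards [Icc_mem_nhds ht.1 ht.2] with s hs using h.localPotentialEnergy_eq hr hδ hs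
  · refine ContinuousOn.mul (ContinuousOn.mul ?_ ?_) ?_
    · exact hσc.comp (f := fun q : ℝ × R3 × R3 => (q.1, q.2.1)) (by fun_prop)
        fun q hq => ⟨hq.1, mem_univ _⟩
    · exact hσc.comp (f := fun q : ℝ × R3 × R3 => (q.1, q.2.2)) (by fun_prop)
        fun q hq => ⟨hq.1, mem_univ _⟩
    · exact ((continuous_coulomb hδ).comp (by fun_prop)).continuousOn
  · have a1 := hσc.comp (f := fun q : ℝ × R3 × R3 => (q.1, q.2.1)) (t := Ioo 0 T ×ˢ univ)
      (s := Ioo 0 T ×ˢ univ) (by fun_prop) fun q hq => ⟨hq.1, mem_univ _⟩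
    have a2 := hσc.comp (f := fun q : ℝ × R3 × R3 => (q.1, q.2.2)) (t := Ioo 0 T ×ˢ univ)
      (s := Ioo 0 T ×ˢ univ) (by fun_prop) fun q hq => ⟨hq.1, mem_univ _⟩
    have b1 := hσ'c.comp (f := fun q : ℝ × R3 × R3 => (q.1, q.2.1)) (t := Ioo 0 T ×ˢ univ)
      (s := Ioo 0 T ×ˢ univ) (by fun_prop) fun q hq => ⟨hq.1, mem_univ _⟩
    have b2 := hσ'c.comp (f := fun q : ℝ × R3 × R3 => (q.1, q.2.2)) (t := Ioo 0 T ×ˢ univ)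
      (s := Ioo 0 T ×ˢ univ) (by fun_prop) fun q hq => ⟨hq.1, mem_univ _⟩
    exact ((b1.mul a2).add (a1.mul b2)).mul
      ((continuous_coulomb hδ).comp (by fun_prop)).continuousOn
  · intro s hs w
    exact ((hσd s hs w.1).mul (hσd s hs w.2)).mul_const _
  · intro s hs w hw
    have hs' := Ioo_subset_Icc_self hs
    by_cases h1 : w.1 ∈ Metric.closedBall (0 : R3) r
    · rw [h.localCharge_eq_zero hr hs' (x := w.2) fun h2 => hw ⟨h1, h2⟩]; simp
    · rw [h.localCharge_eq_zero hr hs' h1]; simp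

end IsRegularSolution

/-! ### Bounds on regularized potentials and fields -/

theorem exists_abs_regPotential_le {a : ℝ} (ha : 3 < a) :
    ∃ C : ℝ, 0 < C ∧ ∀ (K δ : ℝ) (σ : R3 → ℝ), 0 ≤ K → (∀ y, |σ y| ≤ K * weightR y ^ (-a)) →
      ∀ x, |regPotential δ σ x| ≤ C * K * weightR x ^ (-1 : ℝ) := by
  obtain ⟨C, hC, h⟩ := exists_integral_weightR_mul_norm_sub_le (a := a) (s := 1) (by norm_num)
    (by norm_num) ha
  refine ⟨C, hC, fun K δ σ hK hσ x => ?_⟩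
  have hi := (integrable_weightR_mul_norm_sub (a := a) (s := 1) (by norm_num)
    (by norm_num) ha x).const_mul K
  rw [← Real.norm_eq_abs, regPotential]
  refine (norm_integral_le_of_norm_le hi ?_).trans ?_
  · have hne : ∀ᵐ y : R3, y ≠ x := by
      rw [ae_iff]; simp
    filter_upwards [hne] with y hy
    rcases coulomb_le δ (z := x - y) with h1 | h1
    · rw [norm_mul, Real.norm_of_nonneg (coulomb_nonneg _ _), ← mul_assoc]
      have := coulomb_nonneg δ (x - y)
      have := weightR_rpow_pos y (-a)
      exact mul_le_mul (hσ y) h1 (coulomb_nonneg _ _) (by positivity)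
    · exact absurd (sub_eq_zero.1 h1).symm hy
  · rw [integral_const_mul]
    calc K * ∫ y, weightR y ^ (-a) * ‖x - y‖ ^ (-1 : ℝ) ≤ K * (C * weightR x ^ (-1 : ℝ)) :=
          mul_le_mul_of_nonneg_left (h x) hK
      _ = _ := by ring

/-- The localized regularized field converges to the field, with a rate. -/
theorem exists_norm_field_sub_regField_le {a α : ℝ} (hα : 0 ≤ α) (ha : 3 < a - α) :
    ∃ C : ℝ, 0 < C ∧ ∀ (K D η δ : ℝ) (ρ ζ : R3 → ℝ), 0 ≤ K → 0 ≤ D → 0 ≤ η → 0 < δ →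
      (∀ y, |ρ y| ≤ K * weightR y ^ (-a)) → (∀ y, 0 ≤ ζ y) → (∀ y, ζ y ≤ 1) →
      (∀ y, 1 - ζ y ≤ D * (η * weightR y ^ α)) → Integrable (fun y => ζ y * ρ y) → ∀ x : R3,
      Integrable (fun y => (ρ y / ‖x - y‖ ^ 3) • (x - y)) →
      ‖(∫ y, (ρ y / ‖x - y‖ ^ 3) • (x - y)) - regField δ (fun y => ζ y * ρ y) x‖ ≤
        C * K * (D * η + δ ^ (1 / 2 : ℝ)) * weightR x ^ (-2 : ℝ) := by
  obtain ⟨C₁, hC₁, h₁⟩ := exists_integral_weightR_mul_norm_sub_le (a := a - α) (s := 2) (by norm_num)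
    (by norm_num) ha
  obtain ⟨C₂, hC₂, h₂⟩ := exists_integral_weightR_mul_norm_sub_le (a := a) (s := 5 / 2) (by norm_num)
    (by norm_num) (by linarith)
  refine ⟨C₁ + 2 * C₂, by positivity, fun K D η δ ρ ζ hK hD hη hδ hρ hζ0 hζ1 hζD hi x hix => ?_⟩
  have i1 := (integrable_weightR_mul_norm_sub (a := a - α) (s := 2) (by norm_num)
    (by norm_num) ha x).const_mul (K * (D * η))
  have i2 := (integrable_weightR_mul_norm_sub (a := a) (s := 5 / 2) (by norm_num)
    (by norm_num) (by linarith) x).const_mul (K * (2 * δ ^ (1 / 2 : ℝ)))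
  rw [regField, ← integral_sub hix (integrable_forceFactor_smul hδ hi x)]
  refine (norm_integral_le_of_norm_le (i1.add i2) (Filter.Eventually.of_forall fun y => ?_)).trans ?_
  · have hy := weightR_pos y
    have hya := weightR_rpow_pos y (-a)
    have e : (ρ y / ‖x - y‖ ^ 3) • (x - y) - (ζ y * ρ y * forceFactor δ (x - y)) • (x - y) =
        ((ρ y * (1 - ζ y)) / ‖x - y‖ ^ 3) • (x - y) +
          (ζ y * ρ y * (1 / ‖x - y‖ ^ 3 - forceFactor δ (x - y))) • (x - y) := by
      rw [← sub_smul, ← add_smul]; congr 1; ring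
    rw [e]
    refine (norm_add_le _ _).trans (add_le_add ?_ ?_)
    · rw [norm_div_norm_cube_smul, abs_mul, abs_of_nonneg (by linarith [hζ1 y] : 0 ≤ 1 - ζ y)]
      have e1 : weightR y ^ (-(a - α)) = weightR y ^ (-a) * weightR y ^ α := by
        rw [← Real.rpow_add hy]; congr 1; ring
      have hyα := weightR_rpow_pos y α
      simp only [e1]
      calc |ρ y| * (1 - ζ y) * ‖x - y‖ ^ (-2 : ℝ)
          ≤ (K * weightR y ^ (-a)) * (D * (η * weightR y ^ α)) * ‖x - y‖ ^ (-2 : ℝ) := by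
            have h0 : 0 ≤ 1 - ζ y := by linarith [hζ1 y]
            have := hρ y
            have := hζD y
            gcongr
        _ = _ := by ring
    · rw [norm_smul, Real.norm_eq_abs, abs_mul, abs_mul, abs_of_nonneg (hζ0 y), mul_assoc]
      have h3 := abs_inv_cube_sub_forceFactor_mul_norm_le hδ (x - y)
      calc ζ y * |ρ y| * (|1 / ‖x - y‖ ^ 3 - forceFactor δ (x - y)| * ‖x - y‖)
          ≤ 1 * (K * weightR y ^ (-a)) * (2 * δ ^ (1 / 2 : ℝ) * ‖x - y‖ ^ (-(5 / 2) : ℝ)) := by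
            have := hρ y
            have := hζ1 y
            gcongr
        _ = _ := by ring
  · have hx2 := weightR_rpow_pos x (-2)
    have h5 : weightR x ^ (-(5 / 2) : ℝ) ≤ weightR x ^ (-2 : ℝ) :=
      weightR_rpow_le_rpow x (by norm_num)
    have hs : 0 ≤ δ ^ (1 / 2 : ℝ) := by positivity
    have e := integral_add i1 i2
    simp only [integral_const_mul] at e
    refine (le_of_eq e).trans ?_
    calc K * (D * η) * (∫ y, weightR y ^ (-(a - α)) * ‖x - y‖ ^ (-2 : ℝ)) +
          K * (2 * δ ^ (1 / 2 : ℝ)) * (∫ y, weightR y ^ (-a) * ‖x - y‖ ^ (-(5 / 2) : ℝ))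
        ≤ K * (D * η) * (C₁ * weightR x ^ (-2 : ℝ)) +
          K * (2 * δ ^ (1 / 2 : ℝ)) * (C₂ * weightR x ^ (-2 : ℝ)) := by
          have := h₁ x
          have := (h₂ x).trans (mul_le_mul_of_nonneg_left h5 hC₂.le)
          gcongr
      _ = (K * weightR x ^ (-2 : ℝ)) * (C₁ * (D * η) + 2 * C₂ * δ ^ (1 / 2 : ℝ)) := by ring
      _ ≤ (K * weightR x ^ (-2 : ℝ)) * ((C₁ + 2 * C₂) * (D * η) + (C₁ + 2 * C₂) * δ ^ (1 / 2 : ℝ)) := by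
          gcongr <;> linarith
      _ = _ := by ring

/-! ### The differential inequality for the localized energy -/

namespace IsRegularSolution

variable {p T P W L : ℝ} {F : R3 → ℝ} {τ : ℝ → ℝ} {f₀ : R3 → R3 → ℝ} {A : ℝ → R3 → R3}
  {f : ℝ → R3 → R3 → ℝ} {r δ : ℝ}

theorem cutRoot_eq_zero_of_notMem (h : IsRegularSolution p T P W L F τ f₀ A f) (hr : 0 < r) {t : ℝ}
    (ht : t ∈ Icc 0 T) {x : R3} (hx : x ∉ Metric.closedBall (0 : R3) r) : cutRoot P r t x = 0 :=
  pow_eq_zero_iff two_ne_zero |>.1 (cutoff_eq_zero h.pos.le hr ht.1 hx)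

/-- The derivative of the total localized energy in terms of the errors of localization. -/
theorem exists_hasDerivAt_total (h : IsRegularSolution p T P W L F τ f₀ A f)
    (hr : 0 < r) (hδ : 0 < δ) {t : ℝ} (ht : t ∈ Ioo 0 T) :
    ∃ D, HasDerivAt (fun s => localEnergy F τ f P r s + localPotentialEnergy F f P r δ s) D t ∧
      ∃ X : R3 → ℝ, Integrable X ∧ D ≤ ∫ x, X x ∧ ∀ x, X x =
        -(cutoff P r t x * inner ℝ (A t x) (current F f t x)) -
        cutoff P r t x * inner ℝ (electricField F f t x - regField δ (localCharge F f P r t) x)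
          (current F f t x) +
        -(2 * P / r) * cutRoot P r t x * chargeDensity F f t x *
          regPotential δ (localCharge F f P r t) x -
        regPotential δ (localCharge F f P r t) x *
          fderiv ℝ (cutoff P r t) x (current F f t x) := by
  have ht' := Ioo_subset_Icc_self ht
  have hB := isCompact_closedBall (0 : R3) r
  have hσ := h.integrable_localCharge hr ht'
  set U := regPotential δ (localCharge F f P r t) with hU
  set Er := regField δ (localCharge F f P r t) with hEr
  set J := current F f t with hJ
  have hUd : ContDiff ℝ 1 U := contDiff_regPotential hδ hσ
  have hζd := contDiff_cutoff P r t
  have hζ' : Continuous (fderiv ℝ (cutoff P r t)) := hζd.continuous_fderiv (by norm_num)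
  have hζc := hasCompactSupport_cutoff h.pos.le hr ht.1.le
  have hJc : Continuous J := h.continuous_current ht'
  have hErc : Continuous Er := continuous_regField hδ hσ
  have hρc := h.continuous_chargeDensity ht'
  have hcr : Continuous (cutRoot P r t) :=
    (continuous_cutRoot P r).comp (f := fun x => (t, x)) (by fun_prop)
  have hφ : ContDiff ℝ 1 fun x => cutoff P r t x * U x := hζd.mul hUd
  have hφc : HasCompactSupport fun x => cutoff P r t x * U x := hζc.mul_right
  have hφ' : ∀ x, fderiv ℝ (fun x => cutoff P r t x * U x) x (J x) =
      U x * fderiv ℝ (cutoff P r t) x (J x) - cutoff P r t x * inner ℝ (Er x) (J x) := by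
    intro x
    have h1 := (hζd.differentiable (by norm_num) x).hasFDerivAt
    have h2 := hasFDerivAt_regPotential hδ hσ x
    have h3 : HasFDerivAt (fun x => cutoff P r t x * U x)
      (cutoff P r t x • (-innerSL ℝ (Er x)) + U x • fderiv ℝ (cutoff P r t) x) x := h1.mul h2
    rw [h3.fderiv]
    simp
    ring
  have i1 : Integrable fun x => -(2 * P / r) * cutRoot P r t x * chargeDensity F f t x * U x :=
    integrable_of_continuous_of_eq_zero
      (((continuous_const.mul hcr).mul hρc).mul hUd.continuous) hB fun x hx => by
        rw [h.cutRoot_eq_zero_of_notMem hr ht' hx]; simp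
  have c2 := h.phase.continuousOn_integral_phaseDeriv (w := fun v => (0, v, 0)) (by fun_prop)
  have c3 := continuousOn_univ.1 (c2.comp (f := fun x : R3 => (t, x)) (by fun_prop)
    fun z _ => ⟨ht, mem_univ _⟩)
  have i2 : Integrable fun x => (cutoff P r t x * U x) * ∫ v, phaseDeriv f t x v (0, v, 0) :=
    (hφ.continuous.mul c3).integrable_of_hasCompactSupport hφc.mul_right
  have i3 : Integrable fun x => U x * fderiv ℝ (cutoff P r t) x (J x) -
      cutoff P r t x * inner ℝ (Er x) (J x) := by
    refine integrable_of_continuous_of_eq_zero ((hUd.continuous.mul (hζ'.clm_apply hJc)).sub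
      (hζd.continuous.mul (hErc.inner hJc))) hB fun x hx => ?_
    rw [fderiv_cutoff, h.cutRoot_eq_zero_of_notMem hr ht' hx, cutoff_eq_zero h.pos.le hr ht.1.le hx]
    simp
  have i4 : Integrable fun x => cutoff P r t x * inner ℝ (electricField F f t x + A t x) (J x) :=
    (hζd.continuous.mul (h.continuous_inner_field_current ht)).integrable_of_hasCompactSupport
      hζc.mul_right
  have e1 : ∫ x, (-(2 * P / r) * cutRoot P r t x * chargeDensity F f t x + cutoff P r t x *
        ∫ v, phaseDeriv f t x v (0, v, 0)) * U x =
      (∫ x, -(2 * P / r) * cutRoot P r t x * chargeDensity F f t x * U x) -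
        ∫ x, (U x * fderiv ℝ (cutoff P r t) x (J x) - cutoff P r t x * inner ℝ (Er x) (J x)) := by
    have h4 := h.integral_mul_deriv_chargeDensity ht hφ hφc
    simp only [← hJ, hφ'] at h4
    rw [sub_eq_add_neg, ← h4, ← integral_add i1 i2]
    refine integral_congr_ae (Filter.Eventually.of_forall fun x => ?_)
    simp only
    ring
  refine ⟨_, (h.hasDerivAt_localEnergy hr ht).add (h.hasDerivAt_localPotentialEnergy hr hδ ht),
    fun x => -(cutoff P r t x * inner ℝ (electricField F f t x + A t x) (J x)) +
      (-(2 * P / r) * cutRoot P r t x * chargeDensity F f t x * U x -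
        (U x * fderiv ℝ (cutoff P r t) x (J x) - cutoff P r t x * inner ℝ (Er x) (J x))),
    i4.neg.add (i1.sub i3), ?_, fun x => ?_⟩
  · have h5 := h.deriv_localEnergy_le hr ht
    have i5 : Integrable fun x => -(cutoff P r t x * inner ℝ (electricField F f t x + A t x) (J x)) :=
      i4.neg
    have i6 : Integrable fun x => -(2 * P / r) * cutRoot P r t x * chargeDensity F f t x * U x -
        (U x * fderiv ℝ (cutoff P r t) x (J x) - cutoff P r t x * inner ℝ (Er x) (J x)) := i1.sub i3
    rw [integral_add i5 i6, integral_sub i1 i3, integral_neg, ← e1]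
    exact add_le_add h5 le_rfl
  · simp only [inner_add_left, inner_sub_left]
    ring

end IsRegularSolution

/-! ### The energy estimate -/

theorem mul_le_sq_add_sq (a b : ℝ) : a * b ≤ b ^ 2 + a ^ 2 := by
  nlinarith [sq_nonneg (a - b), sq_nonneg a, sq_nonneg b]

theorem integrand_le {C₀ cA CJ CU ε K r P p m k ρ U dζ : ℝ} {x a e j : R3} (hC₀ : 0 ≤ C₀)
    (hcA : 0 ≤ cA) (hCU : 0 ≤ CU) (hε : 0 ≤ ε) (hK : 0 ≤ K) (hr : 0 < r) (hP : 0 ≤ P)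
    (hm : 0 ≤ m) (hm1 : m ≤ 1) (hmr : m ≠ 0 → weightR x ≤ r) (hk : 0 ≤ k)
    (h0 : ‖a‖ * ‖j‖ ≤ C₀ * (‖a‖ ^ 2 + (1 + ‖a‖) * k)) (ha : ‖a‖ ≤ cA * weightR x ^ (-2 : ℝ))
    (hj : ‖j‖ ^ 2 ≤ CJ * k) (hU : |U| ≤ CU * weightR x ^ (-1 : ℝ))
    (he : ‖e‖ ≤ ε * weightR x ^ (-2 : ℝ)) (hρ : |ρ| ≤ K * weightR x ^ (-p))
    (hd : |dζ| ≤ 2 / r * m * ‖j‖) :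
    -(m ^ 2 * inner ℝ a j) - m ^ 2 * inner ℝ e j + -(2 * P / r) * m * ρ * U - U * dζ ≤
      (C₀ * (1 + cA) + ε * CJ + 2 * CU * r ^ (-(1 / 4) : ℝ) * CJ) * (m ^ 2 * k) +
      (C₀ * cA ^ 2 + ε) * weightR x ^ (-4 : ℝ) +
      2 * CU * r ^ (-(1 / 4) : ℝ) * weightR x ^ (-(7 / 2) : ℝ) +
      2 * P * K * CU / r * weightR x ^ (-p) := by
  have hx := weightR_pos x
  have hx2 := weightR_rpow_pos x (-2)
  have hx4 := weightR_rpow_pos x (-4)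
  have hxp := weightR_rpow_pos x (-p)
  have hx1 := weightR_rpow_pos x (-1)
  have e4 : (weightR x ^ (-2 : ℝ)) ^ 2 = weightR x ^ (-4 : ℝ) := by
    rw [← Real.rpow_natCast, ← Real.rpow_mul hx.le]; norm_num
  have hm2 : 0 ≤ m ^ 2 := by positivity
  have hm21 : m ^ 2 ≤ 1 := pow_le_one₀ hm hm1
  have hacA : ‖a‖ ≤ cA := ha.trans (by
    have := weightR_rpow_le_one x (a := -2) (by norm_num)
    nlinarith)
  have t1 : -(m ^ 2 * inner ℝ a j) ≤
      C₀ * (1 + cA) * (m ^ 2 * k) + C₀ * cA ^ 2 * weightR x ^ (-4 : ℝ) := by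
    have h1 : -(inner ℝ a j) ≤ ‖a‖ * ‖j‖ := by
      have := abs_real_inner_le_norm a j
      linarith [neg_abs_le (inner ℝ a j : ℝ)]
    have h2 : ‖a‖ ^ 2 ≤ cA ^ 2 * weightR x ^ (-4 : ℝ) := by
      calc ‖a‖ ^ 2 ≤ (cA * weightR x ^ (-2 : ℝ)) ^ 2 := by gcongr
        _ = _ := by rw [mul_pow, e4]
    calc -(m ^ 2 * inner ℝ a j) = m ^ 2 * -(inner ℝ a j) := by ring
      _ ≤ m ^ 2 * (C₀ * (cA ^ 2 * weightR x ^ (-4 : ℝ) + (1 + cA) * k)) := by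
        refine mul_le_mul_of_nonneg_left (h1.trans (h0.trans ?_)) hm2
        gcongr
      _ = C₀ * (1 + cA) * (m ^ 2 * k) + m ^ 2 * (C₀ * cA ^ 2 * weightR x ^ (-4 : ℝ)) := by ring
      _ ≤ _ := by
        have : 0 ≤ C₀ * cA ^ 2 * weightR x ^ (-4 : ℝ) := by positivity
        nlinarith
  have t2 : -(m ^ 2 * inner ℝ e j) ≤ ε * CJ * (m ^ 2 * k) + ε * weightR x ^ (-4 : ℝ) := by
    have h1 : -(inner ℝ e j) ≤ ‖e‖ * ‖j‖ := by
      have := abs_real_inner_le_norm e j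
      linarith [neg_abs_le (inner ℝ e j : ℝ)]
    have h2 : ‖e‖ * ‖j‖ ≤ ε * (CJ * k + weightR x ^ (-4 : ℝ)) := by
      calc ‖e‖ * ‖j‖ ≤ ε * weightR x ^ (-2 : ℝ) * ‖j‖ := by gcongr
        _ = ε * (weightR x ^ (-2 : ℝ) * ‖j‖) := by ring
        _ ≤ ε * (‖j‖ ^ 2 + weightR x ^ (-4 : ℝ)) := by
          rw [← e4]
          gcongr
          exact mul_le_sq_add_sq _ _
        _ ≤ _ := by gcongr
    calc -(m ^ 2 * inner ℝ e j) = m ^ 2 * -(inner ℝ e j) := by ring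
      _ ≤ m ^ 2 * (ε * (CJ * k + weightR x ^ (-4 : ℝ))) :=
        mul_le_mul_of_nonneg_left (h1.trans h2) hm2
      _ = ε * CJ * (m ^ 2 * k) + m ^ 2 * (ε * weightR x ^ (-4 : ℝ)) := by ring
      _ ≤ _ := by
        have : 0 ≤ ε * weightR x ^ (-4 : ℝ) := by positivity
        nlinarith
  have t3 : -(2 * P / r) * m * ρ * U ≤ 2 * P * K * CU / r * weightR x ^ (-p) := by
    have hx1' : weightR x ^ (-1 : ℝ) ≤ 1 := weightR_rpow_le_one x (by norm_num)
    have h1 : |-(2 * P / r) * m * ρ * U| = 2 * P / r * m * |ρ| * |U| := by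
      rw [abs_mul, abs_mul, abs_mul, abs_neg, abs_of_nonneg (by positivity : 0 ≤ 2 * P / r),
        abs_of_nonneg hm]
    calc -(2 * P / r) * m * ρ * U ≤ |-(2 * P / r) * m * ρ * U| := le_abs_self _
      _ = 2 * P / r * m * |ρ| * |U| := h1
      _ ≤ 2 * P / r * 1 * (K * weightR x ^ (-p)) * (CU * 1) := by
        have hU' : |U| ≤ CU * 1 := hU.trans (by gcongr)
        gcongr
      _ = _ := by ring
  have t4 : -(U * dζ) ≤ 2 * CU * r ^ (-(1 / 4) : ℝ) * CJ * (m ^ 2 * k) +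
      2 * CU * r ^ (-(1 / 4) : ℝ) * weightR x ^ (-(7 / 2) : ℝ) := by
    have hr4 : 0 < r ^ (-(1 / 4) : ℝ) := by positivity
    have hx7 := weightR_rpow_pos x (-(7 / 2))
    have hCJk : 0 ≤ CJ * k := (sq_nonneg _).trans hj
    rcases eq_or_ne m 0 with rfl | hm0
    · have : dζ = 0 := by
        have : |dζ| ≤ 0 := by simpa using hd
        exact abs_nonpos_iff.1 this
      rw [this]
      simp
      positivity
    · have hRr := hmr hm0
      have h1 : r⁻¹ * weightR x ^ (-1 : ℝ) ≤ r ^ (-(1 / 4) : ℝ) * weightR x ^ (-(7 / 4) : ℝ) := by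
        have e1 : r⁻¹ = r ^ (-(1 / 4) : ℝ) * r ^ (-(3 / 4) : ℝ) := by
          rw [← Real.rpow_add hr, ← Real.rpow_neg_one]; norm_num
        have e2 : weightR x ^ (-(7 / 4) : ℝ) = weightR x ^ (-(3 / 4) : ℝ) * weightR x ^ (-1 : ℝ) := by
          rw [← Real.rpow_add hx]; norm_num
        rw [e1, e2, mul_assoc]
        have : r ^ (-(3 / 4) : ℝ) ≤ weightR x ^ (-(3 / 4) : ℝ) :=
          Real.rpow_le_rpow_of_nonpos hx hRr (by norm_num)
        gcongr
      have e7 : (weightR x ^ (-(7 / 4) : ℝ)) ^ 2 = weightR x ^ (-(7 / 2) : ℝ) := by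
        rw [← Real.rpow_natCast, ← Real.rpow_mul hx.le]; norm_num
      have h2 : weightR x ^ (-(7 / 4) : ℝ) * (m * ‖j‖) ≤
          CJ * (m ^ 2 * k) + weightR x ^ (-(7 / 2) : ℝ) := by
        rw [← e7]
        have : m ^ 2 * ‖j‖ ^ 2 ≤ m ^ 2 * (CJ * k) := mul_le_mul_of_nonneg_left hj hm2
        refine (mul_le_sq_add_sq _ _).trans (add_le_add ?_ le_rfl)
        rw [mul_pow]
        linarith
      calc -(U * dζ) ≤ |U| * |dζ| := by rw [← abs_mul]; exact neg_le_abs _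
        _ ≤ (CU * weightR x ^ (-1 : ℝ)) * (2 / r * m * ‖j‖) := by gcongr
        _ = 2 * CU * ((r⁻¹ * weightR x ^ (-1 : ℝ)) * (m * ‖j‖)) := by ring
        _ ≤ 2 * CU * ((r ^ (-(1 / 4) : ℝ) * weightR x ^ (-(7 / 4) : ℝ)) * (m * ‖j‖)) := by gcongr
        _ = 2 * CU * r ^ (-(1 / 4) : ℝ) * (weightR x ^ (-(7 / 4) : ℝ) * (m * ‖j‖)) := by ring
        _ ≤ 2 * CU * r ^ (-(1 / 4) : ℝ) * (CJ * (m ^ 2 * k) + weightR x ^ (-(7 / 2) : ℝ)) := by gcongr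
        _ = _ := by ring
  linarith

theorem le_of_hasDerivAt_le_affine {H : ℝ → ℝ} {T a b : ℝ} (ha : 0 < a)
    (hc : ContinuousOn H (Icc 0 T))
    (hd : ∀ t ∈ Ioo 0 T, ∃ D, HasDerivAt H D t ∧ D ≤ a * H t + b) {t : ℝ} (ht : t ∈ Icc 0 T) :
    H t ≤ (H 0 + b / a) * Real.exp (a * t) - b / a := by
  have hd' : ∀ t ∈ Ioo 0 T, ∃ D ≤ 0,
      HasDerivAt (fun t => Real.exp (-(a * t)) * (H t + b / a)) D t := by
    intro t ht
    obtain ⟨D, hD, hle⟩ := hd t ht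
    have h1 : HasDerivAt (fun t : ℝ => Real.exp (-(a * t))) (Real.exp (-(a * t)) * -a) t := by
      have : HasDerivAt (fun t : ℝ => -(a * t)) (-a) t := by
        simpa using! ((hasDerivAt_id t).const_mul a).neg
      exact this.exp
    refine ⟨_, ?_, h1.mul (hD.add_const (b / a))⟩
    have e : Real.exp (-(a * t)) * -a * (H t + b / a) + Real.exp (-(a * t)) * D =
        Real.exp (-(a * t)) * (D - (a * H t + b)) := by field_simp; ring
    rw [e]
    exact mul_nonpos_of_nonneg_of_nonpos (Real.exp_nonneg _) (by linarith)
  have hanti : AntitoneOn (fun t => Real.exp (-(a * t)) * (H t + b / a)) (Icc 0 T) := by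
    refine antitoneOn_of_deriv_nonpos (convex_Icc 0 T) ?_ ?_ ?_
    · exact (by fun_prop : Continuous fun t : ℝ => Real.exp (-(a * t))).continuousOn.mul
        (hc.add continuousOn_const)
    · intro t ht
      rw [interior_Icc] at ht
      obtain ⟨D, -, hD⟩ := hd' t ht
      exact hD.differentiableAt.differentiableWithinAt
    · intro t ht
      rw [interior_Icc] at ht
      obtain ⟨D, hD0, hD⟩ := hd' t ht
      rw [hD.deriv]; exact hD0
  have h := hanti ⟨le_rfl, ht.1.trans ht.2⟩ ht ht.1
  simp only [mul_zero, neg_zero, Real.exp_zero, one_mul] at h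
  have h2 := mul_le_mul_of_nonneg_right h (Real.exp_nonneg (a * t))
  rw [mul_right_comm, ← Real.exp_add] at h2
  simp only [neg_add_cancel, Real.exp_zero, one_mul] at h2
  linarith

theorem norm_integral_le_of_norm_le_closedBall {g : R3 → ℝ} {B C : ℝ}
    (hg : ∀ v, |g v| ≤ C) (h0 : ∀ v, B < ‖v‖ → g v = 0) :
    |∫ v, g v| ≤ C * volume.real (Metric.closedBall (0 : R3) B) := by
  set S := Metric.closedBall (0 : R3) B with hS
  have hSm : MeasurableSet S := measurableSet_closedBall
  have hi : Integrable (S.indicator fun _ : R3 => C) :=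
    (integrable_indicator_iff hSm).2 (integrableOn_const (isCompact_closedBall _ _).measure_ne_top)
  have h := norm_integral_le_of_norm_le (f := g) hi (Filter.Eventually.of_forall fun v => ?_)
  · rw [integral_indicator hSm, setIntegral_const, smul_eq_mul, mul_comm] at h
    exact h
  · by_cases hv : v ∈ S
    · rw [indicator_of_mem hv]; exact hg v
    · rw [indicator_of_notMem hv, h0 v (not_le.1 (by simpa [hS] using hv)), norm_zero]

theorem IsEnergyInverse.exists_abs_relEnergy_le {F : R3 → ℝ} {W L : ℝ} {τ : ℝ → ℝ}
    (H : IsEnergyInverse F W L τ) (B S : ℝ) :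
    ∃ C : ℝ, 0 ≤ C ∧ ∀ (v : R3) (h : ℝ), ‖v‖ ≤ B → |F v| ≤ S → |h| ≤ S →
      |relEnergy F τ v h| ≤ C * |h - F v| := by
  obtain ⟨C, hC⟩ := (isCompact_Icc (a := -S) (b := S)).exists_bound_of_continuousOn
    H.continuous.continuousOn
  refine ⟨B ^ 2 / 2 + |C|, by positivity, fun v h hv hF hh => ?_⟩
  have hInt : ∀ p q : ℝ, IntervalIntegrable τ volume p q := fun p q =>
    H.continuous.intervalIntegrable p q
  unfold relEnergy
  rw [intervalIntegral.integral_interval_sub_left (hInt _ _) (hInt _ _)]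
  have h1 : |∫ u in F v..h, τ u| ≤ |C| * |h - F v| := by
    rw [← Real.norm_eq_abs (∫ u in F v..h, τ u)]
    refine intervalIntegral.norm_integral_le_of_norm_le_const fun u hu => ?_
    refine (hC u ?_).trans (le_abs_self C)
    have := uIoc_subset_uIcc hu
    exact uIcc_subset_Icc (abs_le.1 hF) (abs_le.1 hh) this
  have h2 : |‖v‖ ^ 2 / 2 * (h - F v)| ≤ B ^ 2 / 2 * |h - F v| := by
    rw [abs_mul, abs_of_nonneg (by positivity : 0 ≤ ‖v‖ ^ 2 / 2)]
    gcongr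
  calc _ ≤ |‖v‖ ^ 2 / 2 * (h - F v)| + |∫ u in F v..h, τ u| := abs_sub _ _
    _ ≤ _ := by linarith

theorem InitialCondition.exists_sub_le {F : R3 → ℝ} {f₀ : R3 → R3 → ℝ} (hF : Continuous F)
    (hf₀ : InitialCondition F f₀) :
    ∃ C : ℝ, 0 ≤ C ∧ ∀ x v, |F v - f₀ x v| ≤ C * weightR x ^ (-6 : ℝ) := by
  obtain ⟨B, hB⟩ := hf₀.compact_support
  obtain ⟨N, hN, C₁, hC₁⟩ := hf₀.decay
  have hc : Continuous fun z : R3 × R3 => F z.2 - f₀ z.1 z.2 :=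
    (hF.comp continuous_snd).sub hf₀.contDiff.continuous
  obtain ⟨C₂, hC₂⟩ := ((isCompact_closedBall (0 : R3) N).prod
    (isCompact_closedBall (0 : R3) B)).exists_bound_of_continuousOn hc.continuousOn
  refine ⟨|C₁| + |C₂| * (1 + N) ^ (6 : ℝ), by positivity, fun x v => ?_⟩
  have hx := weightR_pos x
  have hx6 := weightR_rpow_pos x (-6)
  have hN6 : 0 ≤ (1 + N) ^ (6 : ℝ) := by positivity
  rcases lt_or_ge N ‖x‖ with hxN | hxN
  · refine (hC₁ x v hxN).trans ?_
    gcongr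
    have := le_abs_self C₁
    have := mul_nonneg (abs_nonneg C₂) hN6
    linarith
  · rcases lt_or_ge B ‖v‖ with hvB | hvB
    · rw [hB x v hvB, abs_zero]; positivity
    · have h1 : |F v - f₀ x v| ≤ |C₂| := (hC₂ (x, v) ⟨by simpa using hxN, by simpa using hvB⟩).trans
        (le_abs_self C₂)
      have h2 : 1 ≤ (1 + N) ^ (6 : ℝ) * weightR x ^ (-6 : ℝ) := by
        rw [Real.rpow_neg hx.le, ← div_eq_mul_inv, one_le_div (by positivity)]
        exact Real.rpow_le_rpow hx.le ((weightR_le_one_add_norm x).trans (by linarith)) (by norm_num)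
      calc |F v - f₀ x v| ≤ |C₂| * 1 := by linarith
        _ ≤ |C₂| * ((1 + N) ^ (6 : ℝ) * weightR x ^ (-6 : ℝ)) := by gcongr
        _ = (|C₂| * (1 + N) ^ (6 : ℝ)) * weightR x ^ (-6 : ℝ) := by ring
        _ ≤ _ := by
          gcongr
          linarith [abs_nonneg C₁]

/-- The initial charge and relative energy densities decay like `R^{-6}`. -/
theorem InitialCondition.exists_initial_bound {F : R3 → ℝ} {f₀ : R3 → R3 → ℝ} {W L : ℝ} {τ : ℝ → ℝ}
    (hF : BackgroundCondition F) (H : IsEnergyInverse F W L τ) (hf₀ : InitialCondition F f₀) :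
    ∃ C : ℝ, 0 ≤ C ∧ ∀ f : ℝ → R3 → R3 → ℝ, (∀ x v, f 0 x v = f₀ x v) → ∀ x,
      |chargeDensity F f 0 x| ≤ C * weightR x ^ (-6 : ℝ) ∧
        energyDensity F τ f 0 x ≤ C * weightR x ^ (-6 : ℝ) := by
  obtain ⟨B, hB⟩ := hf₀.compact_support
  obtain ⟨C₁, hC₁, h₁⟩ := hf₀.exists_sub_le hF.contDiff.continuous
  obtain ⟨S, hS⟩ := (isCompact_closedBall (0 : R3) W).exists_bound_of_continuousOn
    hF.contDiff.continuous.continuousOn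
  have hFS : ∀ v, |F v| ≤ |S| := by
    intro v
    rcases le_total ‖v‖ W with hv | hv
    · exact (hS v (by simpa using hv)).trans (le_abs_self S)
    · rw [H.background_eq_zero v hv, abs_zero]; positivity
  obtain ⟨C₂, hC₂, h₂⟩ := H.exists_abs_relEnergy_le B (|S| + C₁)
  set V := volume.real (Metric.closedBall (0 : R3) B) with hV
  have hV0 : 0 ≤ V := measureReal_nonneg
  refine ⟨(1 + C₂) * C₁ * V, by positivity, fun f hf x => ?_⟩
  have hx6 := weightR_rpow_pos x (-6)
  have hx61 := weightR_rpow_le_one x (a := -6) (by norm_num)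
  have hq : 0 ≤ C₁ * weightR x ^ (-6 : ℝ) * V := by positivity
  constructor
  · have h := norm_integral_le_of_norm_le_closedBall (g := fun v => F v - f 0 x v) (B := B)
      (C := C₁ * weightR x ^ (-6 : ℝ)) (fun v => by rw [hf]; exact h₁ x v)
      (fun v hv => by rw [hf]; exact hB x v hv)
    refine h.trans ?_
    rw [← hV]
    nlinarith [mul_nonneg hC₂ hq]
  · have h := norm_integral_le_of_norm_le_closedBall (g := fun v => relEnergy F τ v (f 0 x v)) (B := B)
      (C := C₂ * (C₁ * weightR x ^ (-6 : ℝ))) (fun v => ?_) (fun v hv => ?_)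
    · refine (le_abs_self _).trans (h.trans ?_)
      rw [← hV]
      nlinarith [mul_nonneg hC₂ hq]
    · rw [hf]
      rcases lt_or_ge B ‖v‖ with hv | hv
      · rw [show f₀ x v = F v by linarith [hB x v hv], H.relEnergy_background, abs_zero]; positivity
      · have h3 : |f₀ x v| ≤ |S| + C₁ := by
          have e : f₀ x v = F v - (F v - f₀ x v) := by ring
          rw [e]
          refine (abs_sub _ _).trans (add_le_add (hFS v) ((h₁ x v).trans ?_))
          nlinarith
        refine (h₂ v _ hv ((hFS v).trans (by linarith)) h3).trans ?_
        rw [abs_sub_comm]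
        exact mul_le_mul_of_nonneg_left (h₁ x v) hC₂
    · rw [hf, show f₀ x v = F v by linarith [hB x v hv], H.relEnergy_background]

namespace IsRegularSolution

variable {p T P W L : ℝ} {F : R3 → ℝ} {τ : ℝ → ℝ} {f₀ : R3 → R3 → ℝ} {A : ℝ → R3 → R3}
  {f : ℝ → R3 → R3 → ℝ} {r δ : ℝ}

theorem integrable_cutoff_mul_energyDensity (h : IsRegularSolution p T P W L F τ f₀ A f) (hr : 0 < r)
    {t : ℝ} (ht : t ∈ Icc 0 T) : Integrable fun x => cutoff P r t x * energyDensity F τ f t x :=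
  ((contDiff_cutoff P r t).continuous.mul
    (h.continuous_energyDensity ht)).integrable_of_hasCompactSupport
      (hasCompactSupport_cutoff h.pos.le hr ht.1).mul_right

theorem localPotentialEnergy_nonneg (h : IsRegularSolution p T P W L F τ f₀ A f) (hr : 0 < r)
    (hδ : 0 < δ) {t : ℝ} (ht : t ∈ Icc 0 T) : 0 ≤ localPotentialEnergy F f P r δ t :=
  mul_nonneg (by norm_num) (integral_mul_regPotential_nonneg hδ (h.integrable_localCharge hr ht))

theorem abs_localCharge_le (h : IsRegularSolution p T P W L F τ f₀ A f) (hr : 0 < r)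
    {t : ℝ} (ht : t ∈ Icc 0 T) (x : R3) : |localCharge F f P r t x| ≤ |chargeDensity F f t x| := by
  rw [localCharge, abs_mul, abs_of_nonneg (cutoff_nonneg P r t x)]
  have := cutoff_le_one h.pos.le hr ht.1 x
  nlinarith [abs_nonneg (chargeDensity F f t x)]

/-- Bound on the initial localized energy by a constant depending on the initial data only. -/
theorem initial_energy_le (h : IsRegularSolution p T P W L F τ f₀ A f) (hT : 0 < T) (hr : 0 < r)
    (hδ : 0 < δ) {C V : ℝ} (hC : 0 ≤ C) (hV : 0 < V)
    (hVb : ∀ (K δ : ℝ) (σ : R3 → ℝ), 0 ≤ K → (∀ y, |σ y| ≤ K * weightR y ^ (-6 : ℝ)) →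
      ∀ x, |regPotential δ σ x| ≤ V * K * weightR x ^ (-1 : ℝ))
    (hρ : ∀ x, |chargeDensity F f 0 x| ≤ C * weightR x ^ (-6 : ℝ))
    (hk : ∀ x, energyDensity F τ f 0 x ≤ C * weightR x ^ (-6 : ℝ)) :
    localEnergy F τ f P r 0 + localPotentialEnergy F f P r δ 0 ≤
      (C + C * (V * C)) * ∫ x : R3, weightR x ^ (-6 : ℝ) := by
  have h0 : (0 : ℝ) ∈ Icc 0 T := ⟨le_rfl, hT.le⟩
  have i6 : Integrable fun x : R3 => weightR x ^ (-6 : ℝ) := integrable_weightR_rpow (by norm_num)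
  have h1 : localEnergy F τ f P r 0 ≤ C * ∫ x : R3, weightR x ^ (-6 : ℝ) := by
    rw [← integral_const_mul]
    refine integral_mono (h.integrable_cutoff_mul_energyDensity hr h0) (i6.const_mul C) fun x => ?_
    have := cutoff_le_one h.pos.le hr le_rfl x (t := 0)
    have := cutoff_nonneg P r 0 x
    have := h.energyDensity_nonneg h0 x
    have := hk x
    simp only
    nlinarith
  have hσ : ∀ x, |localCharge F f P r 0 x| ≤ C * weightR x ^ (-6 : ℝ) := fun x =>
    (h.abs_localCharge_le hr h0 x).trans (hρ x)
  have h2 : ∫ x, localCharge F f P r 0 x * regPotential δ (localCharge F f P r 0) x ≤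
      (C * (V * C)) * ∫ x : R3, weightR x ^ (-6 : ℝ) := by
    rw [← integral_const_mul]
    refine (Real.le_norm_self _).trans (norm_integral_le_of_norm_le (i6.const_mul (C * (V * C)))
      (Filter.Eventually.of_forall fun x => ?_))
    rw [norm_mul, Real.norm_eq_abs, Real.norm_eq_abs]
    have hU := hVb C δ _ hC hσ x
    have hx1 := weightR_rpow_le_one x (a := -1) (by norm_num)
    have hx6 := weightR_rpow_pos x (-6)
    calc _ ≤ (C * weightR x ^ (-6 : ℝ)) * (V * C * 1) := by
          have hσx := hσ x
          have hU' := hU.trans (mul_le_mul_of_nonneg_left hx1 (by positivity : 0 ≤ V * C))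
          gcongr
      _ = _ := by ring
  have h3 : 0 ≤ ∫ x, localCharge F f P r 0 x * regPotential δ (localCharge F f P r 0) x :=
    integral_mul_regPotential_nonneg hδ (h.integrable_localCharge hr h0)
  rw [localPotentialEnergy]
  linarith

end IsRegularSolution

/-- The total localized energy satisfies a linear differential inequality whose coefficients do
not depend on the solution, provided the localization is wide enough. -/
theorem IsRegularSolution.eventually_total_deriv_le {p T P W L : ℝ} {F : R3 → ℝ} {τ : ℝ → ℝ}
    {f₀ : R3 → R3 → ℝ} {A : ℝ → R3 → R3} {f : ℝ → R3 → R3 → ℝ} {C₀ cA : ℝ} (hp : p ∈ Ioo (3 : ℝ) 4)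
    (h : IsRegularSolution p T P W L F τ f₀ A f) (hC₀ : 0 < C₀) (hcA : 0 ≤ cA)
    (hmom : ∀ t ∈ Icc 0 T, ∀ x, ∀ l, 0 ≤ l → l * ∫ v, (1 + ‖v‖) * |f t x v - F v| ≤
      C₀ * (l ^ 2 + (1 + l) * energyDensity F τ f t x))
    (hAb : ∀ t, 0 ≤ t → ∀ x, ‖A t x‖ ≤ cA * weightR x ^ (-2 : ℝ)) :
    ∀ᶠ r : ℝ in Filter.atTop, ∀ t ∈ Ioo 0 T, ∃ D,
      HasDerivAt (fun s => localEnergy F τ f P r s + localPotentialEnergy F f P r r⁻¹ s) D t ∧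
      D ≤ (C₀ * (1 + cA) + 2) * (localEnergy F τ f P r t + localPotentialEnergy F f P r r⁻¹ t) +
        ((C₀ * cA ^ 2 + 1) * (∫ x : R3, weightR x ^ (-4 : ℝ)) +
          (∫ x : R3, weightR x ^ (-(7 / 2) : ℝ)) + ∫ x : R3, weightR x ^ (-p)) := by
  obtain ⟨K, hK⟩ := h.sol.density_bounded
  have hρ : ∀ t ∈ Icc 0 T, ∀ y, |chargeDensity F f t y| ≤ K * weightR y ^ (-p) := fun t ht y =>
    abs_le_of_weightedNorm_le (hK t ht) y
  have hK0 : (0 : ℝ) ≤ K := K.2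
  have hρK : ∀ t ∈ Icc 0 T, ∀ y, |chargeDensity F f t y| ≤ K := fun t ht y =>
    (hρ t ht y).trans (mul_le_of_le_one_right hK0 (weightR_rpow_le_one y (by linarith [hp.1])))
  obtain ⟨CV, hCV, hV⟩ := exists_abs_regPotential_le hp.1
  obtain ⟨CE, hCE, hE⟩ := exists_norm_field_sub_regField_le (a := p) (α := (p - 3) / 2)
    (by linarith [hp.1]) (by linarith [hp.1])
  have hP := h.pos
  set CU := CV * K with hCUdef
  have hCU : 0 ≤ CU := by positivity
  set CJ := 4 * C₀ ^ 2 + 2 * C₀ * (P * ((∫ v, F v) + K)) with hCJ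
  set ε : ℝ → ℝ := fun r => CE * K * (2 * (1 + P * T) * r ^ (-((p - 3) / 2)) + r⁻¹ ^ (1 / 2 : ℝ))
    with hεdef
  have l1 : Filter.Tendsto (fun r : ℝ => r ^ (-((p - 3) / 2))) Filter.atTop (nhds 0) :=
    tendsto_rpow_neg_atTop (by linarith [hp.1])
  have l2 : Filter.Tendsto (fun r : ℝ => r ^ (-(1 / 4) : ℝ)) Filter.atTop (nhds 0) :=
    tendsto_rpow_neg_atTop (by norm_num)
  have l3 : Filter.Tendsto (fun r : ℝ => r⁻¹) Filter.atTop (nhds 0) := tendsto_inv_atTop_zero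
  have l4 : Filter.Tendsto (fun r : ℝ => r⁻¹ ^ (1 / 2 : ℝ)) Filter.atTop (nhds 0) := by
    have := l3.rpow_const (p := (1 / 2 : ℝ)) (Or.inr (by norm_num))
    rwa [Real.zero_rpow (by norm_num)] at this
  have lε : Filter.Tendsto ε Filter.atTop (nhds 0) := by
    have := ((l1.const_mul (2 * (1 + P * T))).add l4).const_mul (CE * K)
    rwa [mul_zero, add_zero, mul_zero] at this
  have lim : ∀ {u : ℝ → ℝ} (c : ℝ), Filter.Tendsto u Filter.atTop (nhds 0) →
      ∀ᶠ r in Filter.atTop, c * u r ≤ 1 := fun c hu => by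
    have h0 := hu.const_mul c
    rw [mul_zero] at h0
    exact h0.eventually_le_const zero_lt_one
  filter_upwards [Filter.eventually_gt_atTop 0, lim 1 lε, lim CJ lε, lim (2 * CU) l2,
    lim (2 * CU * CJ) l2, lim (2 * P * K * CU) l3] with r hr e1 e2 e3 e4 e5 t ht
  have ht' := Ioo_subset_Icc_self ht
  have hδ : 0 < r⁻¹ := inv_pos.2 hr
  obtain ⟨D, hD, X, hX, hDX, hXe⟩ := h.exists_hasDerivAt_total hr hδ ht
  refine ⟨D, hD, ?_⟩
  have hPT : 0 ≤ P * T := mul_nonneg hP.le (ht.1.trans ht.2).le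
  have hε : 0 ≤ ε r := by simp only [hεdef]; positivity
  have i4 : Integrable fun x : R3 => weightR x ^ (-4 : ℝ) := integrable_weightR_rpow (by norm_num)
  have i7 : Integrable fun x : R3 => weightR x ^ (-(7 / 2) : ℝ) :=
    integrable_weightR_rpow (by norm_num)
  have ip : Integrable fun x : R3 => weightR x ^ (-p) := integrable_weightR_rpow hp.1
  have ik := h.integrable_cutoff_mul_energyDensity hr ht'
  have hpt : ∀ x, X x ≤ (C₀ * (1 + cA) + 2) * (cutoff P r t x * energyDensity F τ f t x) +
      (C₀ * cA ^ 2 + 1) * weightR x ^ (-4 : ℝ) + weightR x ^ (-(7 / 2) : ℝ) + weightR x ^ (-p) := by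
    intro x
    have hk := h.energyDensity_nonneg ht' x
    have hm := cutRoot_nonneg P r t x
    have hj : ‖current F f t x‖ ^ 2 ≤ CJ * energyDensity F τ f t x := by
      refine sq_le_of_forall_mul_le hC₀ (hmom t ht' x) hk ?_ ?_
      · rw [abs_norm]; exact h.norm_current_le ht' x
      · rw [abs_norm]
        refine (h.norm_current_le_of_density ht' x).trans ?_
        have := hρK t ht' x
        gcongr
    have hb := integrand_le (p := p) (K := K) hC₀.le hcA hCU hε hK0 hr hP.le hm
      (cutRoot_le_one hP.le hr ht.1.le x)
      (fun hne => le_of_not_ge fun hle => hne (cutRoot_eq_zero hP.le hr ht.1.le hle)) hk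
      ((mul_le_mul_of_nonneg_left (h.norm_current_le ht' x) (norm_nonneg (A t x))).trans
        (hmom t ht' x _ (norm_nonneg _)))
      (hAb t ht.1.le x) hj
      (hV K r⁻¹ (localCharge F f P r t) hK0
        (fun y => (h.abs_localCharge_le hr ht' y).trans (hρ t ht' y)) x)
      (hE K (2 * (1 + P * T)) (r ^ (-((p - 3) / 2))) r⁻¹ (chargeDensity F f t) (cutoff P r t) hK0
        (by positivity) (by positivity) hδ (hρ t ht') (cutoff_nonneg P r t)
        (cutoff_le_one hP.le hr ht.1.le)
        (fun y => one_sub_cutoff_le hP.le hr ht' y (by linarith [hp.1]) (by linarith [hp.2]))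
        (h.integrable_localCharge hr ht') x (h.sol.integrable_field t ht' x))
      (hρ t ht' x)
      (((fderiv ℝ (cutoff P r t) x).le_opNorm (current F f t x)).trans
        (mul_le_mul_of_nonneg_right (norm_fderiv_cutoff_le P hr t x) (norm_nonneg _)))
    rw [hXe x]
    refine hb.trans ?_
    have hmk : 0 ≤ cutRoot P r t x ^ 2 * energyDensity F τ f t x := by positivity
    have hc1 : C₀ * (1 + cA) + ε r * CJ + 2 * CU * r ^ (-(1 / 4) : ℝ) * CJ ≤
        C₀ * (1 + cA) + 2 := by linarith
    have hc2 : C₀ * cA ^ 2 + ε r ≤ C₀ * cA ^ 2 + 1 := by linarith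
    have hc3 : 2 * P * K * CU / r ≤ 1 := by rw [div_eq_mul_inv]; exact e5
    have p4 := mul_le_mul_of_nonneg_right hc2 (weightR_rpow_pos x (-4)).le
    have p7 := mul_le_mul_of_nonneg_right e3 (weightR_rpow_pos x (-(7 / 2))).le
    have pp := mul_le_mul_of_nonneg_right hc3 (weightR_rpow_pos x (-p)).le
    have pk := mul_le_mul_of_nonneg_right hc1 hmk
    rw [one_mul] at p7 pp
    exact add_le_add (add_le_add (add_le_add pk p4) p7) pp
  have j1 := ik.const_mul (C₀ * (1 + cA) + 2)
  have j2 := i4.const_mul (C₀ * cA ^ 2 + 1)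
  have hI := integral_mono hX (((j1.add j2).add i7).add ip) hpt
  have eI : ∫ x, ((C₀ * (1 + cA) + 2) * (cutoff P r t x * energyDensity F τ f t x) +
      (C₀ * cA ^ 2 + 1) * weightR x ^ (-4 : ℝ) + weightR x ^ (-(7 / 2) : ℝ) + weightR x ^ (-p)) =
      (C₀ * (1 + cA) + 2) * localEnergy F τ f P r t +
      (C₀ * cA ^ 2 + 1) * (∫ x : R3, weightR x ^ (-4 : ℝ)) +
      (∫ x : R3, weightR x ^ (-(7 / 2) : ℝ)) + ∫ x : R3, weightR x ^ (-p) := by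
    have k2 : Integrable fun x => (C₀ * (1 + cA) + 2) * (cutoff P r t x * energyDensity F τ f t x) +
      (C₀ * cA ^ 2 + 1) * weightR x ^ (-4 : ℝ) := j1.add j2
    have k3 : Integrable fun x => (C₀ * (1 + cA) + 2) * (cutoff P r t x * energyDensity F τ f t x) +
      (C₀ * cA ^ 2 + 1) * weightR x ^ (-4 : ℝ) + weightR x ^ (-(7 / 2) : ℝ) := k2.add i7
    rw [integral_add k3 ip, integral_add k2 i7, integral_add j1 j2,
      integral_const_mul, integral_const_mul, localEnergy]
  have hpot := mul_nonneg (by positivity : 0 ≤ C₀ * (1 + cA) + 2)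
    (h.localPotentialEnergy_nonneg hr hδ ht')
  have hfin := hDX.trans (hI.trans eI.le)
  linarith

/-- The localized relative energy is bounded by a constant that depends only on the data. -/
theorem exists_eventually_localEnergy_le {p T W L : ℝ} {F : R3 → ℝ} {τ : ℝ → ℝ}
    {f₀ : R3 → R3 → ℝ} {A : ℝ → R3 → R3} (hp : p ∈ Ioo (3 : ℝ) 4) (hT : 0 < T)
    (hF : BackgroundCondition F) (hτ : IsEnergyInverse F W L τ) (hf₀ : InitialCondition F f₀)
    (hA : AppliedFieldCondition p T A) {C₀ : ℝ} (hC₀ : 0 < C₀) :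
    ∃ Λ : ℝ, ∀ (f : ℝ → R3 → R3 → ℝ) (P : ℝ), IsRegularSolution p T P W L F τ f₀ A f →
      (∀ t ∈ Icc 0 T, ∀ x, ∀ l, 0 ≤ l → l * ∫ v, (1 + ‖v‖) * |f t x v - F v| ≤
        C₀ * (l ^ 2 + (1 + l) * energyDensity F τ f t x)) →
      ∀ᶠ r : ℝ in Filter.atTop, ∀ t ∈ Icc 0 T, localEnergy F τ f P r t ≤ Λ := by
  obtain ⟨cA, hcA⟩ := hA.decay
  obtain ⟨Ci, hCi, hi⟩ := InitialCondition.exists_initial_bound hF hτ hf₀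
  obtain ⟨V, hV, hVb⟩ := exists_abs_regPotential_le (a := 6) (by norm_num)
  have hAb : ∀ t, 0 ≤ t → ∀ x, ‖A t x‖ ≤ |cA| * weightR x ^ (-2 : ℝ) := fun t ht x =>
    (hcA t ht x).trans
      (mul_le_mul_of_nonneg_right (le_abs_self _) (weightR_rpow_pos x (-2)).le)
  have hw : ∀ a : ℝ, 0 ≤ ∫ x : R3, weightR x ^ a := fun a =>
    integral_nonneg fun x => (weightR_rpow_pos x a).le
  set α := C₀ * (1 + |cA|) + 2 with hα
  set β := (C₀ * |cA| ^ 2 + 1) * (∫ x : R3, weightR x ^ (-4 : ℝ)) +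
    (∫ x : R3, weightR x ^ (-(7 / 2) : ℝ)) + ∫ x : R3, weightR x ^ (-p) with hβ
  have hα0 : 0 < α := by positivity
  have hβ0 : 0 ≤ β := by
    have := hw (-4)
    have := hw (-(7 / 2))
    have := hw (-p)
    positivity
  set H₀ := (Ci + Ci * (V * Ci)) * ∫ x : R3, weightR x ^ (-6 : ℝ) with hH₀
  have hH₀0 : 0 ≤ H₀ := mul_nonneg (by positivity) (hw _)
  refine ⟨(H₀ + β / α) * Real.exp (α * T), fun f P h hmom => ?_⟩
  filter_upwards [Filter.eventually_gt_atTop 0,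
    h.eventually_total_deriv_le hp hC₀ (abs_nonneg cA) hmom hAb] with r hr hd t ht
  have hδ : 0 < r⁻¹ := inv_pos.2 hr
  have hG := le_of_hasDerivAt_le_affine hα0
    ((h.continuousOn_localEnergy hr).add (h.continuousOn_localPotentialEnergy hr hδ)) hd ht
  have h0 := h.initial_energy_le hT hr hδ hCi hV hVb (fun x => (hi f h.sol.initial x).1)
    (fun x => (hi f h.sol.initial x).2)
  have hpot := h.localPotentialEnergy_nonneg hr hδ ht
  have hba : 0 ≤ β / α := by positivity
  have hexp : Real.exp (α * t) ≤ Real.exp (α * T) :=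
    Real.exp_le_exp.2 (mul_le_mul_of_nonneg_left ht.2 hα0.le)
  have h1 : (localEnergy F τ f P r 0 + localPotentialEnergy F f P r r⁻¹ 0 + β / α) *
      Real.exp (α * t) ≤ (H₀ + β / α) * Real.exp (α * T) :=
    mul_le_mul (by linarith) hexp (Real.exp_nonneg _) (by linarith)
  simp only [Pi.add_apply] at hG
  linarith

/-- The squared charge density has an integral bounded in terms of the data and the supremum of the
charge density. -/
theorem exists_integral_sq_chargeDensity_le {p T : ℝ} {F : R3 → ℝ} {f₀ : R3 → R3 → ℝ}
    {A : ℝ → R3 → R3} (hp : p ∈ Ioo (3 : ℝ) 4) (hT : 0 < T) (hF : BackgroundCondition F)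
    (hf₀ : InitialCondition F f₀) (hA : AppliedFieldCondition p T A) (M : ℝ) :
    ∃ I : ℝ, ∀ f : ℝ → R3 → R3 → ℝ, IsVlasovPoissonSolution p T F f₀ A f →
      ∀ t ∈ Icc 0 T, (∀ x, |chargeDensity F f t x| ≤ M) →
        Integrable (fun x => chargeDensity F f t x ^ 2) ∧
          ∫ x, chargeDensity F f t x ^ 2 ≤ I := by
  obtain ⟨W, L, τ, hτ⟩ := hF.exists_isEnergyInverse
  obtain ⟨C₀, hC₀, hmom⟩ := hτ.exists_moment_bound
  obtain ⟨Λ, hΛ⟩ := exists_eventually_localEnergy_le hp hT hF hτ hf₀ hA hC₀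
  refine ⟨(4 * C₀ ^ 2 + 2 * C₀ * M) * Λ, fun f hf t ht hM => ?_⟩
  obtain ⟨P, hP, hFP, hfP⟩ := hf.exists_velocity_bound hp.1 hT hF hf₀ hA
  have h : IsRegularSolution p T P W L F τ f₀ A f :=
    ⟨hF, hτ, hf, ⟨hf.contDiff, hfP⟩, hP, hFP⟩
  have hmom' : ∀ t ∈ Icc 0 T, ∀ x, ∀ l, 0 ≤ l → l * ∫ v, (1 + ‖v‖) * |f t x v - F v| ≤
      C₀ * (l ^ 2 + (1 + l) * energyDensity F τ f t x) := fun t ht x =>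
    hmom (f t x) (hf.nonneg t ht x) (h.integrable_relEnergy ht x) (h.integrable_absMoment ht x)
  have hM0 : 0 ≤ M := (abs_nonneg _).trans (hM 0)
  have hsq : ∀ x, chargeDensity F f t x ^ 2 ≤
      (4 * C₀ ^ 2 + 2 * C₀ * M) * energyDensity F τ f t x := fun x =>
    sq_le_of_forall_mul_le hC₀ (hmom' t ht x) (h.energyDensity_nonneg ht x)
      (h.abs_chargeDensity_le ht x) (hM x)
  obtain ⟨K, hK⟩ := hf.density_bounded
  have hρc := h.continuous_chargeDensity ht
  have hInt : Integrable fun x => chargeDensity F f t x ^ 2 := by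
    refine ((integrable_weightR_rpow hp.1).const_mul (M * K)).mono'
      (hρc.pow 2).aestronglyMeasurable (Filter.Eventually.of_forall fun x => ?_)
    rw [Real.norm_eq_abs, abs_pow, sq, mul_assoc]
    exact mul_le_mul (hM x) (abs_le_of_weightedNorm_le (hK t ht) x) (abs_nonneg _) hM0
  refine ⟨hInt, ?_⟩
  have hlim : Filter.Tendsto (fun r => ∫ x, cutoff P r t x * chargeDensity F f t x ^ 2)
      Filter.atTop (nhds (∫ x, chargeDensity F f t x ^ 2)) := by
    refine tendsto_integral_filter_of_dominated_convergence
      (fun x => chargeDensity F f t x ^ 2) ?_ ?_ hInt ?_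
    · exact Filter.Eventually.of_forall fun r =>
        ((contDiff_cutoff P r t).continuous.mul (hρc.pow 2)).aestronglyMeasurable
    · filter_upwards [Filter.eventually_gt_atTop 0] with r hr
      refine Filter.Eventually.of_forall fun x => ?_
      rw [norm_mul, Real.norm_of_nonneg (cutoff_nonneg P r t x),
        Real.norm_of_nonneg (sq_nonneg _)]
      exact mul_le_of_le_one_left (sq_nonneg _) (cutoff_le_one hP.le hr ht.1 x)
    · refine Filter.Eventually.of_forall fun x => ?_
      have h1 : Filter.Tendsto (fun r : ℝ => (weightR x + P * t) / r) Filter.atTop (nhds 0) :=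
        tendsto_const_nhds.div_atTop Filter.tendsto_id
      have h2 : Filter.Tendsto (fun r => cutoff P r t x) Filter.atTop (nhds 1) := by
        have := ((h1.const_sub 1).max (tendsto_const_nhds (x := (0 : ℝ)))).pow 2
        simpa [cutoff, cutRoot] using this
      simpa using h2.mul_const (chargeDensity F f t x ^ 2)
  refine le_of_tendsto hlim ?_
  filter_upwards [Filter.eventually_gt_atTop 0, hΛ f P h hmom'] with r hr hle
  have hcoef : 0 ≤ 4 * C₀ ^ 2 + 2 * C₀ * M := by positivity
  calc ∫ x, cutoff P r t x * chargeDensity F f t x ^ 2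
      ≤ ∫ x, (4 * C₀ ^ 2 + 2 * C₀ * M) * (cutoff P r t x * energyDensity F τ f t x) := by
        refine integral_mono ?_ ((h.integrable_cutoff_mul_energyDensity hr ht).const_mul _)
          fun x => ?_
        · exact ((contDiff_cutoff P r t).continuous.mul
            (hρc.pow 2)).integrable_of_hasCompactSupport
              (hasCompactSupport_cutoff hP.le hr ht.1).mul_right
        · have := mul_le_mul_of_nonneg_left (hsq x) (cutoff_nonneg P r t x)
          simp only
          linarith
    _ = (4 * C₀ ^ 2 + 2 * C₀ * M) * localEnergy F τ f P r t := by
        rw [integral_const_mul, localEnergy]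
    _ ≤ _ := mul_le_mul_of_nonneg_left (hle t ht) hcoef

theorem abs_le_of_supNorm_le {g : R3 → ℝ} {M : ℝ≥0} (h : supNorm g ≤ M) (x : R3) : |g x| ≤ M := by
  have h1 : ENNReal.ofReal |g x| ≤ M := (le_iSup (fun x => ENNReal.ofReal |g x|) x).trans h
  rw [← ENNReal.ofReal_coe_nnreal] at h1
  exact (ENNReal.ofReal_le_ofReal_iff M.2).1 h1

theorem lemma2 (p T : ℝ) (hp : p ∈ Set.Ioo (3 : ℝ) 4) (hT : 0 < T)
    (F : R3 → ℝ) (f₀ : R3 → R3 → ℝ) (A : ℝ → R3 → R3)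
    (hF : BackgroundCondition F) (hf₀ : InitialCondition F f₀)
    (hA : AppliedFieldCondition p T A)
    (q b : ℝ) (hq : 0 < q) (hb : b ∈ Set.Ico (0 : ℝ) (5 / 18)) (hbq : b ≤ 2 / q) (M : ℝ≥0) :
    ∃ C : ℝ≥0, ∀ f : ℝ → R3 → R3 → ℝ, IsVlasovPoissonSolution p T F f₀ A f →
      ∀ t ∈ Set.Icc 0 T, supNorm (chargeDensity F f t) ≤ M →
        ∀ x : R3, 1 ≤ ‖x‖ →
          ENNReal.ofReal ‖electricField F f t x‖ ≤
            C * (weightedNorm q (chargeDensity F f t) *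
              ENNReal.ofReal (weightR x ^ (-q))) ^ b := by
  obtain ⟨I, hI⟩ := exists_integral_sq_chargeDensity_le hp hT hF hf₀ hA M
  have hqb : q * b ≤ 2 := by rw [le_div_iff₀ hq] at hbq; linarith
  obtain ⟨C, hC, hfield⟩ := exists_norm_field_le (M := M) (I := I) hb.1
    (by linarith [hb.2]) (mul_nonneg hq.le hb.1) hqb
  refine ⟨C.toNNReal, fun f hf t ht hM x _ => ?_⟩
  have hMb := abs_le_of_supNorm_le hM
  obtain ⟨hInt, hle⟩ := hI f hf t ht hMb
  have key : ∀ Q, 0 ≤ Q → (∀ y, |chargeDensity F f t y| ^ b ≤ Q * weightR y ^ (-(q * b))) →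
      ‖electricField F f t x‖ ≤ C * (Q * weightR x ^ (-(q * b))) := fun Q hQ h =>
    hfield _ hMb hInt hle Q hQ h x
  have hw : ∀ y : R3, weightR y ^ (-(q * b)) = (weightR y ^ (-q)) ^ b := fun y => by
    rw [← Real.rpow_mul (weightR_pos y).le, neg_mul]
  change _ ≤ ENNReal.ofReal C * _
  rcases hb.1.eq_or_lt with rfl | hb0
  · rw [ENNReal.rpow_zero, mul_one]
    have := key 1 zero_le_one fun y => by simp
    exact ENNReal.ofReal_le_ofReal (by simpa using this)
  · rcases eq_or_ne (weightedNorm q (chargeDensity F f t)) ⊤ with htop | htop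
    · have hx := ENNReal.ofReal_pos.2 (weightR_rpow_pos x (-q))
      rw [htop, ENNReal.top_mul hx.ne', ENNReal.top_rpow_of_pos hb0,
        ENNReal.mul_top (ENNReal.ofReal_pos.2 hC).ne']
      exact le_top
    · obtain ⟨d, hd⟩ := WithTop.ne_top_iff_exists.1 htop
      change (d : ℝ≥0∞) = _ at hd
      have hdb : ∀ y, |chargeDensity F f t y| ≤ d * weightR y ^ (-q) :=
        abs_le_of_weightedNorm_le hd.symm.le
      have h1 := key ((d : ℝ) ^ b) (by positivity) fun y => by
        rw [hw, ← Real.mul_rpow d.coe_nonneg (weightR_rpow_pos y (-q)).le]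
        exact Real.rpow_le_rpow (abs_nonneg _) (hdb y) hb0.le
      rw [hw, ← Real.mul_rpow d.coe_nonneg (weightR_rpow_pos x (-q)).le] at h1
      rw [← hd, ← ENNReal.ofReal_coe_nnreal, ← ENNReal.ofReal_mul d.coe_nonneg,
        ENNReal.ofReal_rpow_of_nonneg (mul_nonneg d.coe_nonneg (weightR_rpow_pos x (-q)).le) hb0.le,
        ← ENNReal.ofReal_mul hC.le]
      exact ENNReal.ofReal_le_ofReal h1
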